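/- **Setting.** Let $(\Omega,\mathcal F,\pi,(\tau_z)_{z\in\mathbb Z^d})$ be a probability space with an ergodic measure preserving $\mathbb Z^d$-action, and let $\mathcal N=\{k\in\mathbb Z^d:|k|=1\}$. Let $p_k:\Omega\to[0,\infty)$, $k\in\mathcal N$, be measurable with $\sum_k p_k(\omega)=\sum_k p_{-k}(\tau_k\omega)$ a.s., and put $$s_k(\omega)=\tfrac12\big(p_k(\omega)+p_{-k}(\tau_k\omega)\big),\qquad b_k(\omega)=\tfrac12\big(p_k(\omega)-p_{-k}(\tau_k\omega)\big),\qquad r_k=\sqrt{s_k}.$$ Assume $s_k>0$ a.s., and that there are measurable $h_{k,l}:\Omega\to\mathbb R$, $k,l\in\mathcal N$, with, a.s., $h_{k,l}(\omega)=-h_{-k,l}(\tau_k\omega)=-h_{k,-l}(\tau_l\omega)=-h_{l,k}(\omega)$ and $b_k=\sum_l h_{k,l}$. Let $\mathcal L_2$ be the real Hilbert space of centred functions in $L^2(\pi)$. Let $\mathcal V_2$ be the Hilbert space of families $u=(u_k)_{k\in\mathcal N}$ in $L^2(\pi)$ with $u_k(\omega)+u_{-k}(\tau_k\omega)=0$,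 with inner product $\langle u,v\rangle=\frac12\sum_k\int u_kv_k\,d\pi$. For $K<\infty$ let $\Omega_K$ be the set of $\omega$ with $r_k(\omega)^{\pm1},\,r_k(\tau_m\omega)^{\pm1},\,|h_{k,l}(\omega)|,\,|h_{k,l}(\tau_m\omega)|\le K$ for all $k,l,m\in\mathcal N$, and let $\mathcal A$ be the space of essentially bounded $f\in\mathcal L_2$ that vanish a.s. outside some $\Omega_K$. Put $$(\nabla f)_k=f\circ\tau_k-f,\quad (Ru)_k=r_ku_k,\quad (Hu)_k=\tfrac12\sum_{l}h_{k,l}\,(u_l\circ\tau_k+u_l),\quad Af=\sum_k b_k\,(f\circ\tau_k-f)\ \ (f\in\mathcal A).$$ Let $S=\overline{R\nabla}^{\,*}\,\overline{R\nabla}$, where $\overline{R\nabla}$ is the closure of $R\nabla:\mathcal A\to\mathcal V_2$; that is, $S$ is the operator of the closed quadratic form $\frac12\sum_k\int s_k(f\circ\tau_k-f)^2\,d\pi$. **Statement.** Assume $r_k\in L^2(\pi)$ for all $k$. Then: 1. $R\nabla$ maps $\mathcal A$ into $\mathcal V_2$ and $A$ maps $\mathcal A$ into $\mathcal L_2$.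 The operator $S$ is self-adjoint, $\mathcal A\subset\mathrm{Dom}(S)$, and $Sf=-\sum_k s_k(f\circ\tau_k-f)$ for $f\in\mathcal A$. The positive self-adjoint square root $S^{1/2}$ exists, is injective, and $\mathcal A\subset\mathrm{Dom}(S^{1/2})$. 2. $\mathcal C:=S^{1/2}\mathcal A$ is dense in $\mathcal L_2$, and the operator $B=S^{-1/2}AS^{-1/2}$ (with $A$ defined on $\mathcal A$) has domain exactly $\mathcal C$. 3. There is a linear isometry $\Lambda$ from $\mathcal L_2$ to square integrable fields with $\Lambda S^{1/2}g=R\nabla g$ for $g\in\mathcal A$ (that is, $\Lambda=R\nabla S^{-1/2}$), and $Bf=\Lambda^*\,R^{-1}HR^{-1}\,\Lambda f$ for all $f\in\mathcal C$. 4. $B$ is skew-symmetric. 5. If moreover $(r_k)^{-1}\in L^2(\pi)$ and $(r_l)^{-1}h_{k,l}\in L^2(\pi)$ for all $k,l\in\mathcal N$, then $B:\mathcal C\to\mathcal L_2$ is essentially skew-self-adjoint: it is densely defined and closable, and $\overline B=-B^*$. -/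

import Mathlib

open MeasureTheory Filter
open scoped BigOperators InnerProductSpace ENNReal

noncomputable section

namespace RandomEnv

/-! ### Unbounded operators on Hilbert spaces -/

section Operators

variable {E F G : Type*}
  [NormedAddCommGroup E] [InnerProductSpace ℝ E]
  [NormedAddCommGroup F] [InnerProductSpace ℝ F]
  [NormedAddCommGroup G] [InnerProductSpace ℝ G]

/-- The composition `g ∘ f` of two partially defined operators on its natural domain
`{x ∈ Dom f : f x ∈ Dom g}`. -/
def pcomp (g : F →ₗ.[ℝ] G) (f : E →ₗ.[ℝ] F) : E →ₗ.[ℝ] G where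
  domain := (g.domain.comap f.toFun).map f.domain.subtype
  toFun :=
    { toFun := fun x => g ⟨f ⟨x.1, by
          obtain ⟨y, _, hyx⟩ := x.2
          rw [← hyx]; exact y.2⟩, by
          obtain ⟨y, hy, hyx⟩ := x.2
          have : (⟨x.1, by rw [← hyx]; exact y.2⟩ : f.domain) = y := Subtype.ext hyx.symm
          rw [this]; exact hy⟩
      map_add' := fun x y => by
        rw [← LinearPMap.map_add]
        congr 1
        apply Subtype.ext
        exact LinearPMap.map_add f ⟨x.1, _⟩ ⟨y.1, _⟩
      map_smul' := fun c x => by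
        rw [RingHom.id_apply, ← LinearPMap.map_smul]
        congr 1
        apply Subtype.ext
        exact LinearPMap.map_smul f c ⟨x.1, _⟩ }

/-- `T` is a positive self-adjoint square root of `S`: `T = T*`, `⟪T x, x⟫ ≥ 0`, `T ∘ T = S`
(with equality of domains). -/
def IsPositiveSqrt [CompleteSpace E] (S T : E →ₗ.[ℝ] E) : Prop :=
  IsSelfAdjoint T ∧ (∀ x : T.domain, 0 ≤ ⟪T x, (x : E)⟫_ℝ) ∧ pcomp T T = S

open scoped Classical in
/-- The square root `S^{1/2}` of a positive self-adjoint operator `S`: the positive self-adjoint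
operator whose square is `S` (the value is `S` itself when there is no such operator). -/
def opSqrt [CompleteSpace E] (S : E →ₗ.[ℝ] E) : E →ₗ.[ℝ] E :=
  if h : ∃ T, IsPositiveSqrt S T then h.choose else S

/-- `B` is essentially skew-self-adjoint: it is densely defined and closable, and its closure is
the negative of its adjoint. -/
def IsEssentiallySkewSelfAdjoint [CompleteSpace E] (B : E →ₗ.[ℝ] E) : Prop :=
  Dense (B.domain : Set E) ∧ B.IsClosable ∧ B.closure = -B.adjoint

end Operators

/-! ### The lattice directions -/

/-- The `2d` unit vectors of `ℤ^d`: `(i, σ)` stands for `σ e_i`. -/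
abbrev Dir (d : ℕ) : Type := Fin d × ℤˣ

/-- The unit vector `σ e_i ∈ ℤ^d`. -/
def Dir.vec {d : ℕ} (k : Dir d) : Fin d → ℤ := Pi.single k.1 (k.2 : ℤ)

/-- The opposite direction. -/
def Dir.opp {d : ℕ} (k : Dir d) : Dir d := (k.1, -k.2)

section Environment

variable {d : ℕ} {Ω : Type*} [MeasurableSpace Ω] [AddAction (Fin d → ℤ) Ω]

/-- The shift `τ_k ω` by a unit vector. -/
def shift (k : Dir d) (ω : Ω) : Ω := k.vec +ᵥ ω

/-- The conductances `s_k(ω) = (p_k(ω) + p_{-k}(τ_k ω)) / 2`. -/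
def symPart (p : Dir d → Ω → ℝ) (k : Dir d) (ω : Ω) : ℝ :=
  (p k ω + p k.opp (shift k ω)) / 2

/-- The flow `b_k(ω) = (p_k(ω) - p_{-k}(τ_k ω)) / 2`. -/
def antisymPart (p : Dir d → Ω → ℝ) (k : Dir d) (ω : Ω) : ℝ :=
  (p k ω - p k.opp (shift k ω)) / 2

/-- Bistochastic, weakly elliptic random jump rates `p` over the dynamical system
`(Ω, π, (τ_z))`, whose antisymmetric part is the curl of a stationary stream tensor `h`. No
integrability is imposed here. -/
structure Rates (d : ℕ) (Ω : Type*) [MeasurableSpace Ω] [AddAction (Fin d → ℤ) Ω]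
    (π : Measure Ω) where
  p : Dir d → Ω → ℝ
  h : Dir d → Dir d → Ω → ℝ
  measurable_p : ∀ k, Measurable (p k)
  measurable_h : ∀ k l, Measurable (h k l)
  nonneg : ∀ k, ∀ᵐ ω ∂π, 0 ≤ p k ω
  bistochastic : ∀ᵐ ω ∂π, ∑ k, p k ω = ∑ k : Dir d, p k.opp (shift k ω)
  weakly_elliptic : ∀ k, ∀ᵐ ω ∂π, 0 < symPart p k ω
  h_opp_left : ∀ k l, ∀ᵐ ω ∂π, h k l ω = -h k.opp l (shift k ω)
  h_opp_right : ∀ k l, ∀ᵐ ω ∂π, h k l ω = -h k l.opp (shift l ω)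
  h_antisymm : ∀ k l, ∀ᵐ ω ∂π, h k l ω = -h l k ω
  curl : ∀ k, ∀ᵐ ω ∂π, antisymPart p k ω = ∑ l, h k l ω

/-! ### Function spaces -/

/-- The real Hilbert space of centred square integrable functions. -/
def CentredL2 {Ω : Type*} [MeasurableSpace Ω] (π : Measure Ω) [IsProbabilityMeasure π] :
    Submodule ℝ (Lp ℝ 2 π) where
  carrier := {f | ∫ ω, f ω ∂π = 0}
  zero_mem' := by
    have : ∫ ω, (0 : Lp ℝ 2 π) ω ∂π = ∫ _, (0 : ℝ) ∂π := integral_congr_ae (Lp.coeFn_zero ..)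
    simp
  add_mem' {f g} hf hg := by
    have h1 : Integrable f π := (Lp.memLp f).integrable (by norm_num)
    have h2 : Integrable g π := (Lp.memLp g).integrable (by norm_num)
    have hf' : ∫ ω, f ω ∂π = 0 := hf
    have hg' : ∫ ω, g ω ∂π = 0 := hg
    have : ∫ ω, (f + g : Lp ℝ 2 π) ω ∂π = ∫ ω, (f ω + g ω) ∂π :=
      integral_congr_ae (Lp.coeFn_add f g)
    change ∫ ω, (f + g : Lp ℝ 2 π) ω ∂π = 0
    rw [this, integral_add h1 h2, hf', hg', add_zero]
  smul_mem' c f hf := by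
    have hf' : ∫ ω, f ω ∂π = 0 := hf
    have : ∫ ω, (c • f : Lp ℝ 2 π) ω ∂π = ∫ ω, c * f ω ∂π :=
      integral_congr_ae (Lp.coeFn_smul c f)
    change ∫ ω, (c • f : Lp ℝ 2 π) ω ∂π = 0
    rw [this, integral_const_mul, hf', mul_zero]

theorem CentredL2.isClosed {Ω : Type*} [MeasurableSpace Ω] (π : Measure Ω)
    [IsProbabilityMeasure π] : IsClosed (CentredL2 π : Set (Lp ℝ 2 π)) := by
  have key : (CentredL2 π : Set (Lp ℝ 2 π)) =
      {f | ⟪indicatorConstLp 2 MeasurableSet.univ (measure_ne_top π _) (1 : ℝ), f⟫_ℝ = 0} := by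
    ext f
    change ∫ ω, f ω ∂π = 0 ↔ _
    rw [Set.mem_ofPred_eq, L2.inner_indicatorConstLp_one]
    simp
  rw [key]
  exact isClosed_eq (by fun_prop) continuous_const

instance {Ω : Type*} [MeasurableSpace Ω] (π : Measure Ω) [IsProbabilityMeasure π] :
    CompleteSpace (CentredL2 π) :=
  (CentredL2.isClosed π).completeSpace_coe

/-- Families `(u_k)` of square integrable functions indexed by the `2d` directions, with the
`ℓ²` direct sum inner product. The Hilbert space of (antisymmetric) square integrable vector
fields with its inner product `⟪u, v⟫ = ½ ∑_k ∫ u_k v_k dπ` is embedded isometrically into it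
by `u ↦ (u_k / √2)_k`. -/
abbrev Fields (d : ℕ) {Ω : Type*} [MeasurableSpace Ω] (π : Measure Ω) : Type _ :=
  PiLp 2 (fun _ : Dir d => Lp ℝ 2 π)

section Pointwise

variable {π : Measure Ω} {E : Type*} [AddCommGroup E] [Module ℝ E]

/-- An almost everywhere linear pointwise formula `f ↦ (P f k)_k`, as an operator with values in
`Fields d π`, on its maximal domain. -/
def fieldOp (P : E → Dir d → Ω → ℝ)
    (hadd : ∀ f g k, P (f + g) k =ᵐ[π] P f k + P g k)
    (hsmul : ∀ (c : ℝ) f k, P (c • f) k =ᵐ[π] c • P f k) : E →ₗ.[ℝ] Fields d π where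
  domain :=
    { carrier := {f | ∀ k, MemLp (P f k) 2 π}
      zero_mem' := fun k => by
        have h0 : P 0 k =ᵐ[π] (0 : ℝ) • P (0 : E) k := by simpa using hsmul 0 0 k
        rw [zero_smul] at h0
        exact (memLp_congr_ae h0).2 MemLp.zero
      add_mem' := fun {f g} hf hg k => (memLp_congr_ae (hadd f g k)).2 ((hf k).add (hg k))
      smul_mem' := fun c f hf k =>
        (memLp_congr_ae (hsmul c f k)).2 ((hf k).const_smul c) }
  toFun :=
    { toFun := fun f => WithLp.toLp 2 fun k => (f.2 k).toLp (P f.1 k)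
      map_add' := fun f g => by
        apply PiLp.ext
        intro k
        exact (MemLp.toLp_eq_toLp_iff ((f + g).2 k) ((f.2 k).add (g.2 k))).2 (hadd f.1 g.1 k)
      map_smul' := fun c f => by
        apply PiLp.ext
        intro k
        exact (MemLp.toLp_eq_toLp_iff ((c • f).2 k) ((f.2 k).const_smul c)).2 (hsmul c f.1 k) }

variable [IsProbabilityMeasure π]

/-- An almost everywhere linear pointwise formula `f ↦ P f`, as an operator with values in the
centred square integrable functions, on its maximal domain. -/
def scalarOp (P : E → Ω → ℝ)
    (hadd : ∀ f g, P (f + g) =ᵐ[π] P f + P g)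
    (hsmul : ∀ (c : ℝ) f, P (c • f) =ᵐ[π] c • P f) : E →ₗ.[ℝ] CentredL2 π where
  domain :=
    { carrier := {f | MemLp (P f) 2 π ∧ ∫ ω, P f ω ∂π = 0}
      zero_mem' := by
        have h0 : P 0 =ᵐ[π] (0 : ℝ) • P (0 : E) := by simpa using hsmul 0 0
        rw [zero_smul] at h0
        refine ⟨(memLp_congr_ae h0).2 MemLp.zero, ?_⟩
        rw [integral_congr_ae h0]
        simp
      add_mem' := fun {f g} hf hg => by
        refine ⟨(memLp_congr_ae (hadd f g)).2 (hf.1.add hg.1), ?_⟩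
        rw [integral_congr_ae (hadd f g)]
        have := integral_add (hf.1.integrable (by norm_num)) (hg.1.integrable (by norm_num))
        simpa [hf.2, hg.2] using this
      smul_mem' := fun c f hf => by
        refine ⟨(memLp_congr_ae (hsmul c f)).2 (hf.1.const_smul c), ?_⟩
        rw [integral_congr_ae (hsmul c f)]
        have := integral_const_mul (μ := π) c (P f)
        simpa [hf.2] using this }
  toFun :=
    { toFun := fun f => ⟨f.2.1.toLp (P f.1), by
        change ∫ ω, (f.2.1.toLp (P f.1)) ω ∂π = 0
        rw [integral_congr_ae f.2.1.coeFn_toLp, f.2.2]⟩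
      map_add' := fun f g => Subtype.ext
        ((MemLp.toLp_eq_toLp_iff (f + g).2.1 (f.2.1.add g.2.1)).2 (hadd f.1 g.1))
      map_smul' := fun c f => Subtype.ext
        ((MemLp.toLp_eq_toLp_iff (c • f).2.1 (f.2.1.const_smul c)).2 (hsmul c f.1)) }

end Pointwise

theorem shift_ae {π : Measure Ω} [MeasurableConstVAdd (Fin d → ℤ) Ω]
    [VAddInvariantMeasure (Fin d → ℤ) Ω π] {q : Ω → Prop} (k : Dir d)
    (hq : ∀ᵐ ω ∂π, q ω) : ∀ᵐ ω ∂π, q (shift k ω) :=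
  (measurePreserving_vadd k.vec π).quasiMeasurePreserving.ae hq

namespace Rates

variable {π : Measure Ω} (X : Rates d Ω π)

/-- The conductances. -/
def s (k : Dir d) (ω : Ω) : ℝ := symPart X.p k ω

/-- The square roots of the conductances, `r_k = √s_k`. -/
def r (k : Dir d) (ω : Ω) : ℝ := √(X.s k ω)

/-- The divergence free flow. -/
def b (k : Dir d) (ω : Ω) : ℝ := antisymPart X.p k ω

/-- The set `Ω_K` on which, at `ω` and at its neighbours, all the `r_k`, `1 / r_k` and `|h_{k,l}|`
are at most `K`. -/
def goodSet (K : ℝ) : Set Ω :=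
  {ω | ∀ k l m : Dir d,
    X.r k ω ≤ K ∧ (X.r k ω)⁻¹ ≤ K ∧ X.r k (shift m ω) ≤ K ∧ (X.r k (shift m ω))⁻¹ ≤ K ∧
      |X.h k l ω| ≤ K ∧ |X.h k l (shift m ω)| ≤ K}

theorem goodSet_mono {K K' : ℝ} (hK : K ≤ K') : X.goodSet K ⊆ X.goodSet K' := by
  intro ω hω k l m
  obtain ⟨h1, h2, h3, h4, h5, h6⟩ := hω k l m
  exact ⟨h1.trans hK, h2.trans hK, h3.trans hK, h4.trans hK, h5.trans hK, h6.trans hK⟩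

variable [IsProbabilityMeasure π]

/-- The common core `𝒜`: essentially bounded centred functions that vanish almost everywhere
outside some `Ω_K`. -/
def core : Submodule ℝ (CentredL2 π) where
  carrier := {f | (∃ C : ℝ, ∀ᵐ ω ∂π, |(f : Lp ℝ 2 π) ω| ≤ C) ∧
    ∃ K : ℝ, ∀ᵐ ω ∂π, ω ∉ X.goodSet K → (f : Lp ℝ 2 π) ω = 0}
  zero_mem' := by
    have h0 : ((0 : CentredL2 π) : Lp ℝ 2 π) =ᵐ[π] 0 := Lp.coeFn_zero ..
    refine ⟨⟨0, ?_⟩, ⟨0, ?_⟩⟩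
    · filter_upwards [h0] with ω h
      rw [h, Pi.zero_apply, abs_zero]
    · filter_upwards [h0] with ω h _
      rw [h, Pi.zero_apply]
  add_mem' := by
    rintro f g ⟨⟨C, hC⟩, ⟨K, hK⟩⟩ ⟨⟨C', hC'⟩, ⟨K', hK'⟩⟩
    have h0 : ((f + g : CentredL2 π) : Lp ℝ 2 π) =ᵐ[π]
      (f : Lp ℝ 2 π) + (g : Lp ℝ 2 π) := Lp.coeFn_add ..
    refine ⟨⟨C + C', ?_⟩, ⟨max K K', ?_⟩⟩
    · filter_upwards [h0, hC, hC'] with ω h h1 h2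
      rw [h]
      exact (abs_add_le _ _).trans (add_le_add h1 h2)
    · filter_upwards [h0, hK, hK'] with ω h h1 h2 hω
      rw [h, Pi.add_apply, h1 fun h' => hω (X.goodSet_mono (le_max_left _ _) h'),
        h2 fun h' => hω (X.goodSet_mono (le_max_right _ _) h'), add_zero]
  smul_mem' := by
    rintro c f ⟨⟨C, hC⟩, ⟨K, hK⟩⟩
    have h0 : ((c • f : CentredL2 π) : Lp ℝ 2 π) =ᵐ[π] c • (f : Lp ℝ 2 π) := Lp.coeFn_smul ..
    refine ⟨⟨|c| * C, ?_⟩, ⟨K, ?_⟩⟩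
    · filter_upwards [h0, hC] with ω h h1
      rw [h, Pi.smul_apply, smul_eq_mul, abs_mul]
      exact mul_le_mul_of_nonneg_left h1 (abs_nonneg c)
    · filter_upwards [h0, hK] with ω h h1 hω
      rw [h, Pi.smul_apply, h1 hω, smul_zero]

/-- The lattice difference `∂_k f = f ∘ τ_k - f`. -/
def diff (f : CentredL2 π) (k : Dir d) (ω : Ω) : ℝ :=
  (f : Lp ℝ 2 π) (shift k ω) - (f : Lp ℝ 2 π) ω

section Invariant

variable [MeasurableConstVAdd (Fin d → ℤ) Ω] [VAddInvariantMeasure (Fin d → ℤ) Ω π]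

theorem diff_add (f g : CentredL2 π) (k : Dir d) :
    diff (f + g) k =ᵐ[π] diff f k + diff g k := by
  have h0 : ((f + g : CentredL2 π) : Lp ℝ 2 π) =ᵐ[π]
    (f : Lp ℝ 2 π) + (g : Lp ℝ 2 π) := Lp.coeFn_add ..
  filter_upwards [h0, shift_ae k h0] with ω h1 h2
  simp only [diff, Pi.add_apply] at *
  rw [h1, h2]
  ring

theorem diff_smul (c : ℝ) (f : CentredL2 π) (k : Dir d) :
    diff (c • f) k =ᵐ[π] c • diff f k := by
  have h0 : ((c • f : CentredL2 π) : Lp ℝ 2 π) =ᵐ[π] c • (f : Lp ℝ 2 π) := Lp.coeFn_smul ..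
  filter_upwards [h0, shift_ae k h0] with ω h1 h2
  simp only [diff, Pi.smul_apply, smul_eq_mul] at *
  rw [h1, h2]
  ring

/-- The operator `R∇`, `(R∇f)_k = r_k (f ∘ τ_k - f)`, on the core `𝒜`. The factor `1 / √2` is the
embedding of vector fields into `Fields d π`. -/
def gradOp : CentredL2 π →ₗ.[ℝ] Fields d π :=
  (fieldOp (fun (f : CentredL2 π) k ω => (√2)⁻¹ * (X.r k ω * diff f k ω))
    (fun f g k => by
      filter_upwards [diff_add f g k] with ω h
      simp only [Pi.add_apply] at *
      rw [h]
      ring)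
    (fun c f k => by
      filter_upwards [diff_smul c f k] with ω h
      simp only [Pi.smul_apply, smul_eq_mul] at *
      rw [h]
      ring)).domRestrict X.core

/-- The symmetric part `S` of (minus) the generator, as the self-adjoint operator
`S = (R∇)* (R∇)`, where the middle `R∇` is the closure of the operator on the core: the
self-adjoint operator of the closed quadratic form `½ ∑_k ∫ s_k (f ∘ τ_k - f)² dπ`. -/
def symOp : CentredL2 π →ₗ.[ℝ] CentredL2 π :=
  pcomp X.gradOp.closure.adjoint X.gradOp.closure

/-- The square root `S^{1/2}`. -/
def sqrtOp : CentredL2 π →ₗ.[ℝ] CentredL2 π := opSqrt X.symOp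

/-- The antisymmetric part `A f = ∑_k b_k (f ∘ τ_k - f)` of the generator, on the core `𝒜`. -/
def antisymOp : CentredL2 π →ₗ.[ℝ] CentredL2 π :=
  (scalarOp (fun (f : CentredL2 π) ω => ∑ k, X.b k ω * diff f k ω)
    (fun f g => by
      filter_upwards [eventually_all.2 fun k : Dir d => diff_add f g k] with ω h
      simp only [Pi.add_apply] at *
      simp only [h, mul_add, Finset.sum_add_distrib])
    (fun c f => by
      filter_upwards [eventually_all.2 fun k : Dir d => diff_smul c f k] with ω h
      simp only [Pi.smul_apply, smul_eq_mul] at *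
      simp only [h, Finset.mul_sum]
      exact Finset.sum_congr rfl fun k _ => by ring)).domRestrict X.core

/-- The operator `B = S^{-1/2} A S^{-1/2}` on its natural domain (with `A` defined on `𝒜`). -/
def skewOp : CentredL2 π →ₗ.[ℝ] CentredL2 π :=
  pcomp X.sqrtOp.inverse (pcomp X.antisymOp X.sqrtOp.inverse)

/-- The subspace `𝒞 = S^{1/2} 𝒜`. -/
def sqrtCore : Submodule ℝ (CentredL2 π) :=
  (X.core.comap X.sqrtOp.domain.subtype).map X.sqrtOp.toFun

/-- The operator `R⁻¹ H R⁻¹`, where `(R⁻¹ u)_k = u_k / r_k` and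
`(H u)_k = ½ ∑_l h_{k,l} (u_l ∘ τ_k + u_l)`, on its maximal domain. -/
def streamOp : Fields d π →ₗ.[ℝ] Fields d π :=
  fieldOp (fun (u : Fields d π) k ω => (X.r k ω)⁻¹ * (1 / 2 * ∑ l, X.h k l ω *
      ((X.r l (shift k ω))⁻¹ * u l (shift k ω) + (X.r l ω)⁻¹ * u l ω)))
    (fun u v k => by
      have h0 : ∀ l, ((u + v) l : Lp ℝ 2 π) =ᵐ[π] ⇑(u l) + ⇑(v l) := fun l => Lp.coeFn_add _ _
      filter_upwards [eventually_all.2 h0, eventually_all.2 fun l => shift_ae k (h0 l)]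
        with ω h1 h2
      simp only [Pi.add_apply] at *
      simp only [h1, h2, ← mul_add, ← Finset.sum_add_distrib]
      congr 2
      exact Finset.sum_congr rfl fun l _ => by ring)
    (fun c u k => by
      have h0 : ∀ l, ((c • u) l : Lp ℝ 2 π) =ᵐ[π] c • ⇑(u l) := fun l => Lp.coeFn_smul _ _
      filter_upwards [eventually_all.2 h0, eventually_all.2 fun l => shift_ae k (h0 l)]
        with ω h1 h2
      simp only [Pi.smul_apply, smul_eq_mul] at *
      simp only [h1, h2, Finset.mul_sum]
      exact Finset.sum_congr rfl fun l _ => by ring)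

end Invariant

end Rates

end Environment

end RandomEnv

end

/-! Statements 1 to 4 are operator theory around a few identities on the core. The gradient `R∇` is
closable, so `S = D̄* D̄` with `D = R∇` is self-adjoint by von Neumann's argument, and its square
root is assembled from bounded square roots of the resolvent. On the core `‖S^{1/2} f‖ = ‖R∇f‖`, so
`S^{1/2} f ↦ R∇f` extends to the isometry `Λ`. Ergodicity makes `S^{1/2}` injective, and
approximation in graph norm makes `𝒜` a core for it (`IsGradientSqrt.mem_graph`). The symmetries of
`h` and summation by parts give `⟪R⁻¹HR⁻¹ R∇f, R∇g⟫ = ⟪Af, g⟫` (`inner_stream`). Because `𝒜` is a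
core of a self-adjoint operator, this identity says that `S^{1/2} Λ* R⁻¹HR⁻¹ R∇f = Af`. So `Af` lies
in the range of `S^{1/2}`, which yields both the domain of `B` and its factorisation.

For statement 5 it suffices that a `ψ` orthogonal to the range of `B + c`, `c = ±1`, vanishes.
Choose `f_n` in the core with `S^{1/2} f_n → ψ`; then `R∇f_n → Λψ`. Tested against the core, the
orthogonality says that `θ = √2 R⁻¹Λψ` satisfies `∑ (s_k + c b_k) θ_k = 0` almost surely. Thus `θ`
is the gradient of a harmonic function with stationary increments, and a limit of gradients of
stationary functions. Such a corrector must be zero, by a Caccioppoli estimate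
(`EnergyData.energy_estimate`, `energy_le`).

The estimate lives on `Ω × ℤ^d`, with the potential `F(ω, z) = f_n(ω) - f_n(τ_{-z} ω)` and the test
function `η · clamp L F`, where `η` is a tent of radius `2M` and `L = xM`. The symmetric part
produces the energy. In the flow term `b ∂F clamp(F)` is compared with `b ∂(huber F)`, where `huber`
is the primitive of `clamp`. The difference is `b (∂F)² / 2` up to an error living where `|F| > L`,
and `b (∂F)²` is antisymmetric on edges, so that it only sees the slope of `η`. The term `b ∂(huber
F)` is moved by the stream tensor onto `∇η`, at cost `L · M⁻¹ ∫ |h| |∂F| = O(x)`. This is finite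
because `h_{k,l} / r_l` and the rescaled gradients are in `L²`. Edges with `|F| > L` carry little
energy because `F` is sublinear in `L¹`, which uses `1 / r_k ∈ L²`. The limits are taken in the
order `n`, `M`, then a comparison index `m`, a truncation level `Q`, and last `x → 0`
(`nonpos_of_iterated_bound`). -/

namespace RandomEnv

/-! ### Bounded square roots by the Catalan series -/

section BoundedSqrt

/-- The normalised Catalan numbers, the Taylor coefficients of `2 (1 - √(1 - x)) / x`. -/
noncomputable def catalanCoeff (n : ℕ) : ℝ := catalan n / 4 ^ n

theorem catalanCoeff_nonneg (n : ℕ) : 0 ≤ catalanCoeff n := by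
  unfold catalanCoeff; positivity

/-- The telescoping form makes the partial sums explicit, which gives absolute convergence up to the
boundary of the unit ball. -/
theorem catalanCoeff_eq_sub (n : ℕ) : catalanCoeff n =
    2 * (Nat.centralBinom n / 4 ^ n) - 2 * (Nat.centralBinom (n + 1) / 4 ^ (n + 1)) := by
  have h1 : ((n : ℝ) + 1) * catalan n = Nat.centralBinom n := by
    exact_mod_cast succ_mul_catalan_eq_centralBinom n
  have h2 : ((n : ℝ) + 1) * Nat.centralBinom (n + 1) = 2 * (2 * n + 1) * Nat.centralBinom n := by
    exact_mod_cast Nat.succ_mul_centralBinom_succ n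
  have hn : (n : ℝ) + 1 ≠ 0 := by positivity
  unfold catalanCoeff
  have h3 : (Nat.centralBinom (n + 1) : ℝ) = 2 * (2 * n + 1) * catalan n := by
    apply mul_left_cancel₀ hn
    rw [h2, ← h1]; ring
  rw [h3, ← h1, pow_succ]
  field_simp
  ring

theorem sum_catalanCoeff_le (N : ℕ) : ∑ n ∈ Finset.range N, catalanCoeff n ≤ 2 := by
  have h : ∑ n ∈ Finset.range N, catalanCoeff n = 2 - 2 * (Nat.centralBinom N / 4 ^ N) := by
    induction N with
    | zero => simp
    | succ N ih => rw [Finset.sum_range_succ, ih, catalanCoeff_eq_sub]; ring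
  rw [h]
  have : (0 : ℝ) ≤ Nat.centralBinom N / 4 ^ N := by positivity
  linarith

theorem summable_catalanCoeff : Summable catalanCoeff :=
  summable_of_sum_range_le catalanCoeff_nonneg sum_catalanCoeff_le

theorem tsum_catalanCoeff_le : ∑' n, catalanCoeff n ≤ 2 :=
  summable_catalanCoeff.tsum_le_of_sum_range_le sum_catalanCoeff_le

theorem sum_antidiagonal_catalanCoeff (n : ℕ) :
    ∑ ij ∈ Finset.HasAntidiagonal.antidiagonal n, catalanCoeff ij.1 * catalanCoeff ij.2 =
      4 * catalanCoeff (n + 1) := by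
  unfold catalanCoeff
  rw [catalan_succ', Nat.cast_sum, Finset.sum_div, Finset.mul_sum]
  refine Finset.sum_congr rfl fun ij hij => ?_
  rw [Finset.HasAntidiagonal.mem_antidiagonal] at hij
  rw [← hij, pow_succ, pow_add]
  push_cast
  field_simp

variable {E : Type*} [NormedAddCommGroup E] [InnerProductSpace ℝ E] [CompleteSpace E]

/-- An operator within distance one of the identity has a square root with the same property. -/
theorem exists_bounded_sqrt (a : E →L[ℝ] E) (ha : ‖1 - a‖ ≤ 1) :
    ∃ r : E →L[ℝ] E, r * r = a ∧ ‖1 - r‖ ≤ 1 ∧ (∀ z, Commute z a → Commute z r) ∧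
      (IsSelfAdjoint a → IsSelfAdjoint r) := by
  set b := 1 - a with hb
  have hpow : ∀ n, ‖b ^ n‖ ≤ 1 := by
    intro n
    induction n with
    | zero => exact ContinuousLinearMap.norm_id_le
    | succ n ih =>
      rw [pow_succ]
      exact (norm_mul_le _ _).trans (mul_le_one₀ ih (norm_nonneg _) ha)
  have hle : ∀ n, ‖catalanCoeff n • b ^ n‖ ≤ catalanCoeff n := fun n => by
    rw [norm_smul, Real.norm_of_nonneg (catalanCoeff_nonneg n)]
    exact mul_le_of_le_one_right (catalanCoeff_nonneg n) (hpow n)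
  have hsn : Summable fun n => ‖catalanCoeff n • b ^ n‖ :=
    summable_catalanCoeff.of_nonneg_of_le (fun _ => norm_nonneg _) hle
  have hs : Summable fun n => catalanCoeff n • b ^ n := hsn.of_norm
  set c := ∑' n, catalanCoeff n • b ^ n with hc
  have hcn : ‖c‖ ≤ 2 := (norm_tsum_le_tsum_norm hsn).trans
    ((hsn.tsum_le_tsum hle summable_catalanCoeff).trans tsum_catalanCoeff_le)
  have hcc : ∀ z, Commute z b → Commute z c := fun z hz => by
    refine (Commute.tsum_right z fun n => ?_)
    exact (hz.pow_right n).smul_right _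
  have hbc : Commute b c := hcc b (Commute.refl b)
  -- The Catalan recursion is the functional equation `c = 1 + (b / 4) c²` of the generating
  -- function.
  have hmul : b * (c * c) = (4 : ℝ) • (c - 1) := by
    have h1 : c * c = ∑' n, (4 * catalanCoeff (n + 1)) • b ^ n := by
      rw [hc, tsum_mul_tsum_eq_tsum_sum_antidiagonal_of_summable_norm hsn hsn]
      refine tsum_congr fun n => ?_
      rw [← sum_antidiagonal_catalanCoeff, Finset.sum_smul]
      refine Finset.sum_congr rfl fun ij hij => ?_
      rw [Finset.HasAntidiagonal.mem_antidiagonal] at hij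
      rw [smul_mul_smul_comm, ← pow_add, hij]
    have h2 : Summable fun n => (4 * catalanCoeff (n + 1)) • b ^ n := by
      refine Summable.of_norm_bounded
        (((summable_nat_add_iff 1).2 summable_catalanCoeff).mul_left 4) fun n => ?_
      rw [norm_smul, Real.norm_of_nonneg (mul_nonneg (by norm_num) (catalanCoeff_nonneg _))]
      exact mul_le_of_le_one_right (mul_nonneg (by norm_num) (catalanCoeff_nonneg _)) (hpow n)
    have h3 : c - 1 = ∑' n, catalanCoeff (n + 1) • b ^ (n + 1) := by
      rw [hc, hs.tsum_eq_zero_add]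
      simp [catalanCoeff]
    rw [h1, h3, ← h2.tsum_mul_left, ← ((summable_nat_add_iff 1).2 hs).tsum_const_smul]
    refine tsum_congr fun n => ?_
    rw [mul_smul_comm, ← pow_succ', mul_smul]
  -- By `b c² = 4 (c - 1)`, the square of `1 - bc/2` is `1 - bc + (bc - b) = 1 - b = a`.
  refine ⟨1 - (1 / 2 : ℝ) • (b * c), ?_, ?_, ?_, ?_⟩
  · have h4 : b * c * (b * c) = (4 : ℝ) • (b * c - b) := by
      have : b * c * (b * c) = b * (b * (c * c)) := by
        rw [hbc.eq]; rw [mul_assoc c b, ← hbc.eq, ← mul_assoc, ← mul_assoc, ← hbc.eq]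
        simp only [mul_assoc]
        rw [← mul_assoc c b c, ← hbc.eq, mul_assoc]
      rw [this, hmul, mul_smul_comm, mul_sub, mul_one]
    have h5 : a = 1 - b := by rw [hb]; abel
    rw [h5, sub_mul, one_mul, mul_sub, mul_one, smul_mul_smul_comm, h4]
    module
  · rw [sub_sub_cancel, norm_smul]
    have : ‖b * c‖ ≤ 1 * 2 := (norm_mul_le _ _).trans
      (mul_le_mul ha hcn (norm_nonneg _) zero_le_one)
    norm_num
    linarith
  · intro z hz
    have hzb : Commute z b := (Commute.one_right z).sub_right hz
    exact (Commute.one_right z).sub_right ((hzb.mul_right (hcc z hzb)).smul_right _)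
  · intro hsa
    have hbs : IsSelfAdjoint b := (IsSelfAdjoint.one _).sub hsa
    have hcs : IsSelfAdjoint c := by
      rw [IsSelfAdjoint, hc, tsum_star]
      exact tsum_congr fun n => by rw [star_smul, star_pow, hbs.star_eq, star_trivial]
    refine (IsSelfAdjoint.one _).sub (IsSelfAdjoint.smul (by simp [IsSelfAdjoint]) ?_)
    exact (hbs.commute_iff hcs).1 hbc

end BoundedSqrt

end RandomEnv

namespace RandomEnv

/-! ### Graphs, adjoints and von Neumann's decomposition -/

section Graphs

variable {E F G : Type*}
  [NormedAddCommGroup E] [InnerProductSpace ℝ E]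
  [NormedAddCommGroup F] [InnerProductSpace ℝ F]
  [NormedAddCommGroup G] [InnerProductSpace ℝ G]

theorem mem_graph_pcomp {g : F →ₗ.[ℝ] G} {f : E →ₗ.[ℝ] F} {x : E} {z : G} :
    (x, z) ∈ (pcomp g f).graph ↔ ∃ y, (x, y) ∈ f.graph ∧ (y, z) ∈ g.graph := by
  constructor
  · rintro h
    obtain ⟨⟨x', hx⟩, h1, h2⟩ := (LinearPMap.mem_graph_iff _).1 h
    dsimp only at h1 h2
    subst h1
    obtain ⟨y, hy, hyx⟩ := id hx
    have hx' : x' ∈ f.domain := by rw [← hyx]; exact y.2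
    refine ⟨f ⟨x', hx'⟩, LinearPMap.mem_graph f ⟨x', hx'⟩, ?_⟩
    rw [← h2]
    exact LinearPMap.mem_graph g ⟨f ⟨x', hx'⟩, by
      have : (⟨x', hx'⟩ : f.domain) = y := Subtype.ext hyx.symm
      rw [this]; exact hy⟩
  · rintro ⟨y, hxy, hyz⟩
    obtain ⟨x', rfl, rfl⟩ := (LinearPMap.mem_graph_iff _).1 hxy
    obtain ⟨y', h1, rfl⟩ := (LinearPMap.mem_graph_iff _).1 hyz
    dsimp only at *
    have hm : (x' : E) ∈ (pcomp g f).domain := by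
      refine ⟨x', ?_, rfl⟩
      change f x' ∈ g.domain
      rw [← h1]; exact y'.2
    rw [LinearPMap.mem_graph_iff]
    refine ⟨⟨x', hm⟩, rfl, ?_⟩
    change g ⟨f _, _⟩ = g y'
    congr 1
    exact Subtype.ext h1.symm

theorem mem_graph_adjoint [CompleteSpace E] {T : E →ₗ.[ℝ] F} (hT : Dense (T.domain : Set E))
    {y : F} {w : E} :
    (y, w) ∈ T.adjoint.graph ↔ ∀ a b, (a, b) ∈ T.graph → ⟪w, a⟫_ℝ = ⟪y, b⟫_ℝ := by
  rw [LinearPMap.adjoint_graph_eq_graph_adjoint hT, Submodule.mem_adjoint_iff]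
  refine forall₂_congr fun a b => imp_congr_right fun _ => ?_
  rw [real_inner_comm, real_inner_comm b, sub_eq_zero, eq_comm, real_inner_comm]

theorem mem_graph_neg {f : E →ₗ.[ℝ] F} {x : E} {y : F} :
    (x, y) ∈ (-f).graph ↔ (x, -y) ∈ f.graph := by
  simp only [LinearPMap.mem_graph_iff]
  constructor
  · rintro ⟨a, h1, h2⟩
    exact ⟨a, h1, by rw [← h2, LinearPMap.neg_apply, neg_neg]⟩
  · rintro ⟨a, h1, h2⟩
    exact ⟨a, h1, by rw [LinearPMap.neg_apply, h2, neg_neg]⟩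

/-- The product space is the orthogonal sum of the graph of a closed operator and the flipped graph
of its adjoint. -/
theorem exists_graph_add_adjoint_graph [CompleteSpace E] [CompleteSpace F] {T : E →ₗ.[ℝ] F}
    (hT : Dense (T.domain : Set E)) (hc : T.IsClosed) (p : E) (q : F) :
    ∃ x y u v, (x, y) ∈ T.graph ∧ (u, v) ∈ T.adjoint.graph ∧ p = x - v ∧ q = y + u := by
  -- The orthogonal projection onto the graph needs the Hilbert sum, since `E × F` itself carries
  -- the sup norm.
  let M : Submodule ℝ (WithLp 2 (E × F)) :=
    T.graph.comap (WithLp.linearEquiv 2 ℝ (E × F)).toLinearMap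
  have hM : IsClosed (M : Set (WithLp 2 (E × F))) :=
    IsClosed.preimage (WithLp.prod_continuous_ofLp 2 E F) hc
  have : CompleteSpace M := hM.completeSpace_coe
  obtain ⟨g, hg, h, hh, hgh⟩ := M.exists_add_mem_mem_orthogonal (WithLp.toLp 2 (p, q))
  refine ⟨g.fst, g.snd, h.snd, -h.fst, hg, ?_, ?_, ?_⟩
  · rw [mem_graph_adjoint hT]
    intro a b hab
    have := (M.mem_orthogonal' h).1 hh (WithLp.toLp 2 (a, b)) hab
    rw [WithLp.prod_inner_apply] at this
    rw [inner_neg_left]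
    dsimp at this
    linarith
  · have := congrArg WithLp.fst hgh
    simpa using this
  · have := congrArg WithLp.snd hgh
    simpa using this

/-- Decomposing `(z, 0)` along the graph of `T` and the flipped graph of `T*` solves `x + T*Tx = z`.
-/
theorem exists_add_adjoint_eq [CompleteSpace E] [CompleteSpace F] {T : E →ₗ.[ℝ] F}
    (hT : Dense (T.domain : Set E)) (hc : T.IsClosed) (z : E) :
    ∃ x y, (x, y) ∈ (pcomp T.adjoint T).graph ∧ x + y = z := by
  obtain ⟨x, y, u, v, hxy, huv, hp, hq⟩ := exists_graph_add_adjoint_graph hT hc z 0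
  refine ⟨x, -v, mem_graph_pcomp.2 ⟨y, hxy, ?_⟩, by rw [hp]; abel⟩
  have hu : y = -u := eq_neg_of_add_eq_zero_left hq.symm
  rw [hu]
  exact T.adjoint.graph.neg_mem huv

end Graphs

/-! ### Positive operators, resolvents and square roots -/

section PositiveOperators

variable {E : Type*} [NormedAddCommGroup E] [InnerProductSpace ℝ E]

/-- A symmetric positive operator `S` with `1 + S` surjective. -/
structure IsAccretiveSymm (S : E →ₗ.[ℝ] E) : Prop where
  symm : ∀ {x y x' y'}, (x, y) ∈ S.graph → (x', y') ∈ S.graph → ⟪y, x'⟫_ℝ = ⟪x, y'⟫_ℝ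
  nonneg : ∀ {x y}, (x, y) ∈ S.graph → 0 ≤ ⟪y, x⟫_ℝ
  surj : ∀ z, ∃ x y, (x, y) ∈ S.graph ∧ x + y = z

theorem isAccretiveSymm_adjoint_comp [CompleteSpace E] {F : Type*} [NormedAddCommGroup F]
    [InnerProductSpace ℝ F] [CompleteSpace F] {T : E →ₗ.[ℝ] F}
    (hT : Dense (T.domain : Set E)) (hc : T.IsClosed) : IsAccretiveSymm (pcomp T.adjoint T) where
  symm := by
    intro x y x' y' h h'
    obtain ⟨u, hxu, huy⟩ := mem_graph_pcomp.1 h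
    obtain ⟨u', hxu', huy'⟩ := mem_graph_pcomp.1 h'
    rw [(mem_graph_adjoint hT).1 huy _ _ hxu', real_inner_comm,
      ← (mem_graph_adjoint hT).1 huy' _ _ hxu, real_inner_comm]
  nonneg := by
    intro x y h
    obtain ⟨u, hxu, huy⟩ := mem_graph_pcomp.1 h
    rw [(mem_graph_adjoint hT).1 huy _ _ hxu]
    exact real_inner_self_nonneg
  surj := exists_add_adjoint_eq hT hc

theorem dense_of_forall_inner_eq_zero [CompleteSpace E] {K : Submodule ℝ E}
    (h : ∀ z, (∀ x ∈ K, ⟪x, z⟫_ℝ = 0) → z = 0) : Dense (K : Set E) := by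
  rw [Submodule.dense_iff_topologicalClosure_eq_top, Submodule.topologicalClosure_eq_top_iff,
    eq_bot_iff]
  intro z hz
  exact h z ((K.mem_orthogonal z).1 hz)

namespace IsAccretiveSymm

variable {S : E →ₗ.[ℝ] E}

theorem eq_zero (hS : IsAccretiveSymm S) {x y : E} (h : (x, y) ∈ S.graph)
    (h0 : ⟪x + y, x⟫_ℝ = 0) : x = 0 := by
  have h1 := hS.nonneg h
  have h2 : 0 ≤ ⟪x, x⟫_ℝ := real_inner_self_nonneg
  rw [inner_add_left] at h0
  exact inner_self_eq_zero.1 (show ⟪x, x⟫_ℝ = 0 by linarith)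

theorem dense [CompleteSpace E] (hS : IsAccretiveSymm S) : Dense (S.domain : Set E) := by
  refine dense_of_forall_inner_eq_zero fun z hz => ?_
  obtain ⟨x, y, hxy, rfl⟩ := hS.surj z
  have hx := hS.eq_zero hxy (by
    rw [real_inner_comm]; exact hz x (LinearPMap.mem_domain_of_mem_graph hxy))
  rw [hx, zero_add]
  exact S.graph_fst_eq_zero_snd hxy hx

/-- For `(u, v)` in the graph of `S*`, solve `x + Sx = u + v`. Then `e = u - x` satisfies `S*e =
-e`, so it is orthogonal to the range of `1 + S`, which is everything. -/
theorem isSelfAdjoint [CompleteSpace E] (hS : IsAccretiveSymm S) : IsSelfAdjoint S := by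
  rw [LinearPMap.isSelfAdjoint_def]
  apply LinearPMap.eq_of_eq_graph
  have hle : S.graph ≤ S.adjoint.graph := by
    rintro ⟨x, y⟩ h
    rw [mem_graph_adjoint hS.dense]
    exact fun a b hab => hS.symm h hab
  refine le_antisymm ?_ hle
  rintro ⟨u, v⟩ huv
  obtain ⟨x, y, hxy, hz⟩ := hS.surj (u + v)
  have he : (u - x, v - y) ∈ S.adjoint.graph := S.adjoint.graph.sub_mem huv (hle hxy)
  obtain ⟨p, q, hpq, hpe⟩ := hS.surj (u - x)
  have h1 := (mem_graph_adjoint hS.dense).1 he _ _ hpq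
  have h2 : v - y = -(u - x) := by
    rw [eq_neg_iff_add_eq_zero, show v - y + (u - x) = u + v - (x + y) by abel, hz, sub_self]
  have h3 : ⟪u - x, u - x⟫_ℝ = 0 := by
    nth_rw 2 [← hpe]
    rw [inner_add_right, ← h1, h2, inner_neg_left]
    ring
  have h4 : u - x = 0 := inner_self_eq_zero.1 h3
  rw [h4, neg_zero] at h2
  rw [sub_eq_zero.1 h4, sub_eq_zero.1 h2]
  exact hxy

/-- The resolvent `(1 + S)⁻¹` as a bounded operator. -/
theorem exists_resolvent [CompleteSpace E] (hS : IsAccretiveSymm S) :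
    ∃ K : E →L[ℝ] E, (∀ z, (K z, z - K z) ∈ S.graph) ∧
      (∀ x y, (x, y) ∈ S.graph → K (x + y) = x) ∧ IsSelfAdjoint K ∧ ‖K‖ ≤ 1 ∧ ‖1 - K‖ ≤ 1 := by
  choose k l hkl hz using hS.surj
  have huniq : ∀ x y z, (x, y) ∈ S.graph → x + y = z → k z = x := by
    intro x y z h1 h2
    have h3 := S.graph.sub_mem (hkl z) h1
    refine sub_eq_zero.1 (hS.eq_zero h3 ?_)
    rw [show k z - x + (l z - y) = (k z + l z) - (x + y) by abel, hz, h2, sub_self,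
      inner_zero_left]
  -- The cross term is nonnegative by positivity, so this bounds both `K` and `1 - K` by one,
  -- exactly the input that `exists_bounded_sqrt` wants for each of them.
  have hpyth : ∀ z, ‖z‖ ^ 2 = ‖k z‖ ^ 2 + 2 * ⟪l z, k z⟫_ℝ + ‖l z‖ ^ 2 := by
    intro z
    nth_rw 1 [← hz z]
    rw [norm_add_sq_real, real_inner_comm]
  let K₀ : E →ₗ[ℝ] E :=
    { toFun := k
      map_add' := fun x y => huniq _ _ _ (S.graph.add_mem (hkl x) (hkl y)) (by
        change k x + k y + (l x + l y) = x + y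
        rw [add_add_add_comm, hz, hz])
      map_smul' := fun c x => huniq _ _ _ (S.graph.smul_mem c (hkl x)) (by
        change c • k x + c • l x = c • x
        rw [← smul_add, hz]) }
  have hK : ∀ z, ‖K₀ z‖ ≤ 1 * ‖z‖ := fun z => by
    rw [one_mul]
    refine le_of_sq_le_sq ?_ (norm_nonneg z)
    have := hpyth z
    have h2 := hS.nonneg (hkl z)
    change ‖k z‖ ^ 2 ≤ _
    nlinarith [sq_nonneg ‖l z‖]
  have hlz : ∀ z, z - k z = l z := fun z => by nth_rw 1 [← hz z]; abel
  refine ⟨K₀.mkContinuous 1 hK, fun z => ?_, fun x y h => huniq x y _ h rfl, ?_,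
    LinearMap.mkContinuous_norm_le _ zero_le_one _, ?_⟩
  · change (k z, z - k z) ∈ S.graph
    rw [hlz]
    exact hkl z
  · rw [ContinuousLinearMap.isSelfAdjoint_iff_isSymmetric]
    intro x y
    change ⟪k x, y⟫_ℝ = ⟪x, k y⟫_ℝ
    nth_rw 1 [← hz y]
    nth_rw 2 [← hz x]
    rw [inner_add_left, inner_add_right, hS.symm (hkl x) (hkl y)]
  · refine ContinuousLinearMap.opNorm_le_bound _ zero_le_one fun z => ?_
    rw [one_mul]
    refine le_of_sq_le_sq ?_ (norm_nonneg z)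
    have := hpyth z
    have h2 := hS.nonneg (hkl z)
    change ‖z - k z‖ ^ 2 ≤ _
    rw [hlz]
    nlinarith [sq_nonneg ‖k z‖]

end IsAccretiveSymm

/-- A symmetric positive operator `S` with `1 + S` surjective has a positive self-adjoint square
root. -/
theorem IsAccretiveSymm.exists_isPositiveSqrt [CompleteSpace E] {S : E →ₗ.[ℝ] E}
    (hS : IsAccretiveSymm S) : ∃ T, IsPositiveSqrt S T := by
  -- As `S = (1 - K) K⁻¹`, the root should be `N C⁻¹` with `C = K^{1/2}` and `N = (1 - K)^{1/2}`.
  -- The fourth root `D = C^{1/2}` serves only for positivity.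
  obtain ⟨K, hKS, hSK, hKsa, hK1, hK2⟩ := hS.exists_resolvent
  obtain ⟨C, hCC, hC1, hCcomm, hCsa⟩ := exists_bounded_sqrt K hK2
  obtain ⟨N, hNN, hN1, hNcomm, hNsa⟩ := exists_bounded_sqrt (1 - K) (by rwa [sub_sub_cancel])
  obtain ⟨D, hDD, -, hDcomm, hDsa⟩ := exists_bounded_sqrt C hC1
  replace hCsa := hCsa hKsa
  replace hNsa := hNsa ((IsSelfAdjoint.one _).sub hKsa)
  replace hDsa := hDsa hCsa
  have hCN : Commute C N :=
    hNcomm C ((Commute.one_right C).sub_right (hCcomm K (Commute.refl K)).symm)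
  have hND : Commute N D := hDcomm N hCN.symm
  have hCs : ∀ x y, ⟪C x, y⟫_ℝ = ⟪x, C y⟫_ℝ :=
    (ContinuousLinearMap.isSelfAdjoint_iff_isSymmetric).1 hCsa
  have hNs : ∀ x y, ⟪N x, y⟫_ℝ = ⟪x, N y⟫_ℝ :=
    (ContinuousLinearMap.isSelfAdjoint_iff_isSymmetric).1 hNsa
  have hDs : ∀ x y, ⟪D x, y⟫_ℝ = ⟪x, D y⟫_ℝ :=
    (ContinuousLinearMap.isSelfAdjoint_iff_isSymmetric).1 hDsa
  have hCC' : ∀ x, C (C x) = K x := fun x => DFunLike.congr_fun hCC x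
  have hNN' : ∀ x, N (N x) = x - K x := fun x => DFunLike.congr_fun hNN x
  have hCN' : ∀ x, C (N x) = N (C x) := fun x => DFunLike.congr_fun hCN.eq x
  have hCi : ∀ x, C x = 0 → x = 0 := by
    intro x hx
    have h1 := hKS x
    rw [← hCC', hx, map_zero, sub_zero] at h1
    exact S.graph_fst_eq_zero_snd h1 rfl
  -- From `C² + N² = 1`. The relation `N x = C y` describes both the pairs in the graph of the
  -- adjoint and the composable pairs of `T ∘ T`.
  have hrec : ∀ x y, N x = C y → x = C (C x + N y) := by
    intro x y h
    rw [map_add, hCC', hCN', ← h, hNN']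
    abel
  have hCd : Dense (LinearMap.range (C : E →ₗ[ℝ] E) : Set E) := by
    refine dense_of_forall_inner_eq_zero fun z hz => hCi z ?_
    have := hz (C (C z)) ⟨C z, rfl⟩
    exact inner_self_eq_zero.1 ((hCs (C z) z).symm.trans this)
  -- The graph of `N C⁻¹`, parametrised by `x ↦ (C x, N x)` so that no inverse has to be formed.
  let M : Submodule ℝ (E × E) := LinearMap.range ((C : E →ₗ[ℝ] E).prod (N : E →ₗ[ℝ] E))
  have hM : ∀ a b, (a, b) ∈ M ↔ ∃ x, C x = a ∧ N x = b := fun a b =>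
    exists_congr fun x => Prod.mk_inj
  have hgM : M.toLinearPMap.graph = M := by
    refine Submodule.toLinearPMap_graph_eq M ?_
    rintro ⟨a, b⟩ hab h0
    obtain ⟨x, hx, rfl⟩ := (hM a b).1 hab
    dsimp only at *
    rw [hCi x (hx.trans h0), map_zero]
  set T := M.toLinearPMap with hT
  have hgT : ∀ a b, (a, b) ∈ T.graph ↔ ∃ x, C x = a ∧ N x = b := fun a b => by rw [hgM, hM]
  have hTd : Dense (T.domain : Set E) := by
    refine hCd.mono ?_
    rintro _ ⟨x, rfl⟩
    exact LinearPMap.mem_domain_of_mem_graph ((hgT _ _).2 ⟨x, rfl, rfl⟩)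
  refine ⟨T, ?_, ?_, ?_⟩
  · rw [LinearPMap.isSelfAdjoint_def]
    apply LinearPMap.eq_of_eq_graph
    ext ⟨y, z⟩
    rw [mem_graph_adjoint hTd, hgT]
    constructor
    · intro h
      have h1 : N y = C z := by
        refine ext_inner_left ℝ fun x => ?_
        have := h _ _ ((hgT _ _).2 ⟨x, rfl, rfl⟩)
        rw [← hNs x y]
        refine Eq.trans ?_ (hCs x z)
        rw [real_inner_comm z, real_inner_comm y]
        exact this.symm
      refine ⟨C y + N z, (hrec y z h1).symm, ?_⟩
      rw [map_add, ← hCN', h1, hCC', hNN']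
      abel
    · rintro ⟨x, rfl, rfl⟩ a b hab
      obtain ⟨w, rfl, rfl⟩ := (hgT _ _).1 hab
      rw [← hCs (N x) w, ← hNs (C x) w]
      exact congrArg (fun t => ⟪t, w⟫_ℝ) (hCN' x)
  · intro x
    obtain ⟨w, hw1, hw2⟩ := (hgT _ _).1 (T.mem_graph x)
    -- With `w` the parameter, `⟪N w, C w⟫ = ⟪N (D w), D w⟫` since `D` commutes with `N`, and `N` is
    -- the square of a self-adjoint operator.
    rw [← hw1, ← hw2, ← hDD]
    change 0 ≤ ⟪N w, D (D w)⟫_ℝ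
    have h1 : ⟪D (N w), D w⟫_ℝ = ⟪N w, D (D w)⟫_ℝ := hDs (N w) (D w)
    have h2 : N (D w) = D (N w) := DFunLike.congr_fun hND.eq w
    rw [← h1, ← h2]
    obtain ⟨P, hPP, -, -, hPsa⟩ := exists_bounded_sqrt N hN1
    have hPs := (ContinuousLinearMap.isSelfAdjoint_iff_isSymmetric).1 (hPsa hNsa)
    rw [← hPP]
    change 0 ≤ ⟪P (P (D w)), D w⟫_ℝ
    have h3 : ⟪P (P (D w)), D w⟫_ℝ = ⟪P (D w), P (D w)⟫_ℝ := hPs (P (D w)) (D w)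
    rw [h3]
    exact real_inner_self_nonneg
  · apply LinearPMap.eq_of_eq_graph
    ext ⟨a, c⟩
    rw [mem_graph_pcomp]
    constructor
    · rintro ⟨b, hab, hbc⟩
      obtain ⟨x, rfl, rfl⟩ := (hgT _ _).1 hab
      obtain ⟨w, hw, rfl⟩ := (hgT _ _).1 hbc
      have h1 := hrec x w hw.symm
      have h2 : C x = K (C x + N w) := by rw [← hCC', ← h1]
      have h3 := hKS (C x + N w)
      rw [← h2, add_sub_cancel_left] at h3
      exact h3
    · intro h
      have h1 := hSK a c h
      refine ⟨N (C (a + c)), (hgT _ _).2 ⟨C (a + c), by rw [hCC', h1], rfl⟩,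
        (hgT _ _).2 ⟨N (a + c), hCN' _, ?_⟩⟩
      rw [hNN', h1, add_sub_cancel_left]

theorem IsAccretiveSymm.isPositiveSqrt_opSqrt [CompleteSpace E] {S : E →ₗ.[ℝ] E}
    (hS : IsAccretiveSymm S) : IsPositiveSqrt S (opSqrt S) := by
  have h := hS.exists_isPositiveSqrt
  rw [opSqrt, dif_pos h]
  exact h.choose_spec

/-- If the graph of a self-adjoint operator `T` is approximated over `Dom T²` by its restriction to
`𝒜`, then this restriction has the same adjoint as `T`. -/
theorem mem_graph_of_forall_core [CompleteSpace E] {T : E →ₗ.[ℝ] E} (hT : IsSelfAdjoint T)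
    {𝒜 : Set E}
    (h𝒜 : ∀ x y z, (x, y) ∈ T.graph → (y, z) ∈ T.graph → ∀ ε > 0, ∃ a b, a ∈ 𝒜 ∧
      (a, b) ∈ T.graph ∧ ‖x - a‖ ≤ ε ∧ ‖y - b‖ ≤ ε)
    {w z : E} (h : ∀ a b, a ∈ 𝒜 → (a, b) ∈ T.graph → ⟪z, a⟫_ℝ = ⟪w, b⟫_ℝ) :
    (w, z) ∈ T.graph := by
  have hd := hT.dense_domain
  have hadj : T.adjoint = T := hT
  have hsymm : ∀ {x y x' y'}, (x, y) ∈ T.graph → (x', y') ∈ T.graph → ⟪y, x'⟫_ℝ = ⟪x, y'⟫_ℝ := by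
    intro x y x' y' h1 h2
    rw [← hadj] at h1
    exact (mem_graph_adjoint hd).1 h1 _ _ h2
  -- The identity passes from `𝒜` to `Dom T²` by the approximation hypothesis.
  have h2 : ∀ x y v, (x, y) ∈ T.graph → (y, v) ∈ T.graph → ⟪z, x⟫_ℝ = ⟪w, y⟫_ℝ := by
    intro x y v hxy hyv
    have hb : ∀ ε > 0, |⟪z, x⟫_ℝ - ⟪w, y⟫_ℝ| ≤ 0 + (‖z‖ + ‖w‖) * ε := by
      intro ε hε
      obtain ⟨a, b, ha, hab, h1, h2⟩ := h𝒜 x y v hxy hyv ε hε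
      have h3 : ⟪z, x⟫_ℝ - ⟪w, y⟫_ℝ = ⟪z, x - a⟫_ℝ - ⟪w, y - b⟫_ℝ := by
        rw [inner_sub_right, inner_sub_right, h a b ha hab]; ring
      rw [h3]
      refine (abs_sub _ _).trans ?_
      have h4 := (abs_real_inner_le_norm z (x - a)).trans
        (mul_le_mul_of_nonneg_left h1 (norm_nonneg z))
      have h5 := (abs_real_inner_le_norm w (y - b)).trans
        (mul_le_mul_of_nonneg_left h2 (norm_nonneg w))
      linarith
    have h0 : |⟪z, x⟫_ℝ - ⟪w, y⟫_ℝ| ≤ 0 := by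
      refine le_of_forall_pos_le_add fun δ hδ => ?_
      have hp : 0 < ‖z‖ + ‖w‖ + 1 := by positivity
      refine (hb (δ / (‖z‖ + ‖w‖ + 1)) (by positivity)).trans ?_
      gcongr
      rw [mul_div_assoc', div_le_iff₀ hp]
      nlinarith [norm_nonneg z, norm_nonneg w]
    exact sub_eq_zero.1 (abs_nonpos_iff.1 h0)
  -- The component of `(w, z)` orthogonal to the graph is `(-v, u)` with `v = T u`. Testing with the
  -- `a` that solves `a + T²a = u` gives `‖u‖² = 0`.
  obtain ⟨x, y, u, v, hxy, huv, hp, hq⟩ := exists_graph_add_adjoint_graph hd hT.isClosed w z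
  rw [hadj] at huv
  obtain ⟨a, c, hac, hacu⟩ := exists_add_adjoint_eq hd hT.isClosed u
  rw [hadj] at hac
  obtain ⟨b, hab, hbc⟩ := mem_graph_pcomp.1 hac
  have h3 := h2 a b c hab hbc
  have h4 : ⟪u, u⟫_ℝ = 0 := by
    nth_rw 2 [← hacu]
    rw [hp, hq, inner_add_left, inner_sub_left, hsymm hxy hab, hsymm huv hbc] at h3
    rw [inner_add_right]
    linarith
  have hu : u = 0 := inner_self_eq_zero.1 h4
  have hv : v = 0 := T.graph_fst_eq_zero_snd huv hu
  rw [hp, hq, hu, hv, sub_zero, add_zero]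
  exact hxy

end PositiveOperators

end RandomEnv

namespace RandomEnv

/-! ### A range criterion for essential skew-self-adjointness -/

section EssentiallySkew

variable {E : Type*} [NormedAddCommGroup E] [InnerProductSpace ℝ E] [CompleteSpace E]

/-- A densely defined skew-symmetric operator `B` such that `B + 1` and `B - 1` have dense range is
essentially skew-self-adjoint. -/
theorem isEssentiallySkewSelfAdjoint_of_dense_range {B : E →ₗ.[ℝ] E}
    (hd : Dense (B.domain : Set E))
    (hB : ∀ x y : B.domain, ⟪B x, (y : E)⟫_ℝ = -⟪(x : E), B y⟫_ℝ)
    (h : ∀ c : ℝ, |c| = 1 → ∀ ψ : E, (∀ x : B.domain, ⟪ψ, B x + c • (x : E)⟫_ℝ = 0) → ψ = 0) :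
    IsEssentiallySkewSelfAdjoint B := by
  have hneg : ∀ {x y}, (x, y) ∈ (-B.adjoint).graph ↔
      ∀ a b, (a, b) ∈ B.graph → ⟪-y, a⟫_ℝ = ⟪x, b⟫_ℝ := fun {x y} => by
    rw [mem_graph_neg, mem_graph_adjoint hd]
  have hle : B.graph ≤ (-B.adjoint).graph := by
    rintro ⟨x, y⟩ hxy
    rw [hneg]
    intro a b hab
    obtain ⟨x', rfl, rfl⟩ := (LinearPMap.mem_graph_iff _).1 hxy
    obtain ⟨a', rfl, rfl⟩ := (LinearPMap.mem_graph_iff _).1 hab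
    rw [inner_neg_left, hB, neg_neg]
  have hclosed : (-B.adjoint).IsClosed := by
    have h1 : ((-B.adjoint).graph : Set (E × E)) =
        (fun p : E × E => (p.1, -p.2)) ⁻¹' (B.adjoint.graph : Set (E × E)) := by
      ext ⟨x, y⟩
      exact mem_graph_neg
    rw [LinearPMap.IsClosed, h1]
    exact IsClosed.preimage (by fun_prop) (LinearPMap.adjoint_isClosed hd)
  have hcl : B.IsClosable := hclosed.isClosable.leIsClosable (LinearPMap.le_of_le_graph hle)
  refine ⟨hd, hcl, ?_⟩
  apply LinearPMap.eq_of_eq_graph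
  rw [← hcl.graph_closure_eq_closure_graph]
  refine le_antisymm (Submodule.topologicalClosure_minimal _ hle hclosed) ?_
  rintro ⟨y, z⟩ hyz
  let R : B.domain →ₗ[ℝ] E := B.toFun + B.domain.subtype
  have hR : Dense (LinearMap.range R : Set E) := by
    refine dense_of_forall_inner_eq_zero fun ψ hψ => h 1 (by simp) ψ fun x => ?_
    rw [real_inner_comm, one_smul]
    exact hψ _ ⟨x, rfl⟩
  obtain ⟨u, hu, hlim⟩ := mem_closure_iff_seq_limit.1 (hR (y + z))
  choose x hx using hu
  -- Skew symmetry makes `B p` orthogonal to `p`, so `B + 1` does not decrease norms and preimages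
  -- of a Cauchy sequence are Cauchy.
  have hnorm : ∀ p : B.domain, ‖(p : E)‖ ≤ ‖R p‖ := by
    intro p
    refine le_of_sq_le_sq ?_ (norm_nonneg _)
    have h0 : ⟪B p, (p : E)⟫_ℝ = 0 := by
      have := hB p p
      rw [real_inner_comm (B p)] at this
      linarith
    change _ ≤ ‖B p + (p : E)‖ ^ 2
    rw [norm_add_sq_real, h0]
    nlinarith [sq_nonneg ‖B p‖]
  have hcx : CauchySeq fun n => (x n : E) := by
    refine Metric.cauchySeq_iff'.2 fun ε hε => ?_
    obtain ⟨N, hN⟩ := Metric.cauchySeq_iff'.1 hlim.cauchySeq ε hε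
    refine ⟨N, fun n hn => lt_of_le_of_lt ?_ (hN n hn)⟩
    rw [dist_eq_norm, dist_eq_norm, ← hx, ← hx, ← map_sub]
    exact hnorm (x n - x N)
  obtain ⟨p, hp⟩ := cauchySeq_tendsto_of_complete hcx
  have hBx : Tendsto (fun n => B (x n)) atTop (nhds (y + z - p)) := by
    have : (fun n => B (x n)) = fun n => u n - (x n : E) := by
      funext n
      rw [← hx]
      change B (x n) = B (x n) + (x n : E) - (x n : E)
      rw [add_sub_cancel_right]
    rw [this]
    exact hlim.sub hp
  have hmem : (p, y + z - p) ∈ B.graph.topologicalClosure :=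
    mem_closure_of_tendsto (hp.prodMk_nhds hBx) (Eventually.of_forall fun n => B.mem_graph (x n))
  -- The closure of `B` thus contains a pair `(p, q)` with `p + q = y + z`. Hence `-B*` maps `y - p`
  -- to `-(y - p)`, so that `y - p` is orthogonal to the range of `B - 1`.
  have h1 := (Submodule.topologicalClosure_minimal _ hle hclosed) hmem
  have h2 : (y - p, z - (y + z - p)) ∈ (-B.adjoint).graph := (-B.adjoint).graph.sub_mem hyz h1
  have h3 : y - p = 0 := by
    refine h (-1) (by simp) _ fun x => ?_
    have h4 := hneg.1 h2 _ _ (B.mem_graph x)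
    rw [show -(z - (y + z - p)) = y - p by abel] at h4
    rw [inner_add_right, inner_smul_right, ← h4]
    ring
  have h5 : p = y := (sub_eq_zero.1 h3).symm
  rw [h5, add_sub_cancel_left] at hmem
  exact hmem

end EssentiallySkew

/-! ### The square root of `D̄* D̄` and its polar isometry -/

section SqrtOfGradient

variable {E F : Type*} [NormedAddCommGroup E] [InnerProductSpace ℝ E]
  [NormedAddCommGroup F] [InnerProductSpace ℝ F]

theorem exists_linearIsometry_of_graph [CompleteSpace F] (M : Submodule ℝ (E × F))
    (hM : ∀ p ∈ M, ‖p.2‖ = ‖p.1‖) (hd : Dense (M.map (LinearMap.fst ℝ E F) : Set E)) :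
    ∃ Λ : E →ₗᵢ[ℝ] F, ∀ p ∈ M, Λ p.1 = p.2 := by
  have hg : M.toLinearPMap.graph = M := Submodule.toLinearPMap_graph_eq M fun p hp h0 => by
    rw [← norm_eq_zero, hM p hp, h0, norm_zero]
  set P := M.toLinearPMap
  have hn : ∀ x : P.domain, ‖P x‖ = ‖(x : E)‖ := fun x => by
    have := P.mem_graph x
    rw [hg] at this
    exact hM _ this
  have hdP : Dense (P.domain : Set E) := hd
  let f : P.domain →L[ℝ] F := P.toFun.mkContinuous 1 fun x => by
    rw [one_mul]; exact (hn x).le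
  have he : IsUniformInducing (P.domain.subtypeL : P.domain →L[ℝ] E) :=
    isUniformEmbedding_subtype_val.isUniformInducing
  have hr : DenseRange (P.domain.subtypeL : P.domain →L[ℝ] E) := hdP.denseRange_val
  let Λ₀ : E →L[ℝ] F := f.extend P.domain.subtypeL
  have hΛ : ∀ x : P.domain, Λ₀ x = P x := fun x => f.extend_eq hr he x
  refine ⟨⟨Λ₀, fun x => ?_⟩, fun p hp => ?_⟩
  · refine hdP.denseRange_val.induction_on (p := fun x : E => ‖Λ₀ x‖ = ‖x‖) x ?_ ?_
    · exact isClosed_eq (by fun_prop) (by fun_prop)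
    · intro y
      rw [hΛ y, hn]
  · rw [← hg] at hp
    obtain ⟨x, h1, h2⟩ := (LinearPMap.mem_graph_iff _).1 hp
    rw [← h1, ← h2]
    exact hΛ x

variable [CompleteSpace E] {D : E →ₗ.[ℝ] F} {T : E →ₗ.[ℝ] E}

/-- The standing assumptions on a closable gradient `D` whose domain is contained in that of
`S = D̄* D̄`, and on a square root `T` of `S`. -/
structure IsGradientSqrt (D : E →ₗ.[ℝ] F) (T : E →ₗ.[ℝ] E) : Prop where
  dense : Dense (D.domain : Set E)
  closable : D.IsClosable
  sqrt : IsPositiveSqrt (pcomp D.closure.adjoint D.closure) T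
  domain_le : D.domain ≤ (pcomp D.closure.adjoint D.closure).domain
  eq_zero : ∀ x, (x, (0 : F)) ∈ D.closure.graph → x = 0

namespace IsGradientSqrt

theorem symm (h : IsGradientSqrt D T) {x y x' y' : E} (h1 : (x, y) ∈ T.graph)
    (h2 : (x', y') ∈ T.graph) : ⟪y, x'⟫_ℝ = ⟪x, y'⟫_ℝ := by
  have hadj : T.adjoint = T := h.sqrt.1
  rw [← hadj] at h1
  exact (mem_graph_adjoint h.sqrt.1.dense_domain).1 h1 _ _ h2

theorem dense_closure_domain (h : IsGradientSqrt D T) : Dense (D.closure.domain : Set E) :=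
  h.dense.mono D.le_closure.1

/-- Both sides squared equal `⟪T²x, x⟫ = ⟪D̄*D̄x, x⟫`. Asking for `x ∈ Dom T²` is enough, because
`Dom D` lies there. -/
theorem norm_eq (h : IsGradientSqrt D T) {x y z : E} {u : F} (hxy : (x, y) ∈ T.graph)
    (hyz : (y, z) ∈ T.graph) (hxu : (x, u) ∈ D.closure.graph) : ‖u‖ = ‖y‖ := by
  have h1 : (x, z) ∈ (pcomp D.closure.adjoint D.closure).graph := by
    rw [← h.sqrt.2.2]
    exact mem_graph_pcomp.2 ⟨y, hxy, hyz⟩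
  obtain ⟨u', hu', huz⟩ := mem_graph_pcomp.1 h1
  rw [LinearPMap.mem_graph_snd_inj _ hxu hu' rfl]
  have h2 := (mem_graph_adjoint h.dense_closure_domain).1 huz _ _ hu'
  rw [h.symm hyz hxy, real_inner_self_eq_norm_sq, real_inner_self_eq_norm_sq] at h2
  exact ((sq_eq_sq₀ (norm_nonneg _) (norm_nonneg _)).1 h2).symm

theorem exists_graph (h : IsGradientSqrt D T) {x : E} (hx : x ∈ D.domain) :
    ∃ y z, (x, y) ∈ T.graph ∧ (y, z) ∈ T.graph := by
  obtain ⟨z, hz⟩ := LinearPMap.mem_domain_iff.1 (h.domain_le hx)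
  rw [← h.sqrt.2.2] at hz
  obtain ⟨y, hxy, hyz⟩ := mem_graph_pcomp.1 hz
  exact ⟨y, z, hxy, hyz⟩

theorem domain_le_sqrt (h : IsGradientSqrt D T) : D.domain ≤ T.domain := fun _ hx => by
  obtain ⟨y, z, hxy, -⟩ := h.exists_graph hx
  exact LinearPMap.mem_domain_of_mem_graph hxy

/-- A kernel vector of `T` lies in `Dom T²`, so `norm_eq` puts it in the kernel of the closed
gradient. -/
theorem injective (h : IsGradientSqrt D T) {x : E} (hx : (x, (0 : E)) ∈ T.graph) : x = 0 := by
  have h1 : (x, (0 : E)) ∈ (pcomp D.closure.adjoint D.closure).graph := by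
    rw [← h.sqrt.2.2]
    exact mem_graph_pcomp.2 ⟨0, hx, T.graph.zero_mem⟩
  obtain ⟨u, hu, -⟩ := mem_graph_pcomp.1 h1
  have h2 := h.norm_eq hx T.graph.zero_mem hu
  rw [norm_zero, norm_eq_zero] at h2
  rw [h2] at hu
  exact h.eq_zero x hu

theorem ker_eq_bot (h : IsGradientSqrt D T) : LinearMap.ker T.toFun = ⊥ := by
  rw [eq_bot_iff]
  intro x hx
  have h0 : T x = 0 := hx
  have h1 := T.mem_graph x
  rw [h0] at h1
  exact Subtype.ext (h.injective h1)

/-- `Dom D` is a core for `T`. A point of `Dom T²` is approximated from `Dom D` in the graph norm of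
`D̄`, and `norm_eq` turns this into approximation in the graph norm of `T`. Weak identities tested
on `Dom D` therefore determine values of `T`. -/
theorem mem_graph (h : IsGradientSqrt D T) {w z : E}
    (hwz : ∀ a b, a ∈ D.domain → (a, b) ∈ T.graph → ⟪z, a⟫_ℝ = ⟪w, b⟫_ℝ) : (w, z) ∈ T.graph := by
  refine mem_graph_of_forall_core h.sqrt.1 (𝒜 := D.domain) (fun x y z hxy hyz ε hε => ?_) hwz
  have h1 : (x, z) ∈ (pcomp D.closure.adjoint D.closure).graph := by
    rw [← h.sqrt.2.2]
    exact mem_graph_pcomp.2 ⟨y, hxy, hyz⟩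
  obtain ⟨u, hu, -⟩ := mem_graph_pcomp.1 h1
  have hu' := hu
  rw [← h.closable.graph_closure_eq_closure_graph] at hu'
  obtain ⟨⟨a, v⟩, hav, hdist⟩ := Metric.mem_closure_iff.1 hu' ε hε
  have ha : a ∈ D.domain := LinearPMap.mem_domain_of_mem_graph hav
  obtain ⟨b, c, hab, hbc⟩ := h.exists_graph ha
  rw [Prod.dist_eq, max_lt_iff, dist_eq_norm, dist_eq_norm] at hdist
  refine ⟨a, b, ha, hab, hdist.1.le, ?_⟩
  have hav' : (a, v) ∈ D.closure.graph := LinearPMap.le_graph_of_le D.le_closure hav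
  rw [← h.norm_eq (T.graph.sub_mem hxy hab) (T.graph.sub_mem hyz hbc)
    (D.closure.graph.sub_mem hu hav')]
  exact hdist.2.le

/-- The space `T (Dom D)`. -/
theorem dense_image (h : IsGradientSqrt D T) {K : Submodule ℝ E}
    (hK : ∀ a b, a ∈ D.domain → (a, b) ∈ T.graph → b ∈ K) : Dense (K : Set E) := by
  refine dense_of_forall_inner_eq_zero fun z hz => h.injective (h.mem_graph fun a b ha hab => ?_)
  rw [inner_zero_left, real_inner_comm, hz b (hK a b ha hab)]

/-- The map `T a ↦ D a` preserves norms by `norm_eq`, and the vectors `T a` with `a ∈ Dom D` are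
dense. -/
theorem exists_isometry [CompleteSpace F] (h : IsGradientSqrt D T) : ∃ Λ : E →ₗᵢ[ℝ] F,
    ∀ a b u, (a, b) ∈ T.graph → (a, u) ∈ D.graph → Λ b = u := by
  let M : Submodule ℝ (E × F) :=
    { carrier := {p | ∃ a, (a, p.1) ∈ T.graph ∧ (a, p.2) ∈ D.graph}
      zero_mem' := ⟨0, T.graph.zero_mem, D.graph.zero_mem⟩
      add_mem' := by
        rintro p q ⟨a, h1, h2⟩ ⟨b, h3, h4⟩
        exact ⟨a + b, T.graph.add_mem h1 h3, D.graph.add_mem h2 h4⟩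
      smul_mem' := by
        rintro c p ⟨a, h1, h2⟩
        exact ⟨c • a, T.graph.smul_mem c h1, D.graph.smul_mem c h2⟩ }
  obtain ⟨Λ, hΛ⟩ := exists_linearIsometry_of_graph M (by
    rintro ⟨b, u⟩ ⟨a, hab, hau⟩
    obtain ⟨b', c, hab', hbc⟩ := h.exists_graph (LinearPMap.mem_domain_of_mem_graph hau)
    rw [LinearPMap.mem_graph_snd_inj _ hab hab' rfl]
    exact h.norm_eq hab' hbc (LinearPMap.le_graph_of_le D.le_closure hau)) (by
    refine h.dense_image fun a b ha hab => ?_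
    obtain ⟨u, hu⟩ := LinearPMap.mem_domain_iff.1 ha
    exact ⟨(b, u), ⟨a, hab, hu⟩, rfl⟩)
  exact ⟨Λ, fun a b u hab hau => hΛ (b, u) ⟨a, hab, hau⟩⟩

end IsGradientSqrt

end SqrtOfGradient

end RandomEnv

namespace RandomEnv

/-! ### Summation by parts on a lattice system -/

section Lattice

variable {d : ℕ}

@[simp] theorem Dir.opp_opp (k : Dir d) : k.opp.opp = k := by
  simp [Dir.opp]

theorem Dir.vec_opp (k : Dir d) : k.opp.vec = -k.vec := by
  simp [Dir.opp, Dir.vec, Pi.single_neg]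

theorem sum_opp {M : Type*} [AddCommMonoid M] (f : Dir d → M) : ∑ k : Dir d, f k.opp = ∑ k, f k :=
  Fintype.sum_equiv (Function.Involutive.toPerm Dir.opp Dir.opp_opp) _ _ fun _ => rfl

theorem sum_mul_eq_zero_of_antisymm_symm {ι : Type*} [Fintype ι] (h G : ι → ι → ℝ)
    (hh : ∀ k l, h k l = -h l k) (hG : ∀ k l, G k l = G l k) : ∑ k, ∑ l, h k l * G k l = 0 := by
  have h1 : ∑ k, ∑ l, h k l * G k l = -∑ k, ∑ l, h k l * G k l := by
    nth_rw 1 [Finset.sum_comm]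
    simp only [← Finset.sum_neg_distrib]
    refine Finset.sum_congr rfl fun k _ => Finset.sum_congr rfl fun l _ => ?_
    rw [hh, hG]; ring
  linarith

variable {Y : Type*} [AddAction (Fin d → ℤ) Y]

@[simp] theorem shift_opp_shift (k : Dir d) (y : Y) : shift k.opp (shift k y) = y := by
  rw [shift, shift, Dir.vec_opp, neg_vadd_vadd]

theorem shift_comm (k l : Dir d) (y : Y) : shift k (shift l y) = shift l (shift k y) :=
  vadd_comm _ _ _

variable [MeasurableSpace Y] {μ : Measure Y}

/-- The double lattice difference `∂_l F ∘ τ_k + ∂_l F`. -/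
def twoDiff (F : Y → ℝ) (k l : Dir d) (y : Y) : ℝ :=
  F (shift l (shift k y)) - F (shift k y) + (F (shift l y) - F y)

/-- A stream tensor on a dynamical system and the flow that it generates. -/
structure IsStream (μ : Measure Y) (h : Dir d → Dir d → Y → ℝ) (b : Dir d → Y → ℝ) : Prop where
  opp_left : ∀ k l, ∀ᵐ y ∂μ, h k l y = -h k.opp l (shift k y)
  antisymm : ∀ k l, ∀ᵐ y ∂μ, h k l y = -h l k y
  curl : ∀ k, ∀ᵐ y ∂μ, b k y = ∑ l, h k l y

variable {h : Dir d → Dir d → Y → ℝ} {b : Dir d → Y → ℝ}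

theorem IsStream.sum_eq_zero (H : IsStream μ h b) : ∀ᵐ y ∂μ, ∑ k, b k y = 0 := by
  filter_upwards [eventually_all.2 H.curl, eventually_all.2 fun k => eventually_all.2 (H.antisymm k)]
    with y h1 h2
  simp only [h1]
  simpa using sum_mul_eq_zero_of_antisymm_symm (fun k l => h k l y) (fun _ _ => 1) h2 (by simp)

/-- `twoDiff F k l` plus `2 (F ∘ τ_k - F)` is symmetric in `k`, `l`, because shifts commute. The
antisymmetric `h` annihilates that symmetric part, and `∑_l h_{k,l} = b_k` evaluates the rest. -/
theorem IsStream.sum_twoDiff (H : IsStream μ h b) (F : Y → ℝ) : ∀ᵐ y ∂μ,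
    ∑ k, ∑ l, h k l y * twoDiff F k l y = -2 * ∑ k, b k y * (F (shift k y) - F y) := by
  filter_upwards [eventually_all.2 H.curl,
    eventually_all.2 fun k => eventually_all.2 (H.antisymm k)] with y h1 h2
  have e1 := sum_mul_eq_zero_of_antisymm_symm (fun k l => h k l y)
    (fun k l => F (shift l (shift k y)) + F (shift k y) + F (shift l y) - 3 * F y) h2
    (fun k l => by rw [shift_comm]; ring)
  have e2 : ∑ k, ∑ l, h k l y * twoDiff F k l y = ∑ k, ∑ l, h k l y *
      (F (shift l (shift k y)) + F (shift k y) + F (shift l y) - 3 * F y) +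
      -2 * ∑ k, (∑ l, h k l y) * (F (shift k y) - F y) := by
    simp only [Finset.mul_sum, Finset.sum_mul, ← Finset.sum_add_distrib, twoDiff]
    refine Finset.sum_congr rfl fun k _ => Finset.sum_congr rfl fun l _ => ?_
    ring
  rw [e2, e1, zero_add]
  simp only [h1]

variable [MeasurableConstVAdd (Fin d → ℤ) Y]
  [VAddInvariantMeasure (Fin d → ℤ) Y μ]

theorem measurable_shift (k : Dir d) : Measurable (shift k : Y → Y) :=
  measurable_const_vadd k.vec

theorem measurePreserving_shift (k : Dir d) : MeasurePreserving (shift k : Y → Y) μ μ :=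
  measurePreserving_vadd k.vec μ

theorem integral_comp_shift (k : Dir d) (f : Y → ℝ) : ∫ y, f (shift k y) ∂μ = ∫ y, f y ∂μ :=
  integral_vadd_eq_self f (g := k.vec)

theorem integrable_comp_shift (k : Dir d) {f : Y → ℝ} (hf : Integrable f μ) :
    Integrable (fun y => f (shift k y)) μ :=
  (measurePreserving_shift k).integrable_comp_of_integrable hf

section Antisymm

variable {D : Dir d → Y → ℝ} {g : Y → ℝ}

theorem integrable_antisymm_mul_shift (hD : ∀ k, ∀ᵐ y ∂μ, D k.opp (shift k y) = -D k y)
    (hi : ∀ k, Integrable (fun y => D k y * g y) μ) (k : Dir d) :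
    Integrable (fun y => D k y * g (shift k y)) μ := by
  refine (integrable_comp_shift k (hi k.opp)).neg.congr ?_
  filter_upwards [hD k] with y hy
  rw [Pi.neg_apply, hy]; ring

/-- Summation by parts for an antisymmetric field. -/
theorem integral_sum_antisymm_mul_shift (hD : ∀ k, ∀ᵐ y ∂μ, D k.opp (shift k y) = -D k y)
    (hi : ∀ k, Integrable (fun y => D k y * g y) μ) :
    ∫ y, ∑ k, D k y * g (shift k y) ∂μ = -∫ y, ∑ k, D k y * g y ∂μ := by
  rw [integral_finsetSum _ fun k _ => integrable_antisymm_mul_shift hD hi k,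
    integral_finsetSum _ fun k _ => hi k, ← Finset.sum_neg_distrib,
    ← sum_opp (fun k => -∫ y, D k y * g y ∂μ)]
  refine Finset.sum_congr rfl fun k _ => ?_
  rw [← integral_neg, ← integral_comp_shift k fun y => -(D k.opp y * g y)]
  refine integral_congr_ae ?_
  filter_upwards [hD k] with y hy
  rw [hy]; ring

theorem integral_sum_antisymm_mul_diff (hD : ∀ k, ∀ᵐ y ∂μ, D k.opp (shift k y) = -D k y)
    (hi : ∀ k, Integrable (fun y => D k y * g y) μ) :
    ∫ y, ∑ k, D k y * (g (shift k y) - g y) ∂μ = -2 * ∫ y, (∑ k, D k y) * g y ∂μ := by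
  have h1 := integral_sum_antisymm_mul_shift hD hi
  simp only [mul_sub, Finset.sum_sub_distrib, Finset.sum_mul]
  rw [integral_sub (integrable_finsetSum _ fun k _ => integrable_antisymm_mul_shift hD hi k)
    (integrable_finsetSum _ fun k _ => hi k), h1]
  ring

theorem integral_sum_antisymm (hD : ∀ k, ∀ᵐ y ∂μ, D k.opp (shift k y) = -D k y)
    (hi : ∀ k, Integrable (D k) μ) : ∫ y, ∑ k, D k y ∂μ = 0 := by
  have := integral_sum_antisymm_mul_shift (g := fun _ => 1) hD (by simpa using hi)
  simp only [mul_one] at this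
  linarith

end Antisymm

/-- The bilinear form of the flow in terms of its stream tensor. -/
theorem IsStream.integral_form (H : IsStream μ h b) {F g : Y → ℝ}
    (hi : ∀ k l, Integrable (fun y => h k l y * twoDiff F k l y * g y) μ) :
    ∫ y, ∑ k, (∑ l, h k l y * twoDiff F k l y) * (g (shift k y) - g y) ∂μ =
      4 * ∫ y, (∑ k, b k y * (F (shift k y) - F y)) * g y ∂μ := by
  -- The field `∑_l h_{k,l} twoDiff F k l` changes sign when the edge is reversed, since `h` does
  -- and `twoDiff F k l` takes the same value from either end. One summation by parts then leaves
  -- the sum computed in `sum_twoDiff`.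
  rw [integral_sum_antisymm_mul_diff (D := fun k y => ∑ l, h k l y * twoDiff F k l y)]
  · have : ∫ y, (∑ k, ∑ l, h k l y * twoDiff F k l y) * g y ∂μ =
        ∫ y, -2 * ((∑ k, b k y * (F (shift k y) - F y)) * g y) ∂μ := by
      refine integral_congr_ae ?_
      filter_upwards [H.sum_twoDiff F] with y hy
      rw [hy]; ring
    rw [this, integral_const_mul]
    ring
  · intro k
    filter_upwards [eventually_all.2 (H.opp_left k)] with y hy
    rw [← Finset.sum_neg_distrib]
    refine Finset.sum_congr rfl fun l _ => ?_
    rw [hy l, twoDiff, twoDiff, shift_opp_shift]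
    ring
  · intro k
    simp only [Finset.sum_mul]
    exact integrable_finsetSum _ fun l _ => hi k l

/-- Skew symmetry of the generator of a divergence free flow. -/
theorem integral_flow_skew (hb : ∀ k y, b k.opp (shift k y) = -b k y)
    (h0 : ∀ᵐ y ∂μ, ∑ k, b k y = 0) {f g : Y → ℝ}
    (hi : ∀ k, Integrable (fun y => b k y * (f (shift k y) - f y) * g y) μ)
    (hj : ∀ k, Integrable (fun y => b k y * (g (shift k y) - g y) * f y) μ)
    (hfg : ∀ k, Integrable (fun y => b k y * (f y * g y)) μ) :
    ∫ y, (∑ k, b k y * (f (shift k y) - f y)) * g y ∂μ =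
      -∫ y, (∑ k, b k y * (g (shift k y) - g y)) * f y ∂μ := by
  -- The integrand is `b_k (f ∘ τ_k · g + g ∘ τ_k · f)`, antisymmetric under reversal. The extra `2
  -- b_k f g` sums to zero because the flow is divergence free.
  have h1 := integral_sum_antisymm (μ := μ)
    (D := fun k y => b k y * (f (shift k y) - f y) * g y + b k y * (g (shift k y) - g y) * f y +
      2 * (b k y * (f y * g y)))
    (fun k => Eventually.of_forall fun y => by
      rw [hb, shift_opp_shift]; ring)
    (fun k => ((hi k).add (hj k)).add ((hfg k).const_mul 2))
  have h2 : ∫ y, ∑ k, (b k y * (f (shift k y) - f y) * g y +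
      b k y * (g (shift k y) - g y) * f y + 2 * (b k y * (f y * g y))) ∂μ =
      ∫ y, ((∑ k, b k y * (f (shift k y) - f y)) * g y +
        (∑ k, b k y * (g (shift k y) - g y)) * f y) ∂μ := by
    refine integral_congr_ae ?_
    filter_upwards [h0] with y hy
    have : ∑ k, 2 * (b k y * (f y * g y)) = 0 := by
      rw [← Finset.mul_sum, ← Finset.sum_mul, hy]; ring
    rw [Finset.sum_add_distrib, Finset.sum_add_distrib, this, add_zero, Finset.sum_mul,
      Finset.sum_mul]
  rw [h2, integral_add] at h1
  · linarith
  · simp only [Finset.sum_mul]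
    exact integrable_finsetSum _ fun k _ => hi k
  · simp only [Finset.sum_mul]
    exact integrable_finsetSum _ fun k _ => hj k

end Lattice

end RandomEnv

namespace RandomEnv

/-! ### Ergodicity -/

section Ergodic

variable {d : ℕ} {Ω : Type*} [MeasurableSpace Ω] [AddAction (Fin d → ℤ) Ω]
  [MeasurableConstVAdd (Fin d → ℤ) Ω] {π : Measure Ω}

/-- The lattice vectors that leave `f` almost everywhere invariant form a subgroup, and it contains
the generators. -/
theorem ae_vadd_eq_of_shift_eq [VAddInvariantMeasure (Fin d → ℤ) Ω π] {f : Ω → ℝ}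
    (hf : ∀ k : Dir d, ∀ᵐ ω ∂π, f (shift k ω) = f ω) (z : Fin d → ℤ) :
    ∀ᵐ ω ∂π, f (z +ᵥ ω) = f ω := by
  let H : AddSubgroup (Fin d → ℤ) :=
    { carrier := {z | ∀ᵐ ω ∂π, f (z +ᵥ ω) = f ω}
      zero_mem' := by simp
      add_mem' := by
        intro a b ha hb
        have ha' := (measurePreserving_vadd b π).quasiMeasurePreserving.ae ha
        change ∀ᵐ ω ∂π, f ((a + b) +ᵥ ω) = f ω
        filter_upwards [ha', hb] with ω h1 h2
        rw [add_vadd, h1, h2]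
      neg_mem' := by
        intro a ha
        have ha' := (measurePreserving_vadd (-a) π).quasiMeasurePreserving.ae ha
        change ∀ᵐ ω ∂π, f (-a +ᵥ ω) = f ω
        filter_upwards [ha'] with ω h1
        rw [vadd_neg_vadd] at h1
        exact h1.symm }
  change z ∈ H
  rw [← Finset.univ_sum_single z]
  refine H.sum_mem fun i _ => ?_
  have h1 : Pi.single i (z i) = z i • (Pi.single i 1 : Fin d → ℤ) := by
    rw [← Pi.single_smul, smul_eq_mul, mul_one]
  rw [h1]
  refine H.zsmul_mem ?_ _
  have := hf (i, 1)
  change ∀ᵐ ω ∂π, f (Pi.single i 1 +ᵥ ω) = f ω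
  simpa only [shift, Dir.vec, Units.val_one] using this

theorem ae_const_of_shift_eq [IsProbabilityMeasure π] [ErgodicVAdd (Fin d → ℤ) Ω π] {f : Ω → ℝ}
    (hm : Measurable f) (hf : ∀ k : Dir d, ∀ᵐ ω ∂π, f (shift k ω) = f ω) :
    ∃ c, ∀ᵐ ω ∂π, f ω = c := by
  obtain ⟨c, hc⟩ := exists_eventuallyEq_const_of_forall_separating (l := ae π) (f := f)
    MeasurableSet fun U hU => by
      have h := aeconst_of_forall_preimage_vadd_ae_eq (μ := π) (Fin d → ℤ)
        (hm hU).nullMeasurableSet fun z => by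
          filter_upwards [ae_vadd_eq_of_shift_eq hf z] with ω hω
          exact propext (by
            change f (z +ᵥ ω) ∈ U ↔ f ω ∈ U
            rw [hω])
      exact eventuallyConst_set.1 h
  exact ⟨c, hc⟩

end Ergodic

/-! ### Facts on the `L²` spaces -/

section LpFacts

variable {Ω : Type*} [MeasurableSpace Ω] {π : Measure Ω}

theorem exists_subseq_ae_tendsto_of_Lp {u : ℕ → Lp ℝ 2 π} {v : Lp ℝ 2 π}
    (h : Tendsto u atTop (nhds v)) :
    ∃ ns : ℕ → ℕ, StrictMono ns ∧ ∀ᵐ ω ∂π, Tendsto (fun i => u (ns i) ω) atTop (nhds (v ω)) :=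
  (tendstoInMeasure_of_tendsto_Lp h).exists_seq_tendsto_ae

theorem CentredL2.inner_eq [IsProbabilityMeasure π] (x y : CentredL2 π) :
    ⟪x, y⟫_ℝ = ∫ ω, (x : Lp ℝ 2 π) ω * (y : Lp ℝ 2 π) ω ∂π := by
  rw [Submodule.coe_inner, L2.inner_def]
  exact integral_congr_ae (Eventually.of_forall fun ω => by
    simp only [RCLike.inner_apply, conj_trivial]; ring)

theorem Fields.inner_eq {d : ℕ} (x y : Fields d π) :
    ⟪x, y⟫_ℝ = ∫ ω, ∑ k, x k ω * y k ω ∂π := by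
  have h : ∀ k, Integrable (fun ω => x k ω * y k ω) π := fun k =>
    (Lp.memLp (x k)).integrable_mul (Lp.memLp (y k))
  rw [PiLp.inner_apply, integral_finsetSum _ fun k _ => h k]
  refine Finset.sum_congr rfl fun k _ => ?_
  rw [L2.inner_def]
  exact integral_congr_ae (Eventually.of_forall fun ω => by
    simp only [RCLike.inner_apply, conj_trivial]; ring)

theorem CentredL2.integral_eq_zero [IsProbabilityMeasure π] (x : CentredL2 π) :
    ∫ ω, (x : Lp ℝ 2 π) ω ∂π = 0 := x.2

theorem CentredL2.exists_of_memLp [IsProbabilityMeasure π] {f : Ω → ℝ} (hf : MemLp f 2 π)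
    (h0 : ∫ ω, f ω ∂π = 0) : ∃ x : CentredL2 π, ∀ᵐ ω ∂π, (x : Lp ℝ 2 π) ω = f ω :=
  ⟨⟨hf.toLp f, (integral_congr_ae hf.coeFn_toLp).trans h0⟩, hf.coeFn_toLp⟩

theorem CentredL2.ext_ae [IsProbabilityMeasure π] {x y : CentredL2 π}
    (h : ∀ᵐ ω ∂π, (x : Lp ℝ 2 π) ω = (y : Lp ℝ 2 π) ω) : x = y :=
  Subtype.ext (Lp.ext h)

variable [IsProbabilityMeasure π]

theorem memLp_of_ae_abs_le {f : Ω → ℝ} (hf : AEStronglyMeasurable f π) {C : ℝ}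
    (h : ∀ᵐ ω ∂π, |f ω| ≤ C) {p : ℝ≥0∞} : MemLp f p π :=
  MemLp.of_bound hf C h

theorem integrable_of_ae_abs_le {f : Ω → ℝ} (hf : AEStronglyMeasurable f π) {C : ℝ}
    (h : ∀ᵐ ω ∂π, |f ω| ≤ C) : Integrable f π :=
  Integrable.of_bound hf C h

end LpFacts

/-! ### Coefficients, good sets and density of the core -/

namespace Rates

variable {d : ℕ} {Ω : Type*} [MeasurableSpace Ω] [AddAction (Fin d → ℤ) Ω] {π : Measure Ω}
  (X : Rates d Ω π)

theorem s_opp (k : Dir d) (ω : Ω) : X.s k.opp (shift k ω) = X.s k ω := by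
  simp only [s, symPart, shift_opp_shift, Dir.opp_opp, add_comm]

theorem r_opp (k : Dir d) (ω : Ω) : X.r k.opp (shift k ω) = X.r k ω := by
  simp only [r, s_opp]

theorem b_opp (k : Dir d) (ω : Ω) : X.b k.opp (shift k ω) = -X.b k ω := by
  simp only [b, antisymPart, shift_opp_shift, Dir.opp_opp]
  ring

theorem isStream : IsStream π X.h X.b := ⟨X.h_opp_left, X.h_antisymm, X.curl⟩

theorem r_nonneg (k : Dir d) (ω : Ω) : 0 ≤ X.r k ω := Real.sqrt_nonneg _

theorem r_pos : ∀ᵐ ω ∂π, ∀ k, 0 < X.r k ω :=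
  eventually_all.2 fun k => (X.weakly_elliptic k).mono fun _ h => Real.sqrt_pos.2 h

theorem r_sq : ∀ᵐ ω ∂π, ∀ k, X.r k ω ^ 2 = X.s k ω :=
  eventually_all.2 fun k => (X.weakly_elliptic k).mono fun _ h => Real.sq_sqrt h.le

section Measurability

variable [MeasurableConstVAdd (Fin d → ℤ) Ω]

theorem measurable_s (k : Dir d) : Measurable (X.s k) :=
  ((X.measurable_p k).add ((X.measurable_p _).comp (measurable_shift k))).div_const 2

theorem measurable_r (k : Dir d) : Measurable (X.r k) := (X.measurable_s k).sqrt

theorem measurable_b (k : Dir d) : Measurable (X.b k) :=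
  ((X.measurable_p k).sub ((X.measurable_p _).comp (measurable_shift k))).div_const 2

theorem measurableSet_goodSet (K : ℝ) : MeasurableSet (X.goodSet K) := by
  have h1 : ∀ k m : Dir d, Measurable fun ω => X.r k (shift m ω) := fun k m =>
    (X.measurable_r k).comp (measurable_shift m)
  have h2 : ∀ k l m : Dir d, Measurable fun ω => X.h k l (shift m ω) := fun k l m =>
    (X.measurable_h k l).comp (measurable_shift m)
  have h3 := X.measurable_r
  have h4 := X.measurable_h
  have : X.goodSet K = ⋂ k : Dir d, ⋂ l : Dir d, ⋂ m : Dir d,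
      {ω | X.r k ω ≤ K} ∩ ({ω | (X.r k ω)⁻¹ ≤ K} ∩ ({ω | X.r k (shift m ω) ≤ K} ∩
      ({ω | (X.r k (shift m ω))⁻¹ ≤ K} ∩ ({ω | |X.h k l ω| ≤ K} ∩
        {ω | |X.h k l (shift m ω)| ≤ K})))) := by
    ext ω
    simp only [goodSet, Set.mem_iInter, Set.mem_inter_iff, Set.mem_ofPred_eq]
  rw [this]
  refine MeasurableSet.iInter fun k => MeasurableSet.iInter fun l => MeasurableSet.iInter fun m => ?_
  refine (measurableSet_le (h3 k) measurable_const).inter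
    ((measurableSet_le (h3 k).inv measurable_const).inter
    ((measurableSet_le (h1 k m) measurable_const).inter
    ((measurableSet_le (h1 k m).inv measurable_const).inter
    ((measurableSet_le (h4 k l).abs measurable_const).inter
    (measurableSet_le (h2 k l m).abs measurable_const)))))

end Measurability

/-- The good sets exhaust all of `Ω`, without an exceptional null set: finitely many real numbers
have to be bounded, and `0⁻¹ = 0` keeps this true where some `r_k` vanishes. -/
theorem exists_mem_goodSet (ω : Ω) : ∃ n : ℕ, ω ∈ X.goodSet n := by
  have : ∀ k l m : Dir d, ∃ n : ℕ, ∀ n' ≥ n, X.r k ω ≤ n' ∧ (X.r k ω)⁻¹ ≤ n' ∧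
      X.r k (shift m ω) ≤ n' ∧ (X.r k (shift m ω))⁻¹ ≤ n' ∧
      |X.h k l ω| ≤ n' ∧ |X.h k l (shift m ω)| ≤ n' := by
    intro k l m
    have ht := tendsto_natCast_atTop_atTop (R := ℝ)
    refine eventually_atTop.1 ?_
    filter_upwards [ht.eventually_ge_atTop (X.r k ω), ht.eventually_ge_atTop (X.r k ω)⁻¹,
      ht.eventually_ge_atTop (X.r k (shift m ω)), ht.eventually_ge_atTop (X.r k (shift m ω))⁻¹,
      ht.eventually_ge_atTop |X.h k l ω|, ht.eventually_ge_atTop |X.h k l (shift m ω)|]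
      with n h1 h2 h3 h4 h5 h6
    exact ⟨h1, h2, h3, h4, h5, h6⟩
  choose n hn using this
  refine ⟨∑ k, ∑ l, ∑ m, n k l m, fun k l m => hn k l m _ ?_⟩
  refine (Finset.single_le_sum (f := fun m => n k l m) (fun _ _ => Nat.zero_le _)
    (Finset.mem_univ m)).trans ?_
  refine (Finset.single_le_sum (f := fun l => ∑ m, n k l m) (fun _ _ => Nat.zero_le _)
    (Finset.mem_univ l)).trans ?_
  exact Finset.single_le_sum (f := fun k => ∑ l, ∑ m, n k l m) (fun _ _ => Nat.zero_le _)
    (Finset.mem_univ k)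

section Invariant

variable [MeasurableConstVAdd (Fin d → ℤ) Ω] [VAddInvariantMeasure (Fin d → ℤ) Ω π]

theorem abs_b_le_s : ∀ᵐ ω ∂π, ∀ k, |X.b k ω| ≤ X.s k ω := by
  refine eventually_all.2 fun k => ?_
  filter_upwards [X.nonneg k, shift_ae k (X.nonneg k.opp)] with ω h1 h2
  simp only [b, s, antisymPart, symPart]
  rw [abs_le]
  constructor <;> linarith

/-- If a shift of `ω` by at most one step in each of the directions `k`, `l` is in the good set,
then the coefficients on the plaquette spanned by `k`, `l` are bounded. -/
theorem plaquette_bound : ∀ᵐ ω ∂π, ∀ (k l : Dir d) (K : ℝ) (y : Ω),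
    (y = ω ∨ y = shift k ω ∨ y = shift l ω ∨ y = shift l (shift k ω)) → y ∈ X.goodSet K →
      X.r k ω ≤ K ∧ (X.r k ω)⁻¹ ≤ K ∧ |X.h k l ω| ≤ K := by
  filter_upwards [eventually_all.2 fun k => eventually_all.2 fun l => X.h_opp_left k l,
    eventually_all.2 fun k => eventually_all.2 fun l => X.h_opp_right k l,
    eventually_all.2 fun k : Dir d => eventually_all.2 fun l =>
      shift_ae k (X.h_opp_right k.opp l)] with ω h1 h2 h3 k l K y hy hK
  -- From each corner, the edge `(ω, k)` is recovered by reversing `k`, by stepping back along `l`,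
  -- or both. The first reversal uses `r_opp` and the sign rules of `h`. The step back uses that a
  -- good set also controls `r` at the neighbours.
  rcases hy with rfl | rfl | rfl | rfl
  · obtain ⟨e1, e2, -, -, e5, -⟩ := hK k l k
    exact ⟨e1, e2, e5⟩
  · obtain ⟨e1, e2, -, -, e5, -⟩ := hK k.opp l k
    rw [r_opp] at e1 e2
    rw [h1 k l, abs_neg]
    exact ⟨e1, e2, e5⟩
  · obtain ⟨-, -, e3, e4, -, -⟩ := hK k l l.opp
    rw [shift_opp_shift] at e3 e4
    obtain ⟨-, -, -, -, e5, -⟩ := hK k l.opp l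
    rw [h2 k l, abs_neg]
    exact ⟨e3, e4, e5⟩
  · obtain ⟨-, -, e3, e4, -, -⟩ := hK k.opp l l.opp
    rw [shift_opp_shift, r_opp] at e3 e4
    obtain ⟨-, -, -, -, e5, -⟩ := hK k.opp l.opp l
    rw [h1 k l, abs_neg, h3 k l, abs_neg]
    exact ⟨e3, e4, e5⟩

end Invariant

section Core

variable [IsProbabilityMeasure π]

variable [MeasurableConstVAdd (Fin d → ℤ) Ω]

/-- An integrable function that is orthogonal to the core is constant. -/
theorem ae_eq_integral_of_orthogonal_core {φ : Ω → ℝ} (hφ : Integrable φ π)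
    (h : ∀ g ∈ X.core, ∫ ω, φ ω * ((g : CentredL2 π) : Lp ℝ 2 π) ω ∂π = 0) :
    ∀ᵐ ω ∂π, φ ω = ∫ ω, φ ω ∂π := by
  have hG : ∀ n : ℕ, MeasurableSet (X.goodSet n) := fun n => X.measurableSet_goodSet n
  have key : ∀ A, MeasurableSet A → ∀ n : ℕ,
      π.real (X.goodSet n) * ∫ ω in A ∩ X.goodSet n, φ ω ∂π =
        π.real (A ∩ X.goodSet n) * ∫ ω in X.goodSet n, φ ω ∂π := by
    intro A hA n
    set G := X.goodSet n with hGdef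
    -- The combination of the two indicators that has mean zero, hence lies in the core. In the
    -- limit `n → ∞` orthogonality becomes `∫_A φ = π(A) ∫ φ`.
    set f : Ω → ℝ := fun ω => (A ∩ G).indicator (fun _ => π.real G) ω -
      G.indicator (fun _ => π.real (A ∩ G)) ω with hf
    have hfm : Measurable f := (measurable_const.indicator (hA.inter (hG n))).sub
      (measurable_const.indicator (hG n))
    have hfb : ∀ ω, |f ω| ≤ 2 := by
      intro ω
      have e1 : |(A ∩ G).indicator (fun _ => π.real G) ω| ≤ 1 := by
        rw [← Real.norm_eq_abs]
        refine (norm_indicator_le_norm_self _ _).trans ?_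
        rw [Real.norm_of_nonneg measureReal_nonneg]
        exact measureReal_le_one
      have e2 : |G.indicator (fun _ => π.real (A ∩ G)) ω| ≤ 1 := by
        rw [← Real.norm_eq_abs]
        refine (norm_indicator_le_norm_self _ _).trans ?_
        rw [Real.norm_of_nonneg measureReal_nonneg]
        exact measureReal_le_one
      refine (abs_sub _ _).trans ?_
      linarith
    have hf2 : MemLp f 2 π := memLp_of_ae_abs_le hfm.aestronglyMeasurable (Eventually.of_forall hfb)
    have hi1 : Integrable ((A ∩ G).indicator fun _ : Ω => π.real G) π :=
      (integrable_const _).indicator (hA.inter (hG n))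
    have hi2 : Integrable (G.indicator fun _ : Ω => π.real (A ∩ G)) π :=
      (integrable_const _).indicator (hG n)
    have hf0 : ∫ ω, f ω ∂π = 0 := by
      rw [hf, integral_sub hi1 hi2, integral_indicator_const _ (hA.inter (hG n)),
        integral_indicator_const _ (hG n), smul_eq_mul, smul_eq_mul]
      ring
    obtain ⟨g, hg⟩ := CentredL2.exists_of_memLp hf2 hf0
    have hgc : g ∈ X.core := by
      refine ⟨⟨2, hg.mono fun ω hω => by rw [hω]; exact hfb ω⟩, ⟨n, hg.mono fun ω hω hn => ?_⟩⟩
      rw [hω, hf]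
      dsimp only
      rw [Set.indicator_of_notMem hn, Set.indicator_of_notMem fun h' => hn h'.2, sub_zero]
    have h1 := h g hgc
    have h2 : ∫ ω, φ ω * (g : Lp ℝ 2 π) ω ∂π = ∫ ω, ((A ∩ G).indicator (fun ω => π.real G * φ ω) ω -
        G.indicator (fun ω => π.real (A ∩ G) * φ ω) ω) ∂π := by
      refine integral_congr_ae (hg.mono fun ω hω => ?_)
      dsimp only
      rw [hω, hf]
      by_cases hωA : ω ∈ A <;> by_cases hωG : ω ∈ G <;> simp [hωA, hωG] <;> ring
    rw [h2, integral_sub ((hφ.const_mul _).indicator (hA.inter (hG n)))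
      ((hφ.const_mul _).indicator (hG n)), integral_indicator (hA.inter (hG n)),
      integral_indicator (hG n), integral_const_mul, integral_const_mul] at h1
    linarith
  have hmono : Monotone fun n : ℕ => X.goodSet n := fun m n hmn =>
    X.goodSet_mono (Nat.cast_le.2 hmn)
  have hU : ⋃ n : ℕ, X.goodSet n = Set.univ :=
    Set.eq_univ_of_forall fun ω => Set.mem_iUnion.2 (X.exists_mem_goodSet ω)
  have hlim : ∀ A, MeasurableSet A → ∀ ψ : Ω → ℝ, Integrable ψ π →
      Tendsto (fun n : ℕ => ∫ ω in A ∩ X.goodSet n, ψ ω ∂π) atTop (nhds (∫ ω in A, ψ ω ∂π)) := by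
    intro A hA ψ hψ
    have := tendsto_setIntegral_of_monotone (s := fun n : ℕ => A ∩ X.goodSet n)
      (fun n => hA.inter (hG n)) (fun m n hmn => Set.inter_subset_inter_right A (hmono hmn))
      hψ.integrableOn
    rwa [← Set.inter_iUnion, hU, Set.inter_univ] at this
  have hone : ∀ A : Set Ω, π.real A = ∫ _ in A, (1 : ℝ) ∂π := fun A => by simp
  refine hφ.ae_eq_of_forall_setIntegral_eq _ _ (integrable_const _) fun A hA _ => ?_
  have hl := ((hlim _ MeasurableSet.univ _ (integrable_const (1 : ℝ))).mul (hlim A hA φ hφ))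
  have hr := ((hlim A hA _ (integrable_const (1 : ℝ))).mul (hlim _ MeasurableSet.univ φ hφ))
  simp only [← hone, Set.univ_inter] at hl hr
  have := tendsto_nhds_unique (hl.congr fun n => key A hA n) hr
  simp only [probReal_univ, one_mul, Measure.restrict_univ] at this
  rw [this, setIntegral_const, smul_eq_mul]

end Core

end Rates

end RandomEnv

/-! ### The operators on the core, through their graphs -/

namespace RandomEnv

theorem mem_graph_domRestrict {E F : Type*} [AddCommGroup E] [Module ℝ E] [AddCommGroup F]
    [Module ℝ F] {f : E →ₗ.[ℝ] F} {S : Submodule ℝ E} {x : E} {y : F} :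
    (x, y) ∈ (f.domRestrict S).graph ↔ x ∈ S ∧ (x, y) ∈ f.graph := by
  constructor
  · intro h
    obtain ⟨a, h1, h2⟩ := (LinearPMap.mem_graph_iff _).1 h
    dsimp only at h1 h2
    subst h1
    refine ⟨a.2.1, (LinearPMap.mem_graph_iff _).2 ⟨⟨a, a.2.2⟩, rfl, ?_⟩⟩
    rw [← h2]
    exact (LinearPMap.domRestrict_apply rfl).symm
  · rintro ⟨hx, h⟩
    obtain ⟨a, h1, h2⟩ := (LinearPMap.mem_graph_iff _).1 h
    dsimp only at h1 h2
    subst h1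
    refine (LinearPMap.mem_graph_iff _).2 ⟨⟨a, hx, a.2⟩, rfl, ?_⟩
    rw [← h2]
    exact LinearPMap.domRestrict_apply rfl

section Pointwise

variable {d : ℕ} {Ω : Type*} [MeasurableSpace Ω] {π : Measure Ω} {E : Type*} [AddCommGroup E]
  [Module ℝ E]

theorem mem_graph_fieldOp {P : E → Dir d → Ω → ℝ} {hadd hsmul} {f : E} {u : Fields d π} :
    (f, u) ∈ (fieldOp (π := π) P hadd hsmul).graph ↔ ∀ k, ∀ᵐ ω ∂π, u k ω = P f k ω := by
  constructor
  · intro h k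
    obtain ⟨a, h1, h2⟩ := (LinearPMap.mem_graph_iff _).1 h
    dsimp only at h1 h2
    subst h1 h2
    exact (a.2 k).coeFn_toLp
  · intro h
    have hm : ∀ k, MemLp (P f k) 2 π := fun k => (memLp_congr_ae (h k)).1 (Lp.memLp (u k))
    refine (LinearPMap.mem_graph_iff _).2 ⟨⟨f, hm⟩, rfl, ?_⟩
    apply PiLp.ext
    intro k
    refine Lp.ext ?_
    have h1 : (hm k).toLp (P f k) =ᵐ[π] P f k := (hm k).coeFn_toLp
    exact h1.trans (Filter.EventuallyEq.symm (h k))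

theorem mem_graph_scalarOp [IsProbabilityMeasure π] {P : E → Ω → ℝ} {hadd hsmul} {f : E}
    {u : CentredL2 π} :
    (f, u) ∈ (scalarOp (π := π) P hadd hsmul).graph ↔
      ∀ᵐ ω ∂π, (u : Lp ℝ 2 π) ω = P f ω := by
  constructor
  · intro h
    obtain ⟨a, h1, h2⟩ := (LinearPMap.mem_graph_iff _).1 h
    dsimp only at h1 h2
    subst h1 h2
    exact a.2.1.coeFn_toLp
  · intro h
    have hm : MemLp (P f) 2 π := (memLp_congr_ae h).1 (Lp.memLp (u : Lp ℝ 2 π))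
    have h0 : ∫ ω, P f ω ∂π = 0 := by
      rw [← integral_congr_ae h]
      exact u.2
    refine (LinearPMap.mem_graph_iff _).2 ⟨⟨f, hm, h0⟩, rfl, ?_⟩
    exact CentredL2.ext_ae (hm.coeFn_toLp.trans (Filter.EventuallyEq.symm h))

end Pointwise

namespace Rates

variable {d : ℕ} {Ω : Type*} [MeasurableSpace Ω] [AddAction (Fin d → ℤ) Ω] {π : Measure Ω}
  (X : Rates d Ω π) [MeasurableConstVAdd (Fin d → ℤ) Ω]

theorem mem_graph_streamOp [VAddInvariantMeasure (Fin d → ℤ) Ω π] {u v : Fields d π} : (u, v) ∈ X.streamOp.graph ↔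
    ∀ k, ∀ᵐ ω ∂π, v k ω = (X.r k ω)⁻¹ * (1 / 2 * ∑ l, X.h k l ω *
      ((X.r l (shift k ω))⁻¹ * u l (shift k ω) + (X.r l ω)⁻¹ * u l ω)) := mem_graph_fieldOp

variable [IsProbabilityMeasure π]

theorem measurable_coe (f : CentredL2 π) : Measurable ((f : Lp ℝ 2 π) : Ω → ℝ) :=
  (Lp.stronglyMeasurable (f : Lp ℝ 2 π)).measurable

theorem measurable_diff (f : CentredL2 π) (k : Dir d) : Measurable (diff f k) :=
  ((measurable_coe f).comp (measurable_shift k)).sub (measurable_coe f)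

theorem measurable_twoDiff {f : Ω → ℝ} (hf : Measurable f) (k l : Dir d) :
    Measurable (twoDiff f k l) :=
  ((hf.comp ((measurable_shift l).comp (measurable_shift k))).sub
    (hf.comp (measurable_shift k))).add ((hf.comp (measurable_shift l)).sub hf)

/-- A vector orthogonal to the core is almost surely equal to its mean, and that mean is zero. -/
theorem dense_core : Dense (X.core : Set (CentredL2 π)) := by
  refine dense_of_forall_inner_eq_zero fun f hf => ?_
  have h1 := X.ae_eq_integral_of_orthogonal_core
    ((Lp.memLp (f : Lp ℝ 2 π)).integrable (by norm_num)) fun g hg => by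
      rw [← CentredL2.inner_eq, real_inner_comm]
      exact hf g hg
  rw [CentredL2.integral_eq_zero f] at h1
  exact CentredL2.ext_ae (Filter.EventuallyEq.trans h1 (Lp.coeFn_zero ℝ 2 π).symm)

variable [VAddInvariantMeasure (Fin d → ℤ) Ω π]

/-- All the coefficients are bounded on the supports of the differences of a function in the
core. -/
theorem core_bound {f : CentredL2 π} (hf : f ∈ X.core) : ∃ M : ℝ, ∀ᵐ ω ∂π,
    |(f : Lp ℝ 2 π) ω| ≤ M ∧ ∀ k l, |diff f k ω| ≤ M ∧
      |X.h k l ω * twoDiff (f : Lp ℝ 2 π) k l ω| ≤ M ∧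
      |(X.r k ω)⁻¹ * (X.h k l ω * twoDiff (f : Lp ℝ 2 π) k l ω)| ≤ M ∧
      |X.r k ω * diff f k ω| ≤ M ∧ |X.s k ω * diff f k ω| ≤ M ∧ |X.b k ω * diff f k ω| ≤ M ∧
      |X.b k ω * (f : Lp ℝ 2 π) ω| ≤ M := by
  obtain ⟨⟨C, hC⟩, ⟨K₀, hK₀⟩⟩ := hf
  -- With `K ≥ 1`, the bounds `K` and `K²` of all the coefficients are covered by `K²`.
  set K := max K₀ 1 with hK
  have hK1 : 1 ≤ K := le_max_right _ _
  have hC0 : 0 ≤ C := by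
    obtain ⟨ω, hω⟩ := hC.exists
    exact (abs_nonneg _).trans hω
  have hfK : ∀ᵐ ω ∂π, |(f : Lp ℝ 2 π) ω| ≤ C ∧
      (ω ∉ X.goodSet K → (f : Lp ℝ 2 π) ω = 0) := by
    filter_upwards [hC, hK₀] with ω h1 h2
    exact ⟨h1, fun h => h2 fun h' => h (X.goodSet_mono (le_max_left _ _) h')⟩
  refine ⟨4 * (K ^ 2 * C), ?_⟩
  have hKC : C ≤ K ^ 2 * C := le_mul_of_one_le_left hC0 (one_le_pow₀ hK1)
  filter_upwards [hfK, eventually_all.2 fun k : Dir d => shift_ae k hfK,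
    eventually_all.2 fun k : Dir d => eventually_all.2 fun l : Dir d =>
      shift_ae k (shift_ae l hfK), X.plaquette_bound, X.abs_b_le_s, X.r_sq]
    with ω h0 h1 h2 hp hb hr
  -- If `f` does not vanish at a corner of the plaquette, that corner is good and `plaquette_bound`
  -- controls the coefficients at `ω`.
  have key : ∀ (k l : Dir d) (y : Ω),
      (y = ω ∨ y = shift k ω ∨ y = shift l ω ∨ y = shift l (shift k ω)) → ∀ c : ℝ,
      (X.r k ω ≤ K → (X.r k ω)⁻¹ ≤ K → |X.h k l ω| ≤ K → |c| ≤ K ^ 2) →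
      |c * (f : Lp ℝ 2 π) y| ≤ K ^ 2 * C := by
    intro k l y hy c hc
    have hfy : |(f : Lp ℝ 2 π) y| ≤ C ∧ (y ∉ X.goodSet K → (f : Lp ℝ 2 π) y = 0) := by
      rcases hy with rfl | rfl | rfl | rfl
      exacts [h0, h1 k, h1 l, h2 k l]
    by_cases hyK : y ∈ X.goodSet K
    · obtain ⟨e1, e2, e3⟩ := hp k l K y hy hyK
      rw [abs_mul]
      exact mul_le_mul (hc e1 e2 e3) hfy.1 (abs_nonneg _) (by positivity)
    · rw [hfy.2 hyK, mul_zero, abs_zero]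
      positivity
  have kdiff : ∀ (k l : Dir d) (c : ℝ),
      (X.r k ω ≤ K → (X.r k ω)⁻¹ ≤ K → |X.h k l ω| ≤ K → |c| ≤ K ^ 2) →
      |c * diff f k ω| ≤ 4 * (K ^ 2 * C) := by
    intro k l c hc
    have e1 := key k l _ (.inl rfl) c hc
    have e2 := key k l _ (.inr (.inl rfl)) c hc
    rw [diff, mul_sub]
    refine (abs_sub _ _).trans ?_
    linarith [hC0.trans hKC]
  have ktwo : ∀ (k l : Dir d) (c : ℝ),
      (X.r k ω ≤ K → (X.r k ω)⁻¹ ≤ K → |X.h k l ω| ≤ K → |c| ≤ K ^ 2) →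
      |c * twoDiff (f : Lp ℝ 2 π) k l ω| ≤ 4 * (K ^ 2 * C) := by
    intro k l c hc
    have e1 := abs_le.1 (key k l _ (.inl rfl) c hc)
    have e2 := abs_le.1 (key k l _ (.inr (.inl rfl)) c hc)
    have e3 := abs_le.1 (key k l _ (.inr (.inr (.inl rfl))) c hc)
    have e4 := abs_le.1 (key k l _ (.inr (.inr (.inr rfl))) c hc)
    rw [twoDiff, mul_add, mul_sub, mul_sub, abs_le]
    constructor <;> linarith
  have hKsq : K ≤ K ^ 2 := le_self_pow₀ hK1 two_ne_zero
  have hs : ∀ k, X.r k ω ≤ K → |X.s k ω| ≤ K ^ 2 := fun k h => by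
    rw [← hr k, abs_of_nonneg (sq_nonneg _)]
    exact pow_le_pow_left₀ (X.r_nonneg k ω) h 2
  have hbK : ∀ k, X.r k ω ≤ K → |X.b k ω| ≤ K ^ 2 := fun k h =>
    ((hb k).trans (le_abs_self _)).trans (hs k h)
  refine ⟨by linarith [h0.1], fun k l => ⟨?_, ?_, ?_, ?_, ?_, ?_, ?_⟩⟩
  · refine (abs_sub _ _).trans ?_
    linarith [h0.1, (h1 k).1]
  · exact ktwo k l _ fun _ _ h => h.trans hKsq
  · rw [← mul_assoc]
    refine ktwo k l _ fun _ e2 e3 => ?_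
    rw [abs_mul, abs_of_nonneg (inv_nonneg.2 (X.r_nonneg k ω)), pow_two]
    exact mul_le_mul e2 e3 (abs_nonneg _) (by positivity)
  · exact kdiff k l _ fun e _ _ => by
      rw [abs_of_nonneg (X.r_nonneg k ω)]; exact e.trans hKsq
  · exact kdiff k l _ fun e _ _ => hs k e
  · exact kdiff k l _ fun e _ _ => hbK k e
  · have := key k l _ (.inl rfl) (X.b k ω) fun e _ _ => hbK k e
    linarith [hC0.trans hKC]

/-! ### The graphs of the operators -/

/-- The operator `R∇` on its maximal domain. -/
noncomputable def maxGradOp : CentredL2 π →ₗ.[ℝ] Fields d π :=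
  fieldOp (fun (f : CentredL2 π) k ω => (√2)⁻¹ * (X.r k ω * diff f k ω))
    (fun f g k => by
      filter_upwards [diff_add f g k] with ω h
      simp only [Pi.add_apply] at *
      rw [h]
      ring)
    (fun c f k => by
      filter_upwards [diff_smul c f k] with ω h
      simp only [Pi.smul_apply, smul_eq_mul] at *
      rw [h]
      ring)

theorem mem_graph_maxGradOp {f : CentredL2 π} {u : Fields d π} : (f, u) ∈ X.maxGradOp.graph ↔
    ∀ k, ∀ᵐ ω ∂π, u k ω = (√2)⁻¹ * (X.r k ω * diff f k ω) := mem_graph_fieldOp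

theorem mem_graph_gradOp {f : CentredL2 π} {u : Fields d π} : (f, u) ∈ X.gradOp.graph ↔
    f ∈ X.core ∧ ∀ k, ∀ᵐ ω ∂π, u k ω = (√2)⁻¹ * (X.r k ω * diff f k ω) :=
  mem_graph_domRestrict.trans (and_congr_right fun _ => mem_graph_fieldOp)

theorem mem_graph_antisymOp {f g : CentredL2 π} : (f, g) ∈ X.antisymOp.graph ↔
    f ∈ X.core ∧ ∀ᵐ ω ∂π, (g : Lp ℝ 2 π) ω = ∑ k, X.b k ω * diff f k ω :=
  mem_graph_domRestrict.trans (and_congr_right fun _ => mem_graph_scalarOp)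

/-- Convergence of `f_n` and of the fields holds almost everywhere along a common subsequence, so
the pointwise formula survives the limit. The closability of `R∇` on the core follows. -/
theorem isClosed_maxGradOp : X.maxGradOp.IsClosed := by
  refine IsSeqClosed.isClosed fun p q hp hpq => ?_
  obtain ⟨f, u⟩ := q
  change (f, u) ∈ X.maxGradOp.graph
  rw [mem_graph_maxGradOp]
  intro k
  have h1 : Tendsto (fun n => ((p n).1 : Lp ℝ 2 π)) atTop (nhds (f : Lp ℝ 2 π)) :=
    (continuous_subtype_val.tendsto f).comp ((continuous_fst.tendsto _).comp hpq)
  obtain ⟨ns, hns, h2⟩ := exists_subseq_ae_tendsto_of_Lp h1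
  have h3 : Tendsto (fun n => (p (ns n)).2 k) atTop (nhds (u k)) :=
    (((continuous_apply k).comp (PiLp.continuous_ofLp 2 _)).tendsto u).comp
      (((continuous_snd.tendsto _).comp hpq).comp hns.tendsto_atTop)
  obtain ⟨ms, hms, h4⟩ := exists_subseq_ae_tendsto_of_Lp h3
  have h5 : ∀ n, ∀ᵐ ω ∂π, (p n).2 k ω = (√2)⁻¹ * (X.r k ω * diff (p n).1 k ω) := fun n =>
    X.mem_graph_maxGradOp.1 (hp n) k
  filter_upwards [h2, shift_ae k h2, h4, ae_all_iff.2 h5] with ω e1 e2 e3 e4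
  refine tendsto_nhds_unique e3 ?_
  simp only [e4]
  exact (((e2.comp hms.tendsto_atTop).sub (e1.comp hms.tendsto_atTop)).const_mul _).const_mul _

theorem gradOp_le_maxGradOp : X.gradOp ≤ X.maxGradOp := LinearPMap.domRestrict_le

theorem isClosable_gradOp : X.gradOp.IsClosable :=
  X.isClosed_maxGradOp.isClosable.leIsClosable X.gradOp_le_maxGradOp

theorem closure_gradOp_graph_le : X.gradOp.closure.graph ≤ X.maxGradOp.graph := by
  rw [← X.isClosable_gradOp.graph_closure_eq_closure_graph]
  exact Submodule.topologicalClosure_minimal _ (LinearPMap.le_graph_of_le X.gradOp_le_maxGradOp)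
    X.isClosed_maxGradOp

theorem exists_graph_gradOp {f : CentredL2 π} (hf : f ∈ X.core) : ∃ u, (f, u) ∈ X.gradOp.graph := by
  obtain ⟨M, hM⟩ := X.core_bound hf
  have h : ∀ k, MemLp (fun ω => (√2)⁻¹ * (X.r k ω * diff f k ω)) 2 π := fun k => by
    refine MemLp.const_mul (memLp_of_ae_abs_le (C := M) ?_ ?_) _
    · exact ((X.measurable_r k).mul (measurable_diff f k)).aestronglyMeasurable
    · exact hM.mono fun ω hω => (hω.2 k k).2.2.2.1
  exact ⟨WithLp.toLp 2 fun k => (h k).toLp _,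
    X.mem_graph_gradOp.2 ⟨hf, fun k => (h k).coeFn_toLp⟩⟩

theorem domain_gradOp : X.gradOp.domain = X.core := by
  ext f
  rw [LinearPMap.mem_domain_iff]
  exact ⟨fun ⟨u, hu⟩ => (X.mem_graph_gradOp.1 hu).1, X.exists_graph_gradOp⟩

theorem exists_graph_antisymOp {f : CentredL2 π} (hf : f ∈ X.core) :
    ∃ g, (f, g) ∈ X.antisymOp.graph := by
  obtain ⟨M, hM⟩ := X.core_bound hf
  have hm : ∀ k, Measurable fun ω => X.b k ω * diff f k ω := fun k =>
    (X.measurable_b k).mul (measurable_diff f k)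
  have h1 : ∀ k, MemLp (fun ω => X.b k ω * diff f k ω) 2 π := fun k =>
    memLp_of_ae_abs_le (hm k).aestronglyMeasurable
      (hM.mono fun ω hω => (hω.2 k k).2.2.2.2.2.1)
  -- By parts this is `-2 ∫ (∑ b_k) f`, and the flow is divergence free.
  have h0 : ∫ ω, ∑ k, X.b k ω * diff f k ω ∂π = 0 := by
    have e := integral_sum_antisymm_mul_diff (μ := π) (D := X.b) (g := (f : Lp ℝ 2 π))
      (fun k => Eventually.of_forall fun ω => X.b_opp k ω) (fun k =>
        integrable_of_ae_abs_le ((X.measurable_b k).mul (measurable_coe f)).aestronglyMeasurable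
          (hM.mono fun ω hω => (hω.2 k k).2.2.2.2.2.2))
    have e2 : ∫ ω, (∑ k, X.b k ω) * (f : Lp ℝ 2 π) ω ∂π = 0 := by
      rw [← integral_zero Ω ℝ (μ := π)]
      refine integral_congr_ae (X.isStream.sum_eq_zero.mono fun ω hω => ?_)
      dsimp only
      rw [hω, zero_mul]
    rw [e2, mul_zero] at e
    exact e
  obtain ⟨g, hg⟩ := CentredL2.exists_of_memLp (memLp_finsetSum _ fun k _ => h1 k) h0
  exact ⟨g, X.mem_graph_antisymOp.2 ⟨hf, hg⟩⟩

theorem domain_antisymOp : X.antisymOp.domain = X.core := by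
  ext f
  rw [LinearPMap.mem_domain_iff]
  exact ⟨fun ⟨u, hu⟩ => (X.mem_graph_antisymOp.1 hu).1, X.exists_graph_antisymOp⟩

/-- The Dirichlet form identity. -/
theorem integral_dirichlet {f g : CentredL2 π} (hf : f ∈ X.core) (hg : g ∈ X.core) :
    ∫ ω, ∑ k, X.s k ω * diff f k ω * diff g k ω ∂π =
      -2 * ∫ ω, (∑ k, X.s k ω * diff f k ω) * (g : Lp ℝ 2 π) ω ∂π := by
  obtain ⟨M, hM⟩ := X.core_bound hf
  obtain ⟨M', hM'⟩ := X.core_bound hg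
  refine integral_sum_antisymm_mul_diff (D := fun k ω => X.s k ω * diff f k ω)
    (fun k => Eventually.of_forall fun ω => ?_) fun k => ?_
  · simp only [diff, s_opp, shift_opp_shift]; ring
  · refine integrable_of_ae_abs_le (C := M * M') (((X.measurable_s k).mul
      (measurable_diff f k)).mul (measurable_coe g)).aestronglyMeasurable ?_
    filter_upwards [hM, hM'] with ω e1 e2
    rw [abs_mul]
    exact mul_le_mul (e1.2 k k).2.2.2.2.1 e2.1 (abs_nonneg _)
      ((abs_nonneg _).trans e1.1)

theorem inner_grad {f g : CentredL2 π} {u v : Fields d π} (hu : (f, u) ∈ X.gradOp.graph)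
    (hv : (g, v) ∈ X.gradOp.graph) :
    ⟪u, v⟫_ℝ = 1 / 2 * ∫ ω, ∑ k, X.s k ω * diff f k ω * diff g k ω ∂π := by
  rw [Fields.inner_eq, ← integral_const_mul]
  refine integral_congr_ae ?_
  filter_upwards [eventually_all.2 (X.mem_graph_gradOp.1 hu).2,
    eventually_all.2 (X.mem_graph_gradOp.1 hv).2, X.r_sq] with ω h1 h2 h3
  rw [Finset.mul_sum]
  refine Finset.sum_congr rfl fun k _ => ?_
  rw [h1, h2, ← h3]
  have h2 : (√2)⁻¹ * (√2)⁻¹ = (1 / 2 : ℝ) := by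
    rw [← mul_inv, Real.mul_self_sqrt (by norm_num)]; norm_num
  linear_combination (X.r k ω * diff f k ω * (X.r k ω * diff g k ω)) * h2

theorem dense_domain_closure : Dense (X.gradOp.closure.domain : Set (CentredL2 π)) := by
  refine Dense.mono ?_ X.dense_core
  rw [← X.domain_gradOp]
  exact X.gradOp.le_closure.1

/-- The Dirichlet identity exhibits `-∑ s_k ∂_k f` as the value at `R∇f` of the adjoint. It is
checked against the core, and extends to the closed gradient because it is a closed condition on
pairs. -/
theorem exists_graph_symOp {f : CentredL2 π} (hf : f ∈ X.core) : ∃ z : CentredL2 π,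
    (∀ᵐ ω ∂π, (z : Lp ℝ 2 π) ω = -∑ k, X.s k ω * diff f k ω) ∧ (f, z) ∈ X.symOp.graph := by
  obtain ⟨M, hM⟩ := X.core_bound hf
  have hm : ∀ k, Measurable fun ω => X.s k ω * diff f k ω := fun k =>
    (X.measurable_s k).mul (measurable_diff f k)
  have h1 : ∀ k, MemLp (fun ω => X.s k ω * diff f k ω) 2 π := fun k =>
    memLp_of_ae_abs_le (hm k).aestronglyMeasurable
      (hM.mono fun ω hω => (hω.2 k k).2.2.2.2.1)
  have h0 : ∫ ω, -∑ k, X.s k ω * diff f k ω ∂π = 0 := by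
    rw [integral_neg, integral_sum_antisymm
      (fun k => Eventually.of_forall fun ω => by simp only [diff, s_opp, shift_opp_shift]; ring)
      fun k => (h1 k).integrable (by norm_num), neg_zero]
  obtain ⟨z, hz'⟩ := CentredL2.exists_of_memLp (memLp_finsetSum _ fun k _ => h1 k).neg h0
  have hz : ∀ᵐ ω ∂π, (z : Lp ℝ 2 π) ω = -∑ k, X.s k ω * diff f k ω := hz'
  obtain ⟨u, hu⟩ := X.exists_graph_gradOp hf
  refine ⟨z, hz, mem_graph_pcomp.2 ⟨u, LinearPMap.le_graph_of_le X.gradOp.le_closure hu, ?_⟩⟩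
  rw [mem_graph_adjoint X.dense_domain_closure]
  intro a b hab
  rw [← X.isClosable_gradOp.graph_closure_eq_closure_graph] at hab
  have hcl : IsClosed {p : CentredL2 π × Fields d π | ⟪z, p.1⟫_ℝ = ⟪u, p.2⟫_ℝ} :=
    isClosed_eq (by fun_prop) (by fun_prop)
  refine closure_minimal (s := (X.gradOp.graph : Set _)) ?_ hcl hab
  rintro ⟨g, v⟩ hv
  have hg := (X.mem_graph_gradOp.1 hv).1
  change ⟪z, g⟫_ℝ = ⟪u, v⟫_ℝ
  rw [X.inner_grad hu hv, X.integral_dirichlet hf hg, CentredL2.inner_eq, ← mul_assoc,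
    ← integral_const_mul]
  refine integral_congr_ae (hz.mono fun ω hω => ?_)
  dsimp only
  rw [hω]; ring

theorem isAccretiveSymm_symOp : IsAccretiveSymm X.symOp :=
  isAccretiveSymm_adjoint_comp X.dense_domain_closure X.isClosable_gradOp.closure_isClosed

end Rates

end RandomEnv

namespace RandomEnv

/-! ### The stream operator and the factorisation of `A` -/

namespace Rates

variable {d : ℕ} {Ω : Type*} [MeasurableSpace Ω] [AddAction (Fin d → ℤ) Ω] {π : Measure Ω}
  (X : Rates d Ω π) [IsProbabilityMeasure π] [MeasurableConstVAdd (Fin d → ℤ) Ω]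

section Invariant

variable [VAddInvariantMeasure (Fin d → ℤ) Ω π]

/-- On a gradient the inner `R⁻¹` cancels `R`, so that `H` sees only double differences of `f`, on
whose plaquettes all coefficients are bounded. -/
theorem stream_grad_ae {f : CentredL2 π} {u : Fields d π} (hu : (f, u) ∈ X.gradOp.graph) :
    ∀ᵐ ω ∂π, ∀ k, (X.r k ω)⁻¹ * (1 / 2 * ∑ l, X.h k l ω *
      ((X.r l (shift k ω))⁻¹ * u l (shift k ω) + (X.r l ω)⁻¹ * u l ω)) =
      (√2)⁻¹ * (1 / 2 * ∑ l, (X.r k ω)⁻¹ * (X.h k l ω * twoDiff (f : Lp ℝ 2 π) k l ω)) := by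
  have h1 := eventually_all.2 (X.mem_graph_gradOp.1 hu).2
  filter_upwards [h1, eventually_all.2 fun k : Dir d => shift_ae k h1, X.r_pos,
    eventually_all.2 fun k : Dir d => shift_ae k X.r_pos] with ω e1 e2 e3 e4 k
  simp only [Finset.mul_sum]
  refine Finset.sum_congr rfl fun l _ => ?_
  have h3 := (e3 l).ne'
  have h4 := (e4 k l).ne'
  rw [e1, e2]
  simp only [diff, twoDiff]
  field_simp

theorem exists_graph_streamOp {f : CentredL2 π} {u : Fields d π} (hu : (f, u) ∈ X.gradOp.graph) :
    ∃ w, (u, w) ∈ X.streamOp.graph := by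
  have hf := (X.mem_graph_gradOp.1 hu).1
  obtain ⟨M, hM⟩ := X.core_bound hf
  have h1 : ∀ k l, MemLp (fun ω => (X.r k ω)⁻¹ *
      (X.h k l ω * twoDiff (f : Lp ℝ 2 π) k l ω)) 2 π := fun k l =>
    memLp_of_ae_abs_le ((X.measurable_r k).inv.mul ((X.measurable_h k l).mul
      (measurable_twoDiff (measurable_coe f) k l))).aestronglyMeasurable
      (hM.mono fun ω hω => (hω.2 k l).2.2.1)
  have h2 : ∀ k, MemLp (fun ω => (√2)⁻¹ * (1 / 2 * ∑ l, (X.r k ω)⁻¹ *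
      (X.h k l ω * twoDiff (f : Lp ℝ 2 π) k l ω))) 2 π := fun k =>
    ((memLp_finsetSum _ fun l _ => h1 k l).const_mul _).const_mul _
  refine ⟨WithLp.toLp 2 fun k => (h2 k).toLp _, X.mem_graph_streamOp.2 fun k => ?_⟩
  have h3 : ∀ᵐ ω ∂π, (h2 k).toLp _ ω = _ := (h2 k).coeFn_toLp
  filter_upwards [h3, X.stream_grad_ae hu] with ω e1 e2
  rw [e2 k]
  exact e1

/-- The form of the flow, in terms of the stream operator. -/
theorem inner_stream {f g a : CentredL2 π} {u v w : Fields d π} (hu : (f, u) ∈ X.gradOp.graph)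
    (hv : (g, v) ∈ X.gradOp.graph) (hw : (u, w) ∈ X.streamOp.graph)
    (ha : (f, a) ∈ X.antisymOp.graph) : ⟪w, v⟫_ℝ = ⟪a, g⟫_ℝ := by
  have hf := (X.mem_graph_gradOp.1 hu).1
  have hg := (X.mem_graph_gradOp.1 hv).1
  obtain ⟨M, hM⟩ := X.core_bound hf
  obtain ⟨M', hM'⟩ := X.core_bound hg
  have key := X.isStream.integral_form (F := (f : Lp ℝ 2 π)) (g := (g : Lp ℝ 2 π)) fun k l => by
    refine integrable_of_ae_abs_le (C := M * M') (((X.measurable_h k l).mul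
      (measurable_twoDiff (measurable_coe f) k l)).mul (measurable_coe g)).aestronglyMeasurable ?_
    filter_upwards [hM, hM'] with ω e1 e2
    rw [abs_mul]
    exact mul_le_mul (e1.2 k l).2.1 e2.1 (abs_nonneg _) ((abs_nonneg _).trans e1.1)
  have h1 : ⟪a, g⟫_ℝ =
      ∫ ω, (∑ k, X.b k ω * diff f k ω) * (g : Lp ℝ 2 π) ω ∂π := by
    rw [CentredL2.inner_eq]
    refine integral_congr_ae ((X.mem_graph_antisymOp.1 ha).2.mono fun ω hω => ?_)
    dsimp only
    rw [hω]
  -- The constant is the `1 / 2` of `H` times `(1 / √2)²` from the normalisation of `Fields`. It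
  -- cancels the `4` in `integral_form`.
  have h2 : ⟪w, v⟫_ℝ = 1 / 4 * ∫ ω, ∑ k, (∑ l, X.h k l ω * twoDiff (f : Lp ℝ 2 π) k l ω) *
      ((g : Lp ℝ 2 π) (shift k ω) - (g : Lp ℝ 2 π) ω) ∂π := by
    rw [Fields.inner_eq, ← integral_const_mul]
    refine integral_congr_ae ?_
    filter_upwards [eventually_all.2 (X.mem_graph_gradOp.1 hv).2, X.stream_grad_ae hu,
      eventually_all.2 (X.mem_graph_streamOp.1 hw), X.r_pos] with ω e1 e2 e3 e4
    rw [Finset.mul_sum]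
    refine Finset.sum_congr rfl fun k _ => ?_
    rw [e3 k, e2 k, e1 k, ← Finset.mul_sum]
    simp only [diff]
    have h5 := (e4 k).ne'
    have h6 : (√2)⁻¹ * (√2)⁻¹ = (1 / 2 : ℝ) := by
      rw [← mul_inv, Real.mul_self_sqrt (by norm_num)]; norm_num
    have h7 : (X.r k ω)⁻¹ * X.r k ω = 1 := inv_mul_cancel₀ h5
    linear_combination (1 / 2 * ((X.r k ω)⁻¹ * X.r k ω) *
      (∑ l, X.h k l ω * twoDiff (f : Lp ℝ 2 π) k l ω) *
      ((g : Lp ℝ 2 π) (shift k ω) - (g : Lp ℝ 2 π) ω)) * h6 + (1 / 4 *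
      (∑ l, X.h k l ω * twoDiff (f : Lp ℝ 2 π) k l ω) *
      ((g : Lp ℝ 2 π) (shift k ω) - (g : Lp ℝ 2 π) ω)) * h7
  rw [h1, h2, key, ← mul_assoc]
  norm_num [diff]

theorem antisymOp_skew {f g a c : CentredL2 π} (ha : (f, a) ∈ X.antisymOp.graph)
    (hc : (g, c) ∈ X.antisymOp.graph) : ⟪a, g⟫_ℝ = -⟪f, c⟫_ℝ := by
  have hf := (X.mem_graph_antisymOp.1 ha).1
  have hg := (X.mem_graph_antisymOp.1 hc).1
  obtain ⟨M, hM⟩ := X.core_bound hf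
  obtain ⟨M', hM'⟩ := X.core_bound hg
  have h1 := integral_flow_skew (μ := π) (b := X.b) (f := (f : Lp ℝ 2 π)) (g := (g : Lp ℝ 2 π))
    X.b_opp X.isStream.sum_eq_zero
    (fun k => by
      refine integrable_of_ae_abs_le (C := M * M') (((X.measurable_b k).mul
        (measurable_diff f k)).mul (measurable_coe g)).aestronglyMeasurable ?_
      filter_upwards [hM, hM'] with ω e1 e2
      rw [abs_mul]
      exact mul_le_mul (e1.2 k k).2.2.2.2.2.1 e2.1 (abs_nonneg _) ((abs_nonneg _).trans e1.1))
    (fun k => by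
      refine integrable_of_ae_abs_le (C := M' * M) (((X.measurable_b k).mul
        (measurable_diff g k)).mul (measurable_coe f)).aestronglyMeasurable ?_
      filter_upwards [hM, hM'] with ω e1 e2
      rw [abs_mul]
      exact mul_le_mul (e2.2 k k).2.2.2.2.2.1 e1.1 (abs_nonneg _) ((abs_nonneg _).trans e2.1))
    (fun k => by
      refine integrable_of_ae_abs_le (C := M * M') ((X.measurable_b k).mul
        ((measurable_coe f).mul (measurable_coe g))).aestronglyMeasurable ?_
      filter_upwards [hM, hM'] with ω e1 e2
      rw [← mul_assoc, abs_mul]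
      exact mul_le_mul (e1.2 k k).2.2.2.2.2.2 e2.1 (abs_nonneg _) ((abs_nonneg _).trans e1.1))
  have h2 : ⟪a, g⟫_ℝ = ∫ ω, (∑ k, X.b k ω *
      ((f : Lp ℝ 2 π) (shift k ω) - (f : Lp ℝ 2 π) ω)) * (g : Lp ℝ 2 π) ω ∂π := by
    rw [CentredL2.inner_eq]
    refine integral_congr_ae ((X.mem_graph_antisymOp.1 ha).2.mono fun ω hω => ?_)
    dsimp only
    rw [hω]
    rfl
  have h3 : ⟪f, c⟫_ℝ = ∫ ω, (∑ k, X.b k ω *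
      ((g : Lp ℝ 2 π) (shift k ω) - (g : Lp ℝ 2 π) ω)) * (f : Lp ℝ 2 π) ω ∂π := by
    rw [CentredL2.inner_eq]
    refine integral_congr_ae ((X.mem_graph_antisymOp.1 hc).2.mono fun ω hω => ?_)
    dsimp only
    rw [hω, mul_comm]
    rfl
  rw [h2, h1, h3]

end Invariant

section Ergodic

variable [ErgodicVAdd (Fin d → ℤ) Ω π]

/-- Ergodicity enters in `eq_zero`: as `r_k > 0`, a vanishing gradient makes `f` shift invariant,
hence constant, hence zero because it is centred. -/
theorem isGradientSqrt : IsGradientSqrt X.gradOp X.sqrtOp where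
  dense := by rw [X.domain_gradOp]; exact X.dense_core
  closable := X.isClosable_gradOp
  sqrt := X.isAccretiveSymm_symOp.isPositiveSqrt_opSqrt
  domain_le := by
    rw [X.domain_gradOp]
    intro f hf
    obtain ⟨z, -, hz⟩ := X.exists_graph_symOp hf
    exact LinearPMap.mem_domain_of_mem_graph hz
  eq_zero := by
    intro f hf
    have h1 := X.mem_graph_maxGradOp.1 (X.closure_gradOp_graph_le hf)
    have h2 : ∀ k : Dir d, ∀ᵐ ω ∂π, (f : Lp ℝ 2 π) (shift k ω) = (f : Lp ℝ 2 π) ω := by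
      intro k
      have h0 : ∀ᵐ ω ∂π, ((0 : Fields d π) k : Lp ℝ 2 π) ω = 0 := Lp.coeFn_zero ℝ 2 π
      filter_upwards [h1 k, h0, X.r_pos] with ω e1 e2 e3
      rw [e2] at e1
      have h5 := (mul_eq_zero.1 e1.symm).resolve_left (by positivity)
      exact sub_eq_zero.1 ((mul_eq_zero.1 h5).resolve_left (e3 k).ne')
    obtain ⟨c, hc⟩ := ae_const_of_shift_eq (measurable_coe f) h2
    have h3 : c = 0 := by
      have := CentredL2.integral_eq_zero f
      rw [integral_congr_ae hc] at this
      simpa using this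
    rw [h3] at hc
    exact CentredL2.ext_ae (Filter.EventuallyEq.trans hc (Lp.coeFn_zero ℝ 2 π).symm)

theorem mem_graph_inverse {f g : CentredL2 π} :
    (f, g) ∈ X.sqrtOp.inverse.graph ↔ (g, f) ∈ X.sqrtOp.graph := by
  rw [LinearPMap.inverse_graph X.isGradientSqrt.ker_eq_bot]
  constructor
  · rintro ⟨⟨a, b⟩, hab, h⟩
    simp only [LinearEquiv.coe_coe, LinearEquiv.prodComm_apply, Prod.swap_prod_mk,
      Prod.mk.injEq] at h
    rw [← h.1, ← h.2]
    exact hab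
  · exact fun h => ⟨(g, f), h, rfl⟩

theorem mem_graph_skewOp {x y : CentredL2 π} : (x, y) ∈ X.skewOp.graph ↔
    ∃ f a, (f, x) ∈ X.sqrtOp.graph ∧ (f, a) ∈ X.antisymOp.graph ∧ (y, a) ∈ X.sqrtOp.graph := by
  rw [skewOp, mem_graph_pcomp]
  constructor
  · rintro ⟨a, h1, h2⟩
    obtain ⟨f, h3, h4⟩ := mem_graph_pcomp.1 h1
    exact ⟨f, a, X.mem_graph_inverse.1 h3, h4, X.mem_graph_inverse.1 h2⟩
  · rintro ⟨f, a, h1, h2, h3⟩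
    exact ⟨a, mem_graph_pcomp.2 ⟨f, X.mem_graph_inverse.2 h1, h2⟩, X.mem_graph_inverse.2 h3⟩

theorem mem_sqrtCore {x : CentredL2 π} :
    x ∈ X.sqrtCore ↔ ∃ f ∈ X.core, (f, x) ∈ X.sqrtOp.graph := by
  constructor
  · rintro ⟨f, hf, rfl⟩
    exact ⟨f, hf, X.sqrtOp.mem_graph f⟩
  · rintro ⟨f, hf, h⟩
    obtain ⟨f', h1, h2⟩ := (LinearPMap.mem_graph_iff _).1 h
    dsimp only at h1 h2
    subst h1 h2
    exact ⟨f', hf, rfl⟩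

theorem dense_sqrtCore : Dense (X.sqrtCore : Set (CentredL2 π)) := by
  refine X.isGradientSqrt.dense_image fun a b ha hab => X.mem_sqrtCore.2 ⟨a, ?_, hab⟩
  rwa [X.domain_gradOp] at ha

/-- `S^{1/2} Λ* R⁻¹ H R⁻¹ Λ S^{1/2} = A` on the core. -/
theorem sqrt_adjoint_stream {Λ : CentredL2 π →ₗᵢ[ℝ] Fields d π}
    (hΛ : ∀ a b u, (a, b) ∈ X.sqrtOp.graph → (a, u) ∈ X.gradOp.graph → Λ b = u)
    {f a : CentredL2 π} {u w : Fields d π} (hu : (f, u) ∈ X.gradOp.graph)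
    (hw : (u, w) ∈ X.streamOp.graph) (ha : (f, a) ∈ X.antisymOp.graph) :
    (ContinuousLinearMap.adjoint Λ.toContinuousLinearMap w, a) ∈ X.sqrtOp.graph := by
  -- Since `𝒜` is a core for `S^{1/2}`, it suffices that `⟪Λ*w, S^{1/2} g⟫ = ⟪w, R∇g⟫ = ⟪a, g⟫` on
  -- `𝒜`. This is what puts `Af` in the range of `S^{1/2}`.
  refine X.isGradientSqrt.mem_graph fun g b hg hb => ?_
  rw [X.domain_gradOp] at hg
  obtain ⟨v, hv⟩ := X.exists_graph_gradOp hg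
  rw [ContinuousLinearMap.adjoint_inner_left, ← X.inner_stream hu hv hw ha]
  congr 1
  exact (hΛ g b v hb hv).symm

end Ergodic

end Rates

end RandomEnv

namespace RandomEnv

/-! ### Truncation and its convex primitive -/

section Clamp

/-- Truncation at level `L`. -/
def clamp (L x : ℝ) : ℝ := max (-L) (min x L)

/-- The primitive of the truncation. -/
noncomputable def huber (L x : ℝ) : ℝ := clamp L x * x - clamp L x ^ 2 / 2

theorem continuous_clamp (L : ℝ) : Continuous (clamp L) := by
  unfold clamp; fun_prop

theorem continuous_huber (L : ℝ) : Continuous (huber L) := by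
  have := continuous_clamp L
  unfold huber; fun_prop

variable {L : ℝ}

theorem clamp_of_abs_le {x : ℝ} (hx : |x| ≤ L) : clamp L x = x := by
  rw [abs_le] at hx
  rw [clamp, min_eq_left hx.2, max_eq_right hx.1]

theorem abs_clamp_le (hL : 0 ≤ L) (x : ℝ) : |clamp L x| ≤ L :=
  abs_le.2 ⟨le_max_left _ _, max_le (by linarith) (min_le_right _ _)⟩

theorem clamp_mono {x y : ℝ} (h : x ≤ y) : clamp L x ≤ clamp L y :=
  max_le_max le_rfl (min_le_min_right _ h)

theorem clamp_sub_mul_sub_nonneg (x y : ℝ) : 0 ≤ (y - x) * (clamp L y - clamp L x) := by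
  rcases le_total x y with h | h
  · exact mul_nonneg (sub_nonneg.2 h) (sub_nonneg.2 (clamp_mono h))
  · exact mul_nonneg_of_nonpos_of_nonpos (sub_nonpos.2 h) (sub_nonpos.2 (clamp_mono h))

/-- The variational inequality of the metric projection onto `[-L, L]`. -/
theorem clamp_projection (hL : 0 ≤ L) (x y : ℝ) :
    0 ≤ (clamp L y - clamp L x) * (y - clamp L y) := by
  have hx := abs_le.1 (abs_clamp_le hL x)
  rcases lt_or_ge y (-L) with h | h
  · have : clamp L y = -L := by rw [clamp, max_eq_left ((min_le_left _ _).trans h.le)]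
    rw [this]
    exact mul_nonneg_of_nonpos_of_nonpos (by linarith) (by linarith)
  rcases le_or_gt y L with h' | h'
  · rw [clamp_of_abs_le (abs_le.2 ⟨h, h'⟩), sub_self, mul_zero]
  · have : clamp L y = L := by rw [clamp, min_eq_right h'.le, max_eq_right (by linarith)]
    rw [this]
    exact mul_nonneg (by linarith) (by linarith)

theorem huber_convex (hL : 0 ≤ L) (x y : ℝ) : clamp L x * (y - x) ≤ huber L y - huber L x := by
  have := clamp_projection hL x y
  unfold huber
  nlinarith [sq_nonneg (clamp L y - clamp L x)]

theorem huber_le_quadratic (hL : 0 ≤ L) (x y : ℝ) :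
    huber L y - huber L x - clamp L x * (y - x) ≤ (y - x) ^ 2 / 2 := by
  have := clamp_projection hL y x
  unfold huber
  nlinarith [sq_nonneg (y - clamp L y - (x - clamp L x))]

theorem abs_huber_sub_le (hL : 0 ≤ L) (x y : ℝ) : |huber L y - huber L x| ≤ L * |y - x| := by
  have h1 := huber_convex hL x y
  have h2 := huber_convex hL y x
  have h3 : |clamp L x * (y - x)| ≤ L * |y - x| := by
    rw [abs_mul]; exact mul_le_mul_of_nonneg_right (abs_clamp_le hL x) (abs_nonneg _)
  have h4 : |clamp L y * (y - x)| ≤ L * |y - x| := by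
    rw [abs_mul]; exact mul_le_mul_of_nonneg_right (abs_clamp_le hL y) (abs_nonneg _)
  rw [abs_le] at *
  constructor <;> nlinarith

/-- Inside `[-L, L]` the function `huber L` is half the square and there is no error. In general its
Bregman remainder lies between `0` and `(y - x)² / 2`, so the error is at most the whole quadratic
term, charged to `χ`. -/
theorem abs_huber_error_le (hL : 0 ≤ L) {x y χ : ℝ} (hχ : 0 ≤ χ) (hχ1 : L < |x| ∨ L < |y| → 1 ≤ χ) :
    |(y - x) ^ 2 / 2 - (huber L y - huber L x - clamp L x * (y - x))| ≤ (y - x) ^ 2 / 2 * χ := by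
  by_cases h : L < |x| ∨ L < |y|
  · have h1 := huber_convex hL x y
    have h2 := huber_le_quadratic hL x y
    rw [abs_of_nonneg (by linarith)]
    have := mul_le_mul_of_nonneg_left (hχ1 h) (show 0 ≤ (y - x) ^ 2 / 2 by positivity)
    linarith
  · push Not at h
    rw [huber, huber, clamp_of_abs_le h.1, clamp_of_abs_le h.2,
      show (y - x) ^ 2 / 2 - (y * y - y ^ 2 / 2 - (x * x - x ^ 2 / 2) - x * (y - x)) = 0 by ring,
      abs_zero]
    positivity

theorem sq_sub_le_clamp {x y χ : ℝ} (hχ : 0 ≤ χ) (hχ1 : L < |x| ∨ L < |y| → 1 ≤ χ) :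
    (y - x) ^ 2 ≤ (y - x) * (clamp L y - clamp L x) + (y - x) ^ 2 * χ := by
  by_cases h : L < |x| ∨ L < |y|
  · have h1 := clamp_sub_mul_sub_nonneg (L := L) x y
    have := mul_le_mul_of_nonneg_left (hχ1 h) (sq_nonneg (y - x))
    linarith
  · push Not at h
    rw [clamp_of_abs_le h.1, clamp_of_abs_le h.2]
    have : 0 ≤ (y - x) ^ 2 * χ := by positivity
    nlinarith

end Clamp

/-! ### The Caccioppoli estimate for a flow with a stream tensor -/

section Energy

theorem abs_sub_le_two_mul {Y : Type*} {F : Y → ℝ} {C : ℝ} (hC : ∀ y, |F y| ≤ C) (y y' : Y) :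
    |F y - F y'| ≤ 2 * C :=
  (abs_sub _ _).trans (by linarith [hC y, hC y'])

variable {d : ℕ} {Y : Type*} [AddAction (Fin d → ℤ) Y]

theorem abs_twoDiff_huber_le {L : ℝ} (hL : 0 ≤ L) (F : Y → ℝ) (k l : Dir d) (y : Y) :
    |twoDiff (fun y => huber L (F y)) k l y| ≤
      L * (|F (shift l (shift k y)) - F (shift k y)| + |F (shift l y) - F y|) := by
  unfold twoDiff
  refine (abs_add_le _ _).trans ?_
  rw [mul_add]
  exact add_le_add (abs_huber_sub_le hL _ _) (abs_huber_sub_le hL _ _)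

/-- The error terms in the energy estimate that are supported near the slope of the cut-off. -/
noncomputable def slopeTerm (s : Dir d → Y → ℝ) (h : Dir d → Dir d → Y → ℝ) (F : Y → ℝ) (L : ℝ)
    (y : Y) : ℝ :=
  ∑ k, (L / 2 * (s k y * |F (shift k y) - F y|) +
    L / 4 * (∑ l, |h k l y| * (|F (shift l (shift k y)) - F (shift k y)| +
      |F (shift l y) - F y|)) + 1 / 4 * (s k y * (F (shift k y) - F y) ^ 2))

/-- On one edge, the equation tested with `η clamp(F)` is split so that, after summing over edges,
the first three groups on the right integrate to zero: the symmetric part, the stream term and the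
antisymmetric `b (∂F)²`. What is left carries the slope `κζ` of the cut-off or the indicator `χ` of
large values. The two halves of the `χ` term come from truncating the energy and from the Bregman
error of the flow. -/
theorem energy_edge {s b x x' η η' κζ c L χ tw T : ℝ} (hL : 0 ≤ L) (hc : |c| = 1)
    (hb : |b| ≤ s) (hη : 0 ≤ η) (hη' : |η' - η| ≤ κζ) (hχ : 0 ≤ χ)
    (hχ1 : L < |x| ∨ L < |x'| → 1 ≤ χ) (htw : |tw| ≤ L * T) :
    1 / 2 * (η * (s * (x' - x) ^ 2)) + (s + c * b) * (x' - x) * (η * clamp L x) ≤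
      1 / 2 * (s * (x' - x) * (η' * clamp L x' - η * clamp L x)) +
      s * (x' - x) * (η * clamp L x) -
      c / 4 * (tw * (η' - η) - 4 * (b * (huber L x' - huber L x) * η)) -
      c / 4 * (b * (x' - x) ^ 2 * (η' - η) + 2 * (b * (x' - x) ^ 2 * η)) +
      κζ * (L / 2 * (s * |x' - x|) + L / 4 * T + 1 / 4 * (s * (x' - x) ^ 2)) +
      η * (s * (x' - x) ^ 2 * χ) := by
  have hs : 0 ≤ s := (abs_nonneg _).trans hb
  have hκ : 0 ≤ κζ := (abs_nonneg _).trans hη'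
  have e1 := mul_le_mul_of_nonneg_left (sq_sub_le_clamp hχ hχ1) (mul_nonneg hη hs)
  have e2 : |s * (x' - x) * clamp L x' * (η' - η)| ≤ s * |x' - x| * L * κζ := by
    rw [abs_mul, abs_mul, abs_mul, abs_of_nonneg hs]
    gcongr
    exact abs_clamp_le hL x'
  have e3 : |c * (tw * (η' - η))| ≤ L * T * κζ := by
    rw [abs_mul, hc, one_mul, abs_mul]
    exact mul_le_mul htw hη' (abs_nonneg _) ((abs_nonneg _).trans htw)
  have e4 : |c * (b * (x' - x) ^ 2 * (η' - η))| ≤ s * (x' - x) ^ 2 * κζ := by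
    rw [abs_mul, hc, one_mul, abs_mul, abs_mul, abs_of_nonneg (sq_nonneg (x' - x))]
    gcongr
  have e5 : |c * (b * η * ((x' - x) ^ 2 / 2 -
      (huber L x' - huber L x - clamp L x * (x' - x))))| ≤ s * η * ((x' - x) ^ 2 / 2 * χ) := by
    rw [abs_mul, hc, one_mul, abs_mul, abs_mul, abs_of_nonneg hη]
    exact mul_le_mul (mul_le_mul_of_nonneg_right hb hη) (abs_huber_error_le hL hχ hχ1)
      (abs_nonneg _) (by positivity)
  have f2 := (abs_le.1 e2).1
  have f3 := (abs_le.1 e3).2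
  have f4 := (abs_le.1 e4).2
  have f5 := (abs_le.1 e5).2
  linarith

theorem energy_pointwise {s b : Dir d → Y → ℝ} {h : Dir d → Dir d → Y → ℝ} {F η ζ : Y → ℝ}
    {κ c L : ℝ} {χ : Dir d → ℝ} (hL : 0 ≤ L) (hc : |c| = 1) (y : Y) (hb : ∀ k, |b k y| ≤ s k y)
    (hη : 0 ≤ η y) (hη' : ∀ k : Dir d, |η (shift k y) - η y| ≤ κ * ζ y)
    (hχ : ∀ k, 0 ≤ χ k) (hχ1 : ∀ k : Dir d, L < |F y| ∨ L < |F (shift k y)| → 1 ≤ χ k)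
    (hstream : ∑ k, ∑ l, h k l y * twoDiff (fun y => huber L (F y)) k l y =
      -2 * ∑ k, b k y * (huber L (F (shift k y)) - huber L (F y))) :
    1 / 2 * (η y * ∑ k, s k y * (F (shift k y) - F y) ^ 2) ≤
      1 / 2 * (∑ k, s k y * (F (shift k y) - F y) *
        (η (shift k y) * clamp L (F (shift k y)) - η y * clamp L (F y)) +
        2 * ((∑ k, s k y * (F (shift k y) - F y)) * (η y * clamp L (F y)))) +
      -(c / 4) * (∑ k, (∑ l, h k l y * twoDiff (fun y => huber L (F y)) k l y) *
        (η (shift k y) - η y) + 2 * ((∑ k, ∑ l, h k l y * twoDiff (fun y => huber L (F y)) k l y) *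
          η y)) +
      -(c / 4) * (∑ k, b k y * (F (shift k y) - F y) ^ 2 * (η (shift k y) - η y) +
        2 * ((∑ k, b k y * (F (shift k y) - F y) ^ 2) * η y)) +
      (L * (η y * |∑ k, (s k y + c * b k y) * (F (shift k y) - F y)|) +
        κ * (ζ y * slopeTerm s h F L y) +
        η y * ∑ k, s k y * (F (shift k y) - F y) ^ 2 * χ k) := by
  have hedge := Finset.sum_le_sum fun k (_ : k ∈ Finset.univ) =>
    energy_edge (x := F y) (x' := F (shift k y)) hL hc (hb k) hη (hη' k) (hχ k) (hχ1 k)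
      (tw := ∑ l, h k l y * twoDiff (fun y => huber L (F y)) k l y)
      (T := ∑ l, |h k l y| * (|F (shift l (shift k y)) - F (shift k y)| + |F (shift l y) - F y|))
      (by
        refine (Finset.abs_sum_le_sum_abs _ _).trans ?_
        rw [Finset.mul_sum]
        refine Finset.sum_le_sum fun l _ => ?_
        rw [abs_mul, mul_left_comm]
        exact mul_le_mul_of_nonneg_left (abs_twoDiff_huber_le hL F k l y) (abs_nonneg _))
  have hW : -(L * (η y * |∑ k, (s k y + c * b k y) * (F (shift k y) - F y)|)) ≤
      (∑ k, (s k y + c * b k y) * (F (shift k y) - F y)) * (η y * clamp L (F y)) := by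
    refine neg_le_of_abs_le ?_
    rw [abs_mul, abs_mul, abs_of_nonneg hη]
    nlinarith [mul_le_mul_of_nonneg_left (abs_clamp_le hL (F y)) (mul_nonneg hη (abs_nonneg
      (∑ k, (s k y + c * b k y) * (F (shift k y) - F y))))]
  -- This trades the term in `b ∂(huber F)` for the stream term, making the second group one that
  -- integrates to zero.
  rw [hstream]
  simp only [Finset.sum_add_distrib, Finset.sum_sub_distrib, ← Finset.mul_sum, ← Finset.sum_mul]
    at hedge
  simp only [slopeTerm, Finset.sum_add_distrib, ← Finset.mul_sum]
  linarith

variable [MeasurableSpace Y] {μ : Measure Y}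

theorem integrable_mul_of_le {w ζ t : Y → ℝ} (hw : Measurable w) (ht : Measurable t)
    (h : Integrable (fun y => w y * ζ y) μ) {C : ℝ} (hC : ∀ y, |t y| ≤ C * ζ y) :
    Integrable (fun y => w y * t y) μ := by
  refine (h.const_mul C).mono (hw.mul ht).aestronglyMeasurable (Eventually.of_forall fun y => ?_)
  rw [Real.norm_eq_abs, Real.norm_eq_abs, abs_mul, abs_mul, abs_mul, mul_left_comm, ← abs_mul C]
  exact mul_le_mul_of_nonneg_left ((hC y).trans (le_abs_self _)) (abs_nonneg _)

/-- A lattice system with conductances `s` and a flow `b`, a bounded function `F` and a cut-off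
`η` of slope at most `κ`, supported where `ζ` is positive. -/
structure EnergyData (μ : Measure Y) (s b : Dir d → Y → ℝ) (h : Dir d → Dir d → Y → ℝ)
    (F η ζ : Y → ℝ) (κ : ℝ) : Prop where
  stream : IsStream μ h b
  s_opp : ∀ k y, s k.opp (shift k y) = s k y
  b_opp : ∀ k y, b k.opp (shift k y) = -b k y
  b_le : ∀ᵐ y ∂μ, ∀ k, |b k y| ≤ s k y
  measurable_s : ∀ k, Measurable (s k)
  measurable_b : ∀ k, Measurable (b k)
  measurable_h : ∀ k l, Measurable (h k l)
  measurable_F : Measurable F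
  measurable_η : Measurable η
  measurable_ζ : Measurable ζ
  bounded : ∃ C, ∀ y, |F y| ≤ C
  nonneg : ∀ y, 0 ≤ η y
  le : ∀ y, η y ≤ ζ y
  slope : ∀ (k : Dir d) y, |η (shift k y) - η y| ≤ κ * ζ y
  integrable_s : ∀ k, Integrable (fun y => s k y * ζ y) μ
  integrable_h : ∀ k l, Integrable (fun y => h k l y * ζ y) μ

namespace EnergyData

variable {s b : Dir d → Y → ℝ} {h : Dir d → Dir d → Y → ℝ} {F η ζ : Y → ℝ} {κ : ℝ}

theorem ζ_nonneg (H : EnergyData μ s b h F η ζ κ) (y : Y) : 0 ≤ ζ y := (H.nonneg y).trans (H.le y)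

theorem integrable_s_mul (H : EnergyData μ s b h F η ζ κ) (k : Dir d) {t : Y → ℝ}
    (ht : Measurable t) {C : ℝ} (hC : ∀ y, |t y| ≤ C * ζ y) :
    Integrable (fun y => s k y * t y) μ :=
  integrable_mul_of_le (H.measurable_s k) ht (H.integrable_s k) hC

theorem integrable_b_mul (H : EnergyData μ s b h F η ζ κ) (k : Dir d) {t : Y → ℝ}
    (ht : Measurable t) {C : ℝ} (hC : ∀ y, |t y| ≤ C * ζ y) :
    Integrable (fun y => b k y * t y) μ := by
  refine (H.integrable_s_mul k ht hC).mono
    ((H.measurable_b k).mul ht).aestronglyMeasurable (H.b_le.mono fun y hy => ?_)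
  rw [norm_mul, norm_mul]
  exact mul_le_mul_of_nonneg_right ((hy k).trans (le_abs_self _)) (norm_nonneg _)

theorem integrable_h_mul (H : EnergyData μ s b h F η ζ κ) (k l : Dir d) {t : Y → ℝ}
    (ht : Measurable t) {C : ℝ} (hC : ∀ y, |t y| ≤ C * ζ y) :
    Integrable (fun y => h k l y * t y) μ :=
  integrable_mul_of_le (H.measurable_h k l) ht (H.integrable_h k l) hC

variable [MeasurableConstVAdd (Fin d → ℤ) Y]

theorem measurable_diff (H : EnergyData μ s b h F η ζ κ) (k : Dir d) :
    Measurable fun y => F (shift k y) - F y :=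
  (H.measurable_F.comp (measurable_shift k)).sub H.measurable_F

theorem integrable_slopeTerm (H : EnergyData μ s b h F η ζ κ) (L : ℝ) :
    Integrable (fun y => ζ y * slopeTerm s h F L y) μ := by
  obtain ⟨C, hC⟩ := H.bounded
  have hFs : ∀ k l : Dir d, Measurable fun y => F (shift l (shift k y)) - F (shift k y) :=
    fun k l => (H.measurable_diff l).comp (measurable_shift k)
  have h1 : ∀ k, Integrable (fun y => s k y * (ζ y * |F (shift k y) - F y|)) μ := fun k =>
    H.integrable_s_mul k (H.measurable_ζ.mul (H.measurable_diff k).abs) (C := 2 * C) fun y => by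
      rw [abs_mul, abs_abs, abs_of_nonneg (H.ζ_nonneg y), mul_comm]
      exact mul_le_mul_of_nonneg_right (abs_sub_le_two_mul hC _ _) (H.ζ_nonneg y)
  have h2 : ∀ k l, Integrable (fun y => |h k l y * (ζ y *
      (|F (shift l (shift k y)) - F (shift k y)| + |F (shift l y) - F y|))|) μ := fun k l =>
    (H.integrable_h_mul k l (t := fun y => ζ y * (|F (shift l (shift k y)) - F (shift k y)| +
      |F (shift l y) - F y|)) (H.measurable_ζ.mul ((hFs k l).abs.add (H.measurable_diff l).abs))
      (C := 4 * C) fun y => by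
      rw [abs_mul, abs_of_nonneg (H.ζ_nonneg y), mul_comm,
        abs_of_nonneg (add_nonneg (abs_nonneg _) (abs_nonneg _))]
      refine mul_le_mul_of_nonneg_right ?_ (H.ζ_nonneg y)
      linarith [abs_sub_le_two_mul hC (shift l (shift k y)) (shift k y), abs_sub_le_two_mul hC (shift l y) y]).abs
  have h3 : ∀ k, Integrable (fun y => s k y * (ζ y * (F (shift k y) - F y) ^ 2)) μ := fun k =>
    H.integrable_s_mul k (H.measurable_ζ.mul ((H.measurable_diff k).pow_const 2))
      (C := (2 * C) ^ 2) fun y => by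
      rw [abs_mul, abs_pow, abs_of_nonneg (H.ζ_nonneg y), mul_comm]
      exact mul_le_mul_of_nonneg_right (pow_le_pow_left₀ (abs_nonneg _) (abs_sub_le_two_mul hC _ _) 2)
        (H.ζ_nonneg y)
  have h4 := integrable_finsetSum Finset.univ fun k _ => ((h1 k).const_mul (L / 2)).add
    (((integrable_finsetSum Finset.univ fun l _ => h2 k l).const_mul (L / 4)).add
      ((h3 k).const_mul (1 / 4)))
  refine h4.congr (Eventually.of_forall fun y => ?_)
  simp only [slopeTerm, Finset.mul_sum, Pi.add_apply]
  refine Finset.sum_congr rfl fun k _ => ?_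
  have : ∑ l, L / 4 * |h k l y * (ζ y * (|F (shift l (shift k y)) - F (shift k y)| +
      |F (shift l y) - F y|))| = ζ y * ∑ l, L / 4 * (|h k l y| *
      (|F (shift l (shift k y)) - F (shift k y)| + |F (shift l y) - F y|)) := by
    rw [Finset.mul_sum]
    refine Finset.sum_congr rfl fun l _ => ?_
    have hT : 0 ≤ |F (shift l (shift k y)) - F (shift k y)| + |F (shift l y) - F y| := by
      positivity
    rw [abs_mul, abs_mul, abs_of_nonneg (H.ζ_nonneg y), abs_of_nonneg hT]
    ring
  rw [this]
  ring

variable [VAddInvariantMeasure (Fin d → ℤ) Y μ]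

/-- Summation by parts in the form in which the three groups of `energy_pointwise` disappear. -/
theorem integral_antisymm_null {D : Dir d → Y → ℝ} {g : Y → ℝ}
    (hD : ∀ k, ∀ᵐ y ∂μ, D k.opp (shift k y) = -D k y)
    (hi : ∀ k, Integrable (fun y => D k y * g y) μ) :
    Integrable (fun y => ∑ k, D k y * (g (shift k y) - g y) + 2 * ((∑ k, D k y) * g y)) μ ∧
      ∫ y, (∑ k, D k y * (g (shift k y) - g y) + 2 * ((∑ k, D k y) * g y)) ∂μ = 0 := by
  have h1 : Integrable (fun y => ∑ k, D k y * (g (shift k y) - g y)) μ := by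
    simp only [mul_sub]
    exact integrable_finsetSum _ fun k _ => (integrable_antisymm_mul_shift hD hi k).sub (hi k)
  have h2 : Integrable (fun y => (∑ k, D k y) * g y) μ := by
    simp only [Finset.sum_mul]
    exact integrable_finsetSum _ fun k _ => hi k
  refine ⟨h1.add (h2.const_mul 2), ?_⟩
  rw [integral_add h1 (h2.const_mul 2), integral_sum_antisymm_mul_diff hD hi, integral_const_mul]
  ring

/-- Integrating `energy_pointwise` removes the three antisymmetric groups. They use as fields and
test functions `s ∂F` with `η clamp(F)`, the stream field of `huber F` with `η`, and `b (∂F)²` with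
`η`. -/
theorem energy_estimate (H : EnergyData μ s b h F η ζ κ) {c L : ℝ} (hL : 0 ≤ L) (hc : |c| = 1)
    {χ : Dir d → Y → ℝ} (hχm : ∀ k, Measurable (χ k)) (hχ0 : ∀ k y, 0 ≤ χ k y)
    (hχ1 : ∀ k y, χ k y ≤ 1) (hχ : ∀ k y, L < |F y| ∨ L < |F (shift k y)| → 1 ≤ χ k y) :
    1 / 2 * ∫ y, η y * ∑ k, s k y * (F (shift k y) - F y) ^ 2 ∂μ ≤
      L * ∫ y, η y * |∑ k, (s k y + c * b k y) * (F (shift k y) - F y)| ∂μ +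
        κ * ∫ y, ζ y * slopeTerm s h F L y ∂μ +
        ∫ y, η y * ∑ k, s k y * (F (shift k y) - F y) ^ 2 * χ k y ∂μ := by
  obtain ⟨C, hC⟩ := H.bounded
  have hη : ∀ y, |η y| ≤ ζ y := fun y => by rw [abs_of_nonneg (H.nonneg y)]; exact H.le y
  have hmF := H.measurable_diff
  have hcl : Measurable fun y => clamp L (F y) :=
    (continuous_clamp L).measurable.comp H.measurable_F
  have hhu : Measurable fun y => huber L (F y) :=
    (continuous_huber L).measurable.comp H.measurable_F
  have hd := fun y y' => abs_sub_le_two_mul hC y y'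
  obtain ⟨i1, n1⟩ := integral_antisymm_null (μ := μ)
    (D := fun k y => s k y * (F (shift k y) - F y)) (g := fun y => η y * clamp L (F y))
    (fun k => Eventually.of_forall fun y => by
      simp only [H.s_opp, shift_opp_shift]; ring)
    (fun k => by
      simp only [mul_assoc]
      refine H.integrable_s_mul k ((hmF k).mul (H.measurable_η.mul hcl)) (C := 2 * C * L)
        fun y => ?_
      rw [abs_mul, abs_mul, mul_assoc, mul_comm |η y|]
      exact mul_le_mul (hd _ _) (mul_le_mul (abs_clamp_le hL _) (hη y) (abs_nonneg _) hL)
        (by positivity) ((abs_nonneg _).trans (hd y y)))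
  have hstr : ∀ k, Integrable (fun y => (∑ l, h k l y *
      twoDiff (fun y => huber L (F y)) k l y) * η y) μ := fun k => by
    simp only [Finset.sum_mul, mul_assoc]
    refine integrable_finsetSum _ fun l _ => ?_
    refine H.integrable_h_mul k l (Measurable.mul ?_ H.measurable_η) (C := L * (4 * C)) fun y => ?_
    · exact ((hhu.comp ((measurable_shift l).comp (measurable_shift k))).sub
        (hhu.comp (measurable_shift k))).add ((hhu.comp (measurable_shift l)).sub hhu)
    · rw [abs_mul]
      refine mul_le_mul ((abs_twoDiff_huber_le hL F k l y).trans
        (mul_le_mul_of_nonneg_left ?_ hL)) (hη y) (abs_nonneg _) ?_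
      · linarith [hd (shift l (shift k y)) (shift k y), hd (shift l y) y]
      · have := (abs_nonneg _).trans (hC y)
        positivity
  obtain ⟨i2, n2⟩ := integral_antisymm_null (μ := μ)
    (D := fun k y => ∑ l, h k l y * twoDiff (fun y => huber L (F y)) k l y) (g := η)
    (fun k => by
      filter_upwards [eventually_all.2 (H.stream.opp_left k)] with y hy
      rw [← Finset.sum_neg_distrib]
      refine Finset.sum_congr rfl fun l _ => ?_
      rw [hy l, twoDiff, twoDiff, shift_opp_shift]
      ring) hstr
  obtain ⟨i3, n3⟩ := integral_antisymm_null (μ := μ)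
    (D := fun k y => b k y * (F (shift k y) - F y) ^ 2) (g := η)
    (fun k => Eventually.of_forall fun y => by
      simp only [H.b_opp, shift_opp_shift]; ring)
    (fun k => by
      simp only [mul_assoc]
      refine H.integrable_b_mul k (((hmF k).pow_const 2).mul H.measurable_η) (C := (2 * C) ^ 2)
        fun y => ?_
      rw [abs_mul, abs_pow]
      exact mul_le_mul (pow_le_pow_left₀ (abs_nonneg _) (hd _ _) 2) (hη y) (abs_nonneg _)
        (by positivity))
  have i4 : Integrable (fun y => η y * |∑ k, (s k y + c * b k y) * (F (shift k y) - F y)|) μ := by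
    have h1 : Integrable (fun y => ∑ k, (s k y * (η y * (F (shift k y) - F y)) +
        c * (b k y * (η y * (F (shift k y) - F y))))) μ := by
      have hb : ∀ (k : Dir d) y, |η y * (F (shift k y) - F y)| ≤ 2 * C * ζ y := fun k y => by
        rw [abs_mul, mul_comm]
        exact mul_le_mul (hd _ _) (hη y) (abs_nonneg _) ((abs_nonneg _).trans (hd y y))
      exact integrable_finsetSum _ fun k _ =>
        (H.integrable_s_mul k (H.measurable_η.mul (hmF k)) (hb k)).add
        ((H.integrable_b_mul k (H.measurable_η.mul (hmF k)) (hb k)).const_mul c)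
    refine h1.abs.congr (Eventually.of_forall fun y => ?_)
    dsimp only
    rw [← abs_of_nonneg (H.nonneg y), ← abs_mul, abs_of_nonneg (H.nonneg y), Finset.mul_sum]
    congr 1
    exact Finset.sum_congr rfl fun k _ => by ring
  have i5 := H.integrable_slopeTerm L
  have i6 : Integrable (fun y => η y * ∑ k, s k y * (F (shift k y) - F y) ^ 2 * χ k y) μ := by
    have : ∀ k, Integrable (fun y => s k y * ((F (shift k y) - F y) ^ 2 * (χ k y * η y))) μ :=
      fun k => by
        refine H.integrable_s_mul k (((hmF k).pow_const 2).mul ((hχm k).mul H.measurable_η))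
          (C := (2 * C) ^ 2) fun y => ?_
        rw [abs_mul, abs_pow, abs_mul, abs_of_nonneg (hχ0 k y)]
        refine mul_le_mul (pow_le_pow_left₀ (abs_nonneg _) (hd _ _) 2) ?_
          (mul_nonneg (hχ0 k y) (abs_nonneg _)) (by positivity)
        exact (mul_le_of_le_one_left (abs_nonneg _) (hχ1 k y)).trans (hη y)
    refine (integrable_finsetSum Finset.univ fun k _ => this k).congr
      (Eventually.of_forall fun y => ?_)
    dsimp only
    rw [Finset.mul_sum]
    exact Finset.sum_congr rfl fun k _ => by ring
  have i7 : Integrable (fun y => η y * ∑ k, s k y * (F (shift k y) - F y) ^ 2) μ := by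
    have : ∀ k, Integrable (fun y => s k y * ((F (shift k y) - F y) ^ 2 * η y)) μ :=
      fun k => by
        refine H.integrable_s_mul k (((hmF k).pow_const 2).mul H.measurable_η)
          (C := (2 * C) ^ 2) fun y => ?_
        rw [abs_mul, abs_pow]
        exact mul_le_mul (pow_le_pow_left₀ (abs_nonneg _) (hd _ _) 2) (hη y)
          (abs_nonneg _) (by positivity)
    refine (integrable_finsetSum Finset.univ fun k _ => this k).congr
      (Eventually.of_forall fun y => ?_)
    dsimp only
    rw [Finset.mul_sum]
    exact Finset.sum_congr rfl fun k _ => by ring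
  have hmain := integral_mono_ae (i7.const_mul (1 / 2))
    ((((i1.const_mul (1 / 2)).add (i2.const_mul (-(c / 4)))).add (i3.const_mul (-(c / 4)))).add
      (((i4.const_mul L).add (i5.const_mul κ)).add i6)) (by
    filter_upwards [H.b_le, H.stream.sum_twoDiff fun y => huber L (F y)] with y hb hst
    exact energy_pointwise hL hc y hb (H.nonneg y) (fun k => H.slope k y) (fun k => hχ0 k y)
      (fun k => hχ k y) hst)
  rw [integral_add' (((i1.const_mul _).add (i2.const_mul _)).add (i3.const_mul _))
      (((i4.const_mul L).add (i5.const_mul κ)).add i6),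
    integral_add' ((i1.const_mul _).add (i2.const_mul _)) (i3.const_mul _),
    integral_add' (i1.const_mul _) (i2.const_mul _),
    integral_add' ((i4.const_mul L).add (i5.const_mul κ)) i6,
    integral_add' (i4.const_mul L) (i5.const_mul κ)] at hmain
  simp only [integral_const_mul, n1, n2, n3] at hmain
  linarith

end EnergyData

end Energy

end RandomEnv

namespace RandomEnv

/-! ### Tent cut-offs on the lattice -/

section Cutoff

variable {d : ℕ}

/-- The tent function of height one on the box of radius `N`. -/
noncomputable def tent (N : ℕ) (z : Fin d → ℤ) : ℝ := max 0 (1 - ‖z‖ / N)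

/-- The indicator of the box of radius `N`. -/
noncomputable def boxInd (N : ℕ) (z : Fin d → ℤ) : ℝ :=
  Set.indicator {z : Fin d → ℤ | ‖z‖ ≤ N} 1 z

theorem norm_le_iff_mem_Icc (N : ℕ) (z : Fin d → ℤ) :
    ‖z‖ ≤ N ↔ z ∈ Finset.Icc (fun _ : Fin d => (-N : ℤ)) (fun _ => (N : ℤ)) := by
  rw [pi_norm_le_iff_of_nonneg (Nat.cast_nonneg N), Finset.mem_Icc, Pi.le_def, Pi.le_def,
    ← forall_and]
  refine forall_congr' fun i => ?_
  rw [Int.norm_eq_abs, ← abs_le]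
  norm_cast

theorem coe_box (N : ℕ) : {z : Fin d → ℤ | ‖z‖ ≤ N} =
    (Finset.Icc (fun _ : Fin d => (-N : ℤ)) (fun _ => (N : ℤ)) : Finset (Fin d → ℤ)) := by
  ext z
  simp only [Set.mem_ofPred_eq, norm_le_iff_mem_Icc, Finset.mem_coe]

theorem integral_boxInd (N : ℕ) :
    ∫ z, boxInd (d := d) N z ∂Measure.count = (2 * N + 1 : ℝ) ^ d := by
  have : MeasurableSet {z : Fin d → ℤ | ‖z‖ ≤ N} := .of_discrete
  unfold boxInd
  rw [integral_indicator_one this, coe_box, measureReal_def, Measure.count_apply_finset,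
    ENNReal.toReal_natCast, Pi.card_Icc]
  simp only [Int.card_Icc, Finset.prod_const, Finset.card_univ, Fintype.card_fin, Nat.cast_pow]
  congr 1
  have : ((N : ℤ) + 1 - -N).toNat = 2 * N + 1 := by omega
  rw [this]
  push_cast
  ring

theorem integrable_boxInd (N : ℕ) : Integrable (boxInd (d := d) N) Measure.count := by
  have : MeasurableSet {z : Fin d → ℤ | ‖z‖ ≤ N} := .of_discrete
  refine (integrable_indicator_iff this).2 ?_
  refine integrableOn_const ?_
  rw [coe_box, Measure.count_apply_finset]
  exact ENNReal.natCast_ne_top _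

theorem boxInd_of_le {N : ℕ} {z : Fin d → ℤ} (h : ‖z‖ ≤ N) : boxInd N z = 1 :=
  Set.indicator_of_mem (s := {z : Fin d → ℤ | ‖z‖ ≤ N}) h _

theorem boxInd_nonneg (N : ℕ) (z : Fin d → ℤ) : 0 ≤ boxInd N z :=
  Set.indicator_nonneg (fun _ _ => zero_le_one) _

theorem tent_nonneg (N : ℕ) (z : Fin d → ℤ) : 0 ≤ tent N z := le_max_left _ _

theorem tent_le_one (N : ℕ) (z : Fin d → ℤ) : tent N z ≤ 1 :=
  max_le zero_le_one (sub_le_self _ (by positivity))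

theorem tent_eq_zero {N : ℕ} (hN : 0 < N) {z : Fin d → ℤ} (h : (N : ℝ) ≤ ‖z‖) : tent N z = 0 := by
  refine max_eq_left ?_
  rw [sub_nonpos, one_le_div (by positivity)]
  exact h

theorem tent_le_boxInd {N : ℕ} (hN : 0 < N) (z : Fin d → ℤ) : tent N z ≤ boxInd (N + 1) z := by
  rcases le_total (N : ℝ) ‖z‖ with h | h
  · rw [tent_eq_zero hN h]; exact boxInd_nonneg _ _
  · rw [boxInd_of_le (by push_cast; linarith)]; exact tent_le_one _ _

theorem integrable_tent {N : ℕ} (hN : 0 < N) : Integrable (tent (d := d) N) Measure.count :=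
  (integrable_boxInd (N + 1)).mono Measurable.of_discrete.aestronglyMeasurable
    (Eventually.of_forall fun z => by
      rw [Real.norm_of_nonneg (tent_nonneg N z), Real.norm_of_nonneg (boxInd_nonneg _ z)]
      exact tent_le_boxInd hN z)

theorem norm_vec_le (k : Dir d) : ‖k.vec‖ ≤ 1 := by
  refine (pi_norm_le_iff_of_nonneg zero_le_one).2 fun i => ?_
  rw [Dir.vec, Pi.single_apply]
  split_ifs
  · rcases Int.units_eq_one_or k.2 with h | h <;> simp [h]
  · simp

/-- An edge that meets the support may start one step outside the box of radius `N`, hence the box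
of radius `N + 1`. -/
theorem abs_tent_sub_le {N : ℕ} (hN : 0 < N) (k : Dir d) (z : Fin d → ℤ) :
    |tent N (k.vec + z) - tent N z| ≤ 1 / N * boxInd (N + 1) z := by
  have h0 := norm_vec_le k
  have h1 : ‖z‖ ≤ ‖k.vec + z‖ + ‖k.vec‖ := by
    have := norm_sub_le (k.vec + z) k.vec
    rwa [add_sub_cancel_left] at this
  have h2 := norm_add_le k.vec z
  by_cases h : ‖z‖ ≤ (N + 1 : ℕ)
  · rw [boxInd_of_le h, mul_one, tent, tent]
    refine (abs_max_sub_max_le_max _ _ _ _).trans ?_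
    rw [sub_self, abs_zero, sub_sub_sub_cancel_left, ← sub_div, abs_div, Nat.abs_cast]
    refine max_le (by positivity) ?_
    gcongr
    rw [abs_le]
    constructor <;> linarith
  · push Not at h
    push_cast at h
    rw [tent_eq_zero hN (by linarith), tent_eq_zero hN (by linarith), sub_zero, abs_zero]
    exact mul_nonneg (by positivity) (boxInd_nonneg _ _)

theorem boxInd_le_tent {M : ℕ} (hM : 0 < M) (z : Fin d → ℤ) :
    1 / 2 * boxInd M z ≤ tent (2 * M) z := by
  by_cases h : ‖z‖ ≤ M
  · rw [boxInd_of_le h]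
    refine le_trans ?_ (le_max_right _ _)
    have : ‖z‖ / (2 * M : ℕ) ≤ 1 / 2 := by
      push_cast
      rw [div_le_div_iff₀ (by positivity) two_pos]
      linarith
    linarith
  · rw [boxInd, Set.indicator_of_notMem (by exact h), mul_zero]
    exact tent_nonneg _ _

theorem integral_tent_pos {M : ℕ} (hM : 0 < M) : 0 < ∫ z, tent (d := d) (2 * M) z ∂Measure.count := by
  have := integral_mono ((integrable_boxInd M).const_mul (1 / 2)) (integrable_tent (by positivity))
    (boxInd_le_tent (d := d) hM)
  rw [integral_const_mul, integral_boxInd] at this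
  refine lt_of_lt_of_le ?_ this
  positivity

/-- The tent of radius `2M` is at least `1 / 2` on `(2M + 1)^d` points, while the larger box has
`(4M + 3)^d ≤ (3 (2M + 1))^d` points. -/
theorem integral_boxInd_le {M : ℕ} (hM : 0 < M) : ∫ z, boxInd (d := d) (2 * M + 1) z ∂Measure.count ≤
    2 * 3 ^ d * ∫ z, tent (d := d) (2 * M) z ∂Measure.count := by
  have := integral_mono ((integrable_boxInd M).const_mul (1 / 2)) (integrable_tent (by positivity))
    (boxInd_le_tent (d := d) hM)
  rw [integral_const_mul, integral_boxInd] at this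
  have h3 : (2 * (2 * M + 1 : ℕ) + 1 : ℝ) ^ d ≤ (3 * (2 * M + 1)) ^ d := by
    gcongr
    push_cast
    linarith
  rw [integral_boxInd]
  refine h3.trans ?_
  rw [mul_pow]
  linarith [mul_le_mul_of_nonneg_left this (show (0 : ℝ) ≤ 3 ^ d by positivity)]

end Cutoff

/-! ### The orbit potential on `Ω × ℤ^d` -/

section Product

variable {d : ℕ} {Ω : Type*}

theorem ae_prod_count [MeasurableSpace Ω] {π : Measure Ω} [SFinite π] {q : Ω → Prop}
    (h : ∀ᵐ ω ∂π, q ω) : ∀ᵐ y ∂π.prod (Measure.count : Measure (Fin d → ℤ)), q y.1 :=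
  Measure.quasiMeasurePreserving_fst.ae h

theorem integral_snd_mul_fst [MeasurableSpace Ω] {π : Measure Ω} [SFinite π]
    (a : (Fin d → ℤ) → ℝ) (g : Ω → ℝ) :
    ∫ y : Ω × (Fin d → ℤ), a y.2 * g y.1 ∂(π.prod Measure.count) =
      (∫ z, a z ∂Measure.count) * ∫ ω, g ω ∂π := by
  rw [mul_comm, ← integral_prod_mul]
  exact integral_congr_ae (Eventually.of_forall fun y => mul_comm _ _)

variable [AddAction (Fin d → ℤ) Ω]

theorem shift_prod (k : Dir d) (y : Ω × (Fin d → ℤ)) : shift k y = (shift k y.1, k.vec + y.2) := rfl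

/-- The diagonal shift moves `(ω, z)` along the orbit and fixes its base point `-z +ᵥ ω`. Thus `f(ω)
- f(-z +ᵥ ω)` is a potential of `∇f` normalised at the origin, and its differences depend on `ω`
only. -/
theorem increment_shift (f : Ω → ℝ) (k : Dir d) (y : Ω × (Fin d → ℤ)) :
    f (shift k y).1 - f (-(shift k y).2 +ᵥ (shift k y).1) =
      f (shift k y.1) - f (-y.2 +ᵥ y.1) := by
  have : -(k.vec + y.2) +ᵥ shift k y.1 = -y.2 +ᵥ y.1 := by
    rw [shift, vadd_vadd, neg_add_rev, neg_add_cancel_right]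
  rw [shift_prod]
  dsimp only
  rw [this]

theorem increment_shift_sub (f : Ω → ℝ) (k : Dir d) (y : Ω × (Fin d → ℤ)) :
    f (shift k y).1 - f (-(shift k y).2 +ᵥ (shift k y).1) - (f y.1 - f (-y.2 +ᵥ y.1)) =
      f (shift k y.1) - f y.1 := by
  rw [increment_shift]
  ring

theorem slopeTerm_increment (s : Dir d → Ω → ℝ) (h : Dir d → Dir d → Ω → ℝ) (f : Ω → ℝ) (L : ℝ)
    (y : Ω × (Fin d → ℤ)) :
    slopeTerm (fun k y => s k y.1) (fun k l y => h k l y.1)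
      (fun y : Ω × (Fin d → ℤ) => f y.1 - f (-y.2 +ᵥ y.1)) L y = slopeTerm s h f L y.1 := by
  simp only [slopeTerm, increment_shift_sub]
  simp only [shift_prod]

variable [MeasurableSpace Ω] [MeasurableConstVAdd (Fin d → ℤ) Ω]

instance : MeasurableConstVAdd (Fin d → ℤ) (Ω × (Fin d → ℤ)) :=
  ⟨fun c => ((measurable_const_vadd c).comp measurable_fst).prodMk
    ((measurable_const_vadd c).comp measurable_snd)⟩

instance {π : Measure Ω} [SFinite π] [VAddInvariantMeasure (Fin d → ℤ) Ω π] :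
    VAddInvariantMeasure (Fin d → ℤ) (Ω × (Fin d → ℤ))
      (π.prod (Measure.count : Measure (Fin d → ℤ))) where
  measure_preimage_vadd c _ ht :=
    ((measurePreserving_vadd c π).prod (measurePreserving_vadd c Measure.count)).measure_preimage
      ht.nullMeasurableSet

theorem measurable_increment {f : Ω → ℝ} (hf : Measurable f) :
    Measurable fun y : Ω × (Fin d → ℤ) => f y.1 - f (-y.2 +ᵥ y.1) :=
  (hf.comp measurable_fst).sub (hf.comp
    (measurable_from_prod_countable_left fun z => measurable_const_vadd (-z)))

/-- The energy on bad edges is small because `x` is close to the limit gradient `t`. The part of `s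
t²` above level `Q` is small by integrability, and the part below is at most `Q χ`, where `χ` is
bounded linearly by the size `a`, `a'` of the potential at the two ends. -/
theorem edge_bad_le {s x t χ a a' L Q : ℝ} (hs : 0 ≤ s) (hL : 0 < L) (hQ : 0 ≤ Q)
    (ha' : a' ≤ a + |x|) (hχ : χ = min 1 ((a + a') / L)) (hχ0 : 0 ≤ χ) :
    s * x ^ 2 * χ ≤ 2 * (s * (x - t) ^ 2) +
      2 * (if Q < s * t ^ 2 then s * t ^ 2 else 0) + 2 * Q / L * |x| + 4 * Q / L * a := by
  have h1 : χ ≤ 1 := hχ ▸ min_le_left _ _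
  have h2 : χ ≤ (2 * a + |x|) / L := hχ ▸ (min_le_right _ _).trans (div_le_div_of_nonneg_right (by linarith) hL.le)
  have h3 : s * x ^ 2 ≤ 2 * (s * (x - t) ^ 2) + 2 * (s * t ^ 2) := by
    nlinarith [mul_nonneg hs (sq_nonneg (x - 2 * t))]
  have h4 : s * (x - t) ^ 2 * χ ≤ s * (x - t) ^ 2 := mul_le_of_le_one_right (by positivity) h1
  have h5 : s * t ^ 2 * χ ≤ (if Q < s * t ^ 2 then s * t ^ 2 else 0) + Q * χ := by
    split_ifs with h
    · exact (mul_le_of_le_one_right (by positivity) h1).trans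
        (le_add_of_nonneg_right (by positivity))
    · push Not at h
      rw [zero_add]
      gcongr
  have h6 : Q * χ ≤ Q * ((2 * a + |x|) / L) := by gcongr
  have h7 := mul_le_mul_of_nonneg_right h3 hχ0
  have h8 : 2 * (Q * ((2 * a + |x|) / L)) = 2 * Q / L * |x| + 4 * Q / L * a := by ring
  nlinarith

theorem integral_tent_mul_increment_le {π : Measure Ω} [IsProbabilityMeasure π] {f : Ω → ℝ} (hf : Measurable f) {C : ℝ}
    (hC : ∀ ω, |f ω| ≤ C) {N : ℕ} (hN : 0 < N) {ρ : ℝ}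
    (hρ : ∀ z : Fin d → ℤ, ‖z‖ ≤ N → ∫ ω, |f ω - f (-z +ᵥ ω)| ∂π ≤ ρ) :
    Integrable (fun y : Ω × (Fin d → ℤ) => |f y.1 - f (-y.2 +ᵥ y.1)| * tent N y.2)
      (π.prod Measure.count) ∧
    ∫ y : Ω × (Fin d → ℤ), |f y.1 - f (-y.2 +ᵥ y.1)| * tent N y.2 ∂(π.prod Measure.count) ≤
      ρ * ∫ z, tent (d := d) N z ∂Measure.count := by
  have hi : Integrable (fun y : Ω × (Fin d → ℤ) => |f y.1 - f (-y.2 +ᵥ y.1)| * tent N y.2)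
      (π.prod Measure.count) := by
    refine ((integrable_const (2 * C)).mul_prod (integrable_tent hN)).mono
      ((measurable_increment hf).abs.mul
        ((Measurable.of_discrete (f := tent (d := d) N)).comp measurable_snd)).aestronglyMeasurable
      (Eventually.of_forall fun y => ?_)
    rw [norm_mul, norm_mul]
    refine mul_le_mul_of_nonneg_right ?_ (norm_nonneg _)
    rw [Real.norm_eq_abs, abs_abs]
    exact (abs_sub_le_two_mul hC _ _).trans (le_abs_self _)
  refine ⟨hi, ?_⟩
  rw [integral_prod_symm _ hi, ← integral_const_mul]
  refine integral_mono hi.integral_prod_right ((integrable_tent hN).const_mul ρ) fun z => ?_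
  dsimp only
  rw [integral_mul_const]
  rcases le_total ‖z‖ N with h | h
  · exact mul_le_mul_of_nonneg_right (hρ z h) (tent_nonneg N z)
  · rw [tent_eq_zero hN h, mul_zero, mul_zero]

section Subadditive

variable {π : Measure Ω} [VAddInvariantMeasure (Fin d → ℤ) Ω π] {g : Ω → ℝ}

theorem integrable_vadd_sub (hg : Integrable g π) (z : Fin d → ℤ) :
    Integrable (fun ω => g (z +ᵥ ω) - g ω) π :=
  ((measurePreserving_vadd z π).integrable_comp_of_integrable hg).sub hg

/-- The increments form a cocycle over a measure preserving action. -/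
theorem integral_abs_vadd_add_le (hg : Integrable g π) (z z' : Fin d → ℤ) :
    ∫ ω, |g ((z + z') +ᵥ ω) - g ω| ∂π ≤
      ∫ ω, |g (z +ᵥ ω) - g ω| ∂π + ∫ ω, |g (z' +ᵥ ω) - g ω| ∂π := by
  have h1 : Integrable (fun ω => |g (z +ᵥ z' +ᵥ ω) - g (z' +ᵥ ω)|) π :=
    ((measurePreserving_vadd z' π).integrable_comp_of_integrable (integrable_vadd_sub hg z)).abs
  have h2 : ∫ ω, |g (z +ᵥ z' +ᵥ ω) - g (z' +ᵥ ω)| ∂π = ∫ ω, |g (z +ᵥ ω) - g ω| ∂π :=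
    integral_vadd_eq_self (fun ω => |g (z +ᵥ ω) - g ω|)
  rw [← h2, ← integral_add h1 (integrable_vadd_sub hg z').abs]
  refine integral_mono (integrable_vadd_sub hg _).abs (h1.add (integrable_vadd_sub hg z').abs)
    fun ω => ?_
  simp only [add_vadd]
  exact abs_sub_le _ _ _

/-- The `L¹` size of the increments of a function grows at most linearly. -/
theorem integral_abs_vadd_sub_le (hg : Integrable g π) {δ : ℝ}
    (hδ : ∀ k : Dir d, ∫ ω, |g (shift k ω) - g ω| ∂π ≤ δ) (z : Fin d → ℤ) :
    ∫ ω, |g (z +ᵥ ω) - g ω| ∂π ≤ d * ‖z‖ * δ := by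
  have h0 : ∫ ω, |g ((0 : Fin d → ℤ) +ᵥ ω) - g ω| ∂π = 0 := by simp
  have h1 : ∀ (i : Fin d) (σ : ℤˣ) (n : ℕ),
      ∫ ω, |g ((Pi.single i (σ * n : ℤ) : Fin d → ℤ) +ᵥ ω) - g ω| ∂π ≤ n * δ := by
    intro i σ n
    induction n with
    | zero => simp
    | succ n ih =>
      rw [Nat.cast_succ, mul_add, mul_one, Pi.single_add]
      refine (integral_abs_vadd_add_le hg _ _).trans ?_
      have := hδ (i, σ)
      rw [Nat.cast_succ, add_mul, one_mul]
      exact add_le_add ih this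
  have h2 : ∀ (i : Fin d) (m : ℤ),
      ∫ ω, |g ((Pi.single i m : Fin d → ℤ) +ᵥ ω) - g ω| ∂π ≤ |(m : ℝ)| * δ := by
    intro i m
    have hm : ∃ σ : ℤˣ, m = σ * (m.natAbs : ℤ) := by
      rcases Int.natAbs_eq m with h | h
      · exact ⟨1, by simpa using h⟩
      · exact ⟨-1, by simpa using h⟩
    obtain ⟨σ, hσ⟩ := hm
    have := h1 i σ m.natAbs
    rwa [← hσ, Nat.cast_natAbs, Int.cast_abs] at this
  have h3 : ∀ s : Finset (Fin d),
      ∫ ω, |g ((∑ i ∈ s, (Pi.single i (z i) : Fin d → ℤ)) +ᵥ ω) - g ω| ∂π ≤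
        ∑ i ∈ s, |(z i : ℝ)| * δ := by
    intro s
    induction s using Finset.induction_on with
    | empty => simp
    | insert i s hi ih =>
      rw [Finset.sum_insert hi, Finset.sum_insert hi]
      exact (integral_abs_vadd_add_le hg _ _).trans (add_le_add (h2 i _) ih)
  have h4 := h3 Finset.univ
  rw [Finset.univ_sum_single] at h4
  refine h4.trans ?_
  rcases isEmpty_or_nonempty (Fin d) with h | ⟨⟨i⟩⟩
  · have : d = 0 := by_contra fun hd => h.elim ⟨0, Nat.pos_of_ne_zero hd⟩
    simp [this]
  have hδ0 : 0 ≤ δ := le_trans (integral_nonneg fun _ => abs_nonneg _) (hδ (i, 1))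
  refine (Finset.sum_le_card_nsmul Finset.univ _ (‖z‖ * δ) fun i _ => ?_).trans (le_of_eq ?_)
  · have := norm_le_pi_norm z i
    rw [Int.norm_eq_abs] at this
    exact mul_le_mul_of_nonneg_right this hδ0
  · rw [Finset.card_univ, Fintype.card_fin, nsmul_eq_mul, mul_assoc]

end Subadditive

end Product

namespace Rates

variable {d : ℕ} {Ω : Type*} [MeasurableSpace Ω] [AddAction (Fin d → ℤ) Ω]
  [MeasurableConstVAdd (Fin d → ℤ) Ω] {π : Measure Ω} [IsProbabilityMeasure π]
  [VAddInvariantMeasure (Fin d → ℤ) Ω π] (X : Rates d Ω π)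

theorem energyData (hs : ∀ k, Integrable (X.s k) π) (hh : ∀ k l, Integrable (X.h k l) π)
    {f : Ω → ℝ} (hf : Measurable f) {C : ℝ} (hC : ∀ ω, |f ω| ≤ C) {N : ℕ} (hN : 0 < N) :
    EnergyData (π.prod (Measure.count : Measure (Fin d → ℤ))) (fun k y => X.s k y.1)
      (fun k y => X.b k y.1) (fun k l y => X.h k l y.1) (fun y => f y.1 - f (-y.2 +ᵥ y.1))
      (fun y => tent N y.2) (fun y => boxInd (N + 1) y.2) (1 / N) where
  stream := ⟨fun k l => ae_prod_count (X.h_opp_left k l), fun k l => ae_prod_count (X.h_antisymm k l),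
    fun k => ae_prod_count (X.curl k)⟩
  s_opp k y := X.s_opp k y.1
  b_opp k y := X.b_opp k y.1
  b_le := ae_prod_count X.abs_b_le_s
  measurable_s k := (X.measurable_s k).comp measurable_fst
  measurable_b k := (X.measurable_b k).comp measurable_fst
  measurable_h k l := (X.measurable_h k l).comp measurable_fst
  measurable_F := measurable_increment hf
  measurable_η := (Measurable.of_discrete (f := tent (d := d) N)).comp measurable_snd
  measurable_ζ := (Measurable.of_discrete (f := boxInd (d := d) (N + 1))).comp measurable_snd
  bounded := ⟨2 * C, fun _ => abs_sub_le_two_mul hC _ _⟩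
  nonneg y := tent_nonneg N y.2
  le y := tent_le_boxInd hN y.2
  slope k y := abs_tent_sub_le hN k y.2
  integrable_s k := (hs k).mul_prod (integrable_boxInd _)
  integrable_h k l := (hh k l).mul_prod (integrable_boxInd _)

/-- The energy estimate for a bounded function on the environment. -/
theorem energy_le (hs : ∀ k, Integrable (X.s k) π) (hh : ∀ k l, Integrable (X.h k l) π)
    {f : Ω → ℝ} (hf : Measurable f) {C : ℝ} (hC : ∀ ω, |f ω| ≤ C) {M : ℕ} (hM : 0 < M) {c L Q ρ : ℝ}
    (hc : |c| = 1) (hL : 0 < L) (hQ : 0 ≤ Q)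
    (hρ : ∀ z : Fin d → ℤ, ‖z‖ ≤ (2 * M : ℕ) → ∫ ω, |f ω - f (-z +ᵥ ω)| ∂π ≤ ρ)
    {θ : Dir d → Ω → ℝ} (hθ : ∀ k, Measurable (θ k))
    (hθi : ∀ k, Integrable (fun ω => X.s k ω * θ k ω ^ 2) π) :
    1 / 2 * ∫ ω, ∑ k, X.s k ω * (f (shift k ω) - f ω) ^ 2 ∂π ≤
      L * ∫ ω, |∑ k, (X.s k ω + c * X.b k ω) * (f (shift k ω) - f ω)| ∂π +
      3 ^ d / M * ∫ ω, slopeTerm X.s X.h f L ω ∂π +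
      ∑ k, (2 * ∫ ω, X.s k ω * (f (shift k ω) - f ω - θ k ω) ^ 2 ∂π +
        2 * ∫ ω, (if Q < X.s k ω * θ k ω ^ 2 then X.s k ω * θ k ω ^ 2 else 0) ∂π +
        2 * Q / L * ∫ ω, |f (shift k ω) - f ω| ∂π + 4 * Q / L * ρ) := by
  have hN : 0 < 2 * M := by positivity
  set μ := π.prod (Measure.count : Measure (Fin d → ℤ)) with hμ
  set w := ∫ z, tent (d := d) (2 * M) z ∂Measure.count with hw
  have hw0 : 0 < w := integral_tent_pos hM
  have H := X.energyData hs hh hf hC hN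
  set F : Ω × (Fin d → ℤ) → ℝ := fun y => f y.1 - f (-y.2 +ᵥ y.1) with hF
  have hFm : Measurable F := measurable_increment hf
  have hDm : ∀ k : Dir d, Measurable fun ω => f (shift k ω) - f ω := fun k =>
    (hf.comp (measurable_shift k)).sub hf
  obtain ⟨iF, nF⟩ := integral_tent_mul_increment_le (π := π) hf hC hN hρ
  have hq : ∀ k, Integrable (fun ω => X.s k ω * (f (shift k ω) - f ω) ^ 2) π := fun k =>
    (hs k).mul_bdd (c := (2 * C) ^ 2) ((hDm k).pow_const 2).aestronglyMeasurable
      (Eventually.of_forall fun ω => by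
        rw [norm_pow, Real.norm_eq_abs]
        exact pow_le_pow_left₀ (abs_nonneg _) (abs_sub_le_two_mul hC _ _) 2)
  have hs0 : ∀ᵐ ω ∂π, ∀ k, 0 ≤ X.s k ω := by
    filter_upwards [X.abs_b_le_s] with ω h k
    exact (abs_nonneg _).trans (h k)
  have g1 : ∀ k, Integrable (fun ω => X.s k ω * (f (shift k ω) - f ω - θ k ω) ^ 2) π := fun k => by
    refine (((hq k).const_mul 2).add ((hθi k).const_mul 2)).mono
      ((X.measurable_s k).mul (((hDm k).sub (hθ k)).pow_const 2)).aestronglyMeasurable ?_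
    filter_upwards [hs0] with ω h
    have h0 := h k
    rw [Real.norm_of_nonneg (by positivity)]
    refine le_trans ?_ (le_abs_self _)
    simp only [Pi.add_apply]
    nlinarith [mul_nonneg h0 (sq_nonneg (f (shift k ω) - f ω + θ k ω))]
  have g2 : ∀ k, Integrable (fun ω => if Q < X.s k ω * θ k ω ^ 2 then X.s k ω * θ k ω ^ 2 else 0) π :=
    fun k => (hθi k).indicator (measurableSet_lt measurable_const
      ((X.measurable_s k).mul ((hθ k).pow_const 2)))
  have g3 : ∀ k : Dir d, Integrable (fun ω => |f (shift k ω) - f ω|) π := fun k =>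
    (integrable_of_ae_abs_le (hDm k).aestronglyMeasurable
      (Eventually.of_forall fun ω => abs_sub_le_two_mul hC _ _)).abs
  have hit := integrable_tent (d := d) hN
  -- A Lipschitz majorant of the indicator of large values: it equals one there and is controlled by
  -- the `L¹` size of `F`.
  have est := H.energy_estimate hL.le hc
    (χ := fun k y => min 1 ((|F y| + |F (shift k y)|) / L))
    (fun k => measurable_const.min ((hFm.abs.add (hFm.comp (measurable_shift k)).abs).div_const L))
    (fun k y => le_min zero_le_one (by positivity)) (fun k y => min_le_left _ _)
    (fun k y h => by
      refine le_min le_rfl ((one_le_div hL).2 ?_)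
      rcases h with h | h
      · linarith [abs_nonneg (F (shift k y))]
      · linarith [abs_nonneg (F y)])
  simp only [hF, increment_shift_sub, slopeTerm_increment] at est
  rw [integral_snd_mul_fst (tent (2 * M)) fun ω => ∑ k, X.s k ω * (f (shift k ω) - f ω) ^ 2,
    integral_snd_mul_fst (tent (2 * M)) fun ω =>
      |∑ k, (X.s k ω + c * X.b k ω) * (f (shift k ω) - f ω)|,
    integral_snd_mul_fst (boxInd (2 * M + 1)) (slopeTerm X.s X.h f L), ← hw] at est
  have hsl : 0 ≤ ∫ ω, slopeTerm X.s X.h f L ω ∂π := by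
    refine integral_nonneg_of_ae (hs0.mono fun ω h => ?_)
    exact Finset.sum_nonneg fun k _ => by have := h k; positivity
  have e3 : ∫ y : Ω × (Fin d → ℤ), tent (2 * M) y.2 * ∑ k, X.s k y.1 *
      (f (shift k y.1) - f y.1) ^ 2 * min 1 ((|F y| + |F (shift k y)|) / L) ∂μ ≤
      w * ∑ k, (2 * ∫ ω, X.s k ω * (f (shift k ω) - f ω - θ k ω) ^ 2 ∂π +
        2 * ∫ ω, (if Q < X.s k ω * θ k ω ^ 2 then X.s k ω * θ k ω ^ 2 else 0) ∂π +
        2 * Q / L * ∫ ω, |f (shift k ω) - f ω| ∂π + 4 * Q / L * ρ) := by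
    have hG : ∀ k, Integrable (fun y : Ω × (Fin d → ℤ) =>
        (2 * (X.s k y.1 * (f (shift k y.1) - f y.1 - θ k y.1) ^ 2) +
        2 * (if Q < X.s k y.1 * θ k y.1 ^ 2 then X.s k y.1 * θ k y.1 ^ 2 else 0) +
        2 * Q / L * |f (shift k y.1) - f y.1|) * tent (2 * M) y.2 +
        4 * Q / L * (|F y| * tent (2 * M) y.2)) μ := fun k =>
      (((((g1 k).const_mul 2).add ((g2 k).const_mul 2)).add
        ((g3 k).const_mul (2 * Q / L))).mul_prod hit).add (iF.const_mul _)
    have hle := integral_mono_of_nonneg (μ := μ) (f := fun y => tent (2 * M) y.2 * ∑ k, X.s k y.1 *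
      (f (shift k y.1) - f y.1) ^ 2 * min 1 ((|F y| + |F (shift k y)|) / L))
      ((ae_prod_count hs0).mono fun y h => mul_nonneg (tent_nonneg _ _)
        (Finset.sum_nonneg fun k _ => mul_nonneg (mul_nonneg (h k) (sq_nonneg _))
          (le_min zero_le_one (by positivity))))
      (integrable_finsetSum Finset.univ fun k _ => hG k)
      ((ae_prod_count hs0).mono fun y h => by
        dsimp only
        rw [Finset.mul_sum]
        refine Finset.sum_le_sum fun k _ => ?_
        have h1 : |F (shift k y)| ≤ |F y| + |f (shift k y.1) - f y.1| := by
          rw [← increment_shift_sub]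
          have := abs_add_le (F y) (F (shift k y) - F y)
          rwa [add_sub_cancel] at this
        have h2 := mul_le_mul_of_nonneg_left (edge_bad_le (t := θ k y.1) (h k) hL hQ h1 rfl
          (le_min zero_le_one (by positivity))) (tent_nonneg (2 * M) y.2)
        refine h2.trans (le_of_eq ?_)
        ring)
    refine hle.trans ?_
    rw [integral_finsetSum _ fun k _ => hG k, Finset.mul_sum]
    refine Finset.sum_le_sum fun k _ => ?_
    have i1 := (g1 k).const_mul 2
    have i2 := (g2 k).const_mul 2
    have i3 := (g3 k).const_mul (2 * Q / L)
    have i12 : Integrable (fun ω => 2 * (X.s k ω * (f (shift k ω) - f ω - θ k ω) ^ 2) +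
        2 * (if Q < X.s k ω * θ k ω ^ 2 then X.s k ω * θ k ω ^ 2 else 0)) π := i1.add i2
    have i123 : Integrable (fun ω => 2 * (X.s k ω * (f (shift k ω) - f ω - θ k ω) ^ 2) +
        2 * (if Q < X.s k ω * θ k ω ^ 2 then X.s k ω * θ k ω ^ 2 else 0) +
        2 * Q / L * |f (shift k ω) - f ω|) π := i12.add i3
    rw [integral_add (i123.mul_prod hit) (iF.const_mul _), integral_const_mul,
      integral_prod_mul (fun ω => 2 * (X.s k ω * (f (shift k ω) - f ω - θ k ω) ^ 2) +
        2 * (if Q < X.s k ω * θ k ω ^ 2 then X.s k ω * θ k ω ^ 2 else 0) +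
        2 * Q / L * |f (shift k ω) - f ω|) (tent (2 * M)),
      integral_add i12 i3, integral_add i1 i2, integral_const_mul, integral_const_mul,
      integral_const_mul]
    have := mul_le_mul_of_nonneg_left nF (show 0 ≤ 4 * Q / L by positivity)
    rw [← hw] at this ⊢
    linarith
  -- The slope `1 / (2M)` and the volume ratio `2 · 3^d` combine to `3^d / M`. The mass `w` of the
  -- tent then cancels from all the terms.
  have e4 : 1 / ((2 * M : ℕ) : ℝ) * ((∫ z, boxInd (d := d) (2 * M + 1) z ∂Measure.count) *
      ∫ ω, slopeTerm X.s X.h f L ω ∂π) ≤ w * (3 ^ d / M * ∫ ω, slopeTerm X.s X.h f L ω ∂π) := by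
    have h1 := mul_le_mul_of_nonneg_right (integral_boxInd_le (d := d) hM) hsl
    refine (mul_le_mul_of_nonneg_left h1 (by positivity)).trans (le_of_eq ?_)
    rw [← hw]
    push_cast
    field_simp
  refine le_of_mul_le_mul_left ?_ hw0
  linarith

end Rates

end RandomEnv

/-! ### Sublinearity and the iterated limit -/

namespace RandomEnv

-- With cut-off level `L = xM`, the limits are taken as `n → ∞`, `M → ∞`, `m → ∞`, `Q → ∞`, `x → 0`.
-- Sending `n` first kills the approximation errors, although `xM ε_n` is not uniform in `M`. The
-- factor `1 / M` absorbs the fixed `I m`, and then `δ m` removes the remaining linear growth. The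
-- stream term leaves `κ K x`, removed last.
open Topology in
theorem nonpos_of_iterated_bound {e K T κ c₀ D : ℝ} {A δ ε I τ : ℕ → ℝ}
    (hA : Tendsto A atTop (𝓝 0)) (hδ : Tendsto δ atTop (𝓝 0)) (hε : Tendsto ε atTop (𝓝 0))
    (hτ : Tendsto τ atTop (𝓝 0))
    (h : ∀ (n m M Q : ℕ) (x : ℝ), 0 < M → 0 < x → e ≤ 1 / 2 * A n + (x * M * ε n +
      κ / M * ((x * M + 1) * K) + (2 * A n + 2 * τ Q + 2 * Q / (x * M) * (δ n + T) +
        c₀ * (4 * Q / (x * M) * (2 * I m + D * M * (δ n + δ m)))))) : e ≤ 0 := by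
  have h1 : ∀ (m M Q : ℕ) (x : ℝ), 0 < M → 0 < x → e ≤ κ * K * x + κ * K * (1 / M) + 2 * τ Q +
      2 * Q * T / x * (1 / M) + c₀ * (8 * Q / x * I m * (1 / M) + 4 * Q * D / x * δ m) := by
    intro m M Q x hM hx
    have hM' : (0 : ℝ) < M := by exact_mod_cast hM
    have ht : Tendsto (fun n => 1 / 2 * A n + (x * M * ε n +
        κ / M * ((x * M + 1) * K) + (2 * A n + 2 * τ Q + 2 * Q / (x * M) * (δ n + T) +
        c₀ * (4 * Q / (x * M) * (2 * I m + D * M * (δ n + δ m)))))) atTop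
        (𝓝 (1 / 2 * 0 + (x * M * 0 +
        κ / M * ((x * M + 1) * K) + (2 * 0 + 2 * τ Q + 2 * Q / (x * M) * (0 + T) +
        c₀ * (4 * Q / (x * M) * (2 * I m + D * M * (0 + δ m))))))) :=
      (hA.const_mul _).add (((hε.const_mul _).add_const _).add ((((hA.const_mul 2).add_const _).add
        ((hδ.add_const T).const_mul _)).add (((((hδ.add_const _).const_mul _).const_add _).const_mul
          _).const_mul _)))
    refine (ge_of_tendsto' ht fun n => h n m M Q x hM hx).trans (le_of_eq ?_)
    field_simp
    ring
  have hM : Tendsto (fun M : ℕ => 1 / (M : ℝ)) atTop (𝓝 0) := tendsto_one_div_atTop_nhds_zero_nat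
  have h2 : ∀ (m Q : ℕ) (x : ℝ), 0 < x → e ≤ κ * K * x + κ * K * 0 + 2 * τ Q +
      2 * Q * T / x * 0 + c₀ * (8 * Q / x * I m * 0 + 4 * Q * D / x * δ m) := by
    intro m Q x hx
    have ht := ((((hM.const_mul (κ * K)).const_add (κ * K * x)).add_const (2 * τ Q)).add
      (hM.const_mul (2 * Q * T / x))).add (((hM.const_mul (8 * Q / x * I m)).add_const
        (4 * Q * D / x * δ m)).const_mul c₀)
    exact ge_of_tendsto ht ((eventually_gt_atTop 0).mono fun M hM => h1 m M Q x hM hx)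
  have h3 : ∀ (Q : ℕ) (x : ℝ), 0 < x → e ≤ κ * K * x + 2 * τ Q := by
    intro Q x hx
    have ht := ((hδ.const_mul (4 * Q * D / x)).const_mul c₀).const_add (κ * K * x + 2 * τ Q)
    rw [mul_zero, mul_zero, add_zero] at ht
    refine ge_of_tendsto' ht fun m => (h2 m Q x hx).trans (le_of_eq ?_)
    ring
  have h4 : ∀ x : ℝ, 0 < x → e ≤ κ * K * x := by
    intro x hx
    have ht := (hτ.const_mul 2).const_add (κ * K * x)
    rw [mul_zero, add_zero] at ht
    exact ge_of_tendsto' ht fun Q => h3 Q x hx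
  have ht : Tendsto (fun x : ℝ => κ * K * x) (𝓝[>] 0) (𝓝 (κ * K * 0)) :=
    (tendsto_id.mono_left nhdsWithin_le_nhds).const_mul _
  rw [mul_zero] at ht
  exact ge_of_tendsto ht (eventually_mem_nhdsWithin.mono fun x hx => h4 x hx)

open Topology in
theorem tendsto_integral_truncation {Ω : Type*} [MeasurableSpace Ω] {π : Measure Ω} {g : Ω → ℝ}
    (hg : Integrable g π) (hm : Measurable g) :
    Tendsto (fun Q : ℕ => ∫ ω, (if (Q : ℝ) < g ω then g ω else 0) ∂π) atTop (𝓝 0) := by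
  have := tendsto_integral_of_dominated_convergence (μ := π) (F := fun (Q : ℕ) ω =>
    if (Q : ℝ) < g ω then g ω else 0) (f := fun _ => 0) (fun ω => |g ω|)
    (fun Q => (Measurable.ite (measurableSet_lt measurable_const hm) hm
      measurable_const).aestronglyMeasurable) hg.abs
    (fun Q => Eventually.of_forall fun ω => by
      split_ifs
      · exact le_rfl
      · rw [norm_zero]; exact abs_nonneg _)
    (Eventually.of_forall fun ω => by
      obtain ⟨N, hN⟩ := exists_nat_ge (g ω)
      refine tendsto_const_nhds.congr' ((eventually_ge_atTop N).mono fun Q hQ => ?_)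
      exact (if_neg (not_lt.2 (hN.trans (Nat.cast_le.2 hQ)))).symm)
  simpa using this

namespace Rates

variable {d : ℕ} {Ω : Type*} [MeasurableSpace Ω] [AddAction (Fin d → ℤ) Ω]
  [MeasurableConstVAdd (Fin d → ℤ) Ω] {π : Measure Ω} [IsProbabilityMeasure π]
  [VAddInvariantMeasure (Fin d → ℤ) Ω π] (X : Rates d Ω π)

open Topology in
/-- Sublinearity of the corrector: an `L²` limit of gradients that solves the equation weakly has
zero energy. -/
theorem energy_limit_nonpos (hs : ∀ k, Integrable (X.s k) π) (hh : ∀ k l, Integrable (X.h k l) π)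
    {f : ℕ → Ω → ℝ} (hf : ∀ n, Measurable (f n)) (hb : ∀ n, ∃ C, ∀ ω, |f n ω| ≤ C)
    {c : ℝ} (hc : |c| = 1) {θ : Dir d → Ω → ℝ} (hθ : ∀ k, Measurable (θ k))
    (hθ1 : ∀ k, Integrable (θ k) π) (hθi : ∀ k, Integrable (fun ω => X.s k ω * θ k ω ^ 2) π)
    (h1 : ∀ k, Tendsto (fun n => ∫ ω, X.s k ω * (f n (shift k ω) - f n ω - θ k ω) ^ 2 ∂π) atTop
      (𝓝 0))
    (h2 : ∀ k, Tendsto (fun n => ∫ ω, |f n (shift k ω) - f n ω - θ k ω| ∂π) atTop (𝓝 0))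
    (h3 : Tendsto (fun n => ∫ ω, |∑ k, (X.s k ω + c * X.b k ω) * (f n (shift k ω) - f n ω)| ∂π)
      atTop (𝓝 0))
    (h4 : ∃ K, ∀ n, ∀ L ≥ 0, ∫ ω, slopeTerm X.s X.h (f n) L ω ∂π ≤ (L + 1) * K) :
    ∑ k, ∫ ω, X.s k ω * θ k ω ^ 2 ∂π ≤ 0 := by
  obtain ⟨K, hK⟩ := h4
  have hDm : ∀ n (k : Dir d), Measurable fun ω => f n (shift k ω) - f n ω := fun n k =>
    ((hf n).comp (measurable_shift k)).sub (hf n)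
  have hDi : ∀ n (k : Dir d), Integrable (fun ω => f n (shift k ω) - f n ω) π := fun n k => by
    obtain ⟨C, hC⟩ := hb n
    exact integrable_of_ae_abs_le (hDm n k).aestronglyMeasurable
      (Eventually.of_forall fun ω => abs_sub_le_two_mul hC _ _)
  have hdi : ∀ n (k : Dir d), Integrable (fun ω => |f n (shift k ω) - f n ω - θ k ω|) π :=
    fun n k => ((hDi n k).sub (hθ1 k)).abs
  have hfi : ∀ n, Integrable (f n) π := fun n => by
    obtain ⟨C, hC⟩ := hb n
    exact integrable_of_ae_abs_le (hf n).aestronglyMeasurable (Eventually.of_forall hC)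
  have hq : ∀ n k, Integrable (fun ω => X.s k ω * (f n (shift k ω) - f n ω) ^ 2) π := fun n k => by
    obtain ⟨C, hC⟩ := hb n
    exact (hs k).mul_bdd (c := (2 * C) ^ 2) ((hDm n k).pow_const 2).aestronglyMeasurable
      (Eventually.of_forall fun ω => by
        rw [norm_pow, Real.norm_eq_abs]
        exact pow_le_pow_left₀ (abs_nonneg _) (abs_sub_le_two_mul hC _ _) 2)
  have hs0 : ∀ᵐ ω ∂π, ∀ k, 0 ≤ X.s k ω := by
    filter_upwards [X.abs_b_le_s] with ω h k
    exact (abs_nonneg _).trans (h k)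
  set A : ℕ → ℝ := fun n => ∑ k, ∫ ω, X.s k ω * (f n (shift k ω) - f n ω - θ k ω) ^ 2 ∂π with hA
  set δ : ℕ → ℝ := fun n => ∑ k, ∫ ω, |f n (shift k ω) - f n ω - θ k ω| ∂π with hδ
  set τ : ℕ → ℝ := fun Q => ∑ k, ∫ ω, (if (Q : ℝ) < X.s k ω * θ k ω ^ 2 then
    X.s k ω * θ k ω ^ 2 else 0) ∂π with hτ
  have hA0 : Tendsto A atTop (𝓝 0) := by simpa using tendsto_finsetSum Finset.univ fun k _ => h1 k
  have hδ0 : Tendsto δ atTop (𝓝 0) := by simpa using tendsto_finsetSum Finset.univ fun k _ => h2 k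
  have hτ0 : Tendsto τ atTop (𝓝 0) := by
    simpa using tendsto_finsetSum Finset.univ fun k _ => tendsto_integral_truncation (hθi k)
      ((X.measurable_s k).mul ((hθ k).pow_const 2))
  have hδk : ∀ n k, ∫ ω, |f n (shift k ω) - f n ω - θ k ω| ∂π ≤ δ n := fun n k =>
    Finset.single_le_sum (f := fun k => ∫ ω, |f n (shift k ω) - f n ω - θ k ω| ∂π)
      (fun k _ => integral_nonneg fun _ => abs_nonneg _) (Finset.mem_univ k)
  -- Sublinearity: compared with the stationary `f_m`, whose increments stay bounded in `L¹`, the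
  -- difference `f_n - f_m` has a gradient of size `δ n + δ m` and grows at most linearly with that
  -- slope.
  have hinc : ∀ n m (z : Fin d → ℤ), ∫ ω, |f n ω - f n (-z +ᵥ ω)| ∂π ≤
      2 * ∫ ω, |f m ω| ∂π + d * ‖z‖ * (δ n + δ m) := by
    intro n m z
    have hg := (hfi n).sub (hfi m)
    have e1 := integral_abs_vadd_sub_le hg (δ := δ n + δ m) (fun k => by
      refine le_trans ?_ (add_le_add (hδk n k) (hδk m k))
      rw [← integral_add (hdi n k) (hdi m k)]
      refine integral_mono (integrable_vadd_sub hg k.vec).abs ((hdi n k).add (hdi m k)) fun ω => ?_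
      simp only [Pi.sub_apply]
      refine le_trans (le_of_eq ?_) (abs_sub _ _)
      congr 1
      rw [shift]
      ring) (-z)
    rw [norm_neg] at e1
    have e2 : ∫ ω, |f m (-z +ᵥ ω)| ∂π = ∫ ω, |f m ω| ∂π :=
      integral_vadd_eq_self (fun ω => |f m ω|)
    have i2 : Integrable (fun ω => |f m (-z +ᵥ ω)|) π :=
      ((measurePreserving_vadd (-z) π).integrable_comp_of_integrable (hfi m)).abs
    have i1 := (integrable_vadd_sub hg (-z)).abs
    have i3 : Integrable (fun ω => |f n ω - f n (-z +ᵥ ω)|) π := by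
      refine (integrable_vadd_sub (hfi n) (-z)).abs.congr (Eventually.of_forall fun ω => ?_)
      exact abs_sub_comm _ _
    have e3 := integral_mono i3 (i1.add ((hfi m).abs.add i2)) fun ω => by
      simp only [Pi.sub_apply, Pi.add_apply]
      have := abs_add_three (f n (-z +ᵥ ω) - f m (-z +ᵥ ω) - (f n ω - f m ω)) (f m (-z +ᵥ ω))
        (-f m ω)
      rw [abs_neg] at this
      rw [abs_sub_comm]
      refine le_trans (le_of_eq ?_) (this.trans (le_of_eq ?_))
      · congr 1; ring
      · ring
    rw [integral_add' i1 ((hfi m).abs.add i2), integral_add' (hfi m).abs i2, e2] at e3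
    linarith
  refine le_of_mul_le_mul_left (a := 1 / 4) ?_ (by norm_num)
  rw [mul_zero]
  refine nonpos_of_iterated_bound (K := K) (T := ∑ k, ∫ ω, |θ k ω| ∂π) (κ := 3 ^ d)
    (c₀ := Fintype.card (Dir d)) (D := 2 * d) (I := fun m => ∫ ω, |f m ω| ∂π) hA0 hδ0 h3 hτ0 ?_
  intro n m M Q x hM hx
  have hM' : (0 : ℝ) < M := by exact_mod_cast hM
  obtain ⟨C, hC⟩ := hb n
  have hL : 0 < x * M := by positivity
  obtain ⟨R, hR⟩ : ∃ R, R = 2 * ∫ ω, |f m ω| ∂π + 2 * d * M * (δ n + δ m) := ⟨_, rfl⟩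
  have est := X.energy_le hs hh (hf n) hC hM hc hL (Nat.cast_nonneg Q)
    (ρ := R) (fun z hz => by
      refine (hinc n m z).trans ?_
      have hnn : 0 ≤ δ n + δ m := add_nonneg
        (Finset.sum_nonneg fun k _ => integral_nonneg fun _ => abs_nonneg _)
        (Finset.sum_nonneg fun k _ => integral_nonneg fun _ => abs_nonneg _)
      push_cast at hz
      have : d * ‖z‖ * (δ n + δ m) ≤ d * (2 * M) * (δ n + δ m) := by gcongr
      linarith) hθ hθi
  simp only [Finset.sum_add_distrib, ← Finset.mul_sum] at est
  rw [Finset.sum_const, Finset.card_univ, nsmul_eq_mul, hR] at est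
  have e1 : ∑ k : Dir d, ∫ ω, |f n (shift k ω) - f n ω| ∂π ≤ δ n + ∑ k, ∫ ω, |θ k ω| ∂π := by
    rw [← Finset.sum_add_distrib]
    refine Finset.sum_le_sum fun k _ => ?_
    rw [← integral_add (hdi n k) (hθ1 k).abs]
    refine integral_mono (hDi n k).abs ((hdi n k).add (hθ1 k).abs) fun ω => ?_
    have := abs_add_le (f n (shift k ω) - f n ω - θ k ω) (θ k ω)
    rwa [sub_add_cancel] at this
  -- From `θ² ≤ 2 (∂f_n - θ)² + 2 (∂f_n)²`. This explains the factor `1 / 4` by which the claim was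
  -- multiplied.
  have e2 : 1 / 4 * ∑ k, ∫ ω, X.s k ω * θ k ω ^ 2 ∂π ≤
      1 / 2 * A n + 1 / 2 * ∫ ω, ∑ k, X.s k ω * (f n (shift k ω) - f n ω) ^ 2 ∂π := by
    rw [integral_finsetSum _ fun k _ => hq n k, ← mul_add, hA, ← Finset.sum_add_distrib,
      Finset.mul_sum, Finset.mul_sum]
    refine Finset.sum_le_sum fun k _ => ?_
    have g1 : Integrable (fun ω => X.s k ω * (f n (shift k ω) - f n ω - θ k ω) ^ 2) π := by
      refine (((hq n k).const_mul 2).add ((hθi k).const_mul 2)).mono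
        ((X.measurable_s k).mul (((hDm n k).sub (hθ k)).pow_const 2)).aestronglyMeasurable ?_
      filter_upwards [hs0] with ω h
      have h0 := h k
      rw [Real.norm_of_nonneg (by positivity)]
      refine le_trans ?_ (le_abs_self _)
      simp only [Pi.add_apply]
      nlinarith [mul_nonneg h0 (sq_nonneg (f n (shift k ω) - f n ω + θ k ω))]
    rw [← integral_add g1 (hq n k), ← integral_const_mul, ← integral_const_mul]
    refine integral_mono_ae ((hθi k).const_mul _) ((g1.add (hq n k)).const_mul _) ?_
    filter_upwards [hs0] with ω h
    nlinarith [mul_nonneg (h k) (sq_nonneg (2 * (f n (shift k ω) - f n ω) - θ k ω))]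
  have e3 := mul_le_mul_of_nonneg_left (hK n _ hL.le) (show (0 : ℝ) ≤ 3 ^ d / M by positivity)
  have e4 := mul_le_mul_of_nonneg_left e1 (show 0 ≤ 2 * Q / (x * M) by positivity)
  linarith

end Rates

end RandomEnv

/-! ### Weak solutions of the homogeneous equation -/

namespace RandomEnv

section CauchySchwarz

variable {Ω : Type*} [MeasurableSpace Ω] {π : Measure Ω}

theorem integral_abs_mul_le {a : Ω → ℝ} (ha : MemLp a 2 π) (w : Lp ℝ 2 π) :
    ∫ ω, |a ω * w ω| ∂π ≤ ‖ha.toLp a‖ * ‖w‖ := by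
  have h := real_inner_le_norm |ha.toLp a| |w|
  rw [norm_abs_eq_norm, norm_abs_eq_norm, L2.inner_def] at h
  refine le_trans (le_of_eq (integral_congr_ae ?_)) h
  filter_upwards [ha.coeFn_toLp, Lp.coeFn_abs (ha.toLp a), Lp.coeFn_abs w] with ω h1 h2 h3
  rw [RCLike.inner_apply, conj_trivial, h2, h3, h1, abs_mul, mul_comm]

theorem integral_sq_eq_norm_sq (w : Lp ℝ 2 π) : ∫ ω, w ω ^ 2 ∂π = ‖w‖ ^ 2 := by
  rw [← real_inner_self_eq_norm_sq, L2.inner_def]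
  exact integral_congr_ae (Eventually.of_forall fun ω => by
    simp only [RCLike.inner_apply, conj_trivial, sq])

end CauchySchwarz

namespace Rates

variable {d : ℕ} {Ω : Type*} [MeasurableSpace Ω] [AddAction (Fin d → ℤ) Ω]
  {π : Measure Ω} (X : Rates d Ω π)

/-- The gradient of which `w` is the rescaled field. -/
noncomputable def unscale (w : Fields d π) (k : Dir d) (ω : Ω) : ℝ := √2 * ((X.r k ω)⁻¹ * w k ω)

/-- The weak form `∑_k (b_k + c s_k) ∂_k` of the resolvent equation, on rescaled fields. -/
noncomputable def drift (c : ℝ) (w : Fields d π) (ω : Ω) : ℝ :=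
  ∑ k, (X.b k ω + c * X.s k ω) * X.unscale w k ω

theorem unscale_sub (v w : Fields d π) : ∀ᵐ ω ∂π, ∀ k,
    X.unscale (v - w) k ω = X.unscale v k ω - X.unscale w k ω := by
  filter_upwards [eventually_all.2 fun k => Lp.coeFn_sub (v k) (w k)] with ω h k
  rw [unscale, PiLp.sub_apply, h, Pi.sub_apply, unscale, unscale]
  ring

theorem s_mul_unscale (w : Fields d π) : ∀ᵐ ω ∂π, ∀ k,
    X.s k ω * X.unscale w k ω = √2 * (X.r k ω * w k ω) := by
  filter_upwards [X.r_pos, X.r_sq] with ω h1 h2 k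
  rw [← h2, unscale]
  have := (h1 k).ne'
  field_simp

theorem s_mul_abs_unscale (w : Fields d π) : ∀ᵐ ω ∂π, ∀ k,
    X.s k ω * |X.unscale w k ω| = √2 * |X.r k ω * w k ω| := by
  filter_upwards [X.s_mul_unscale w, X.r_sq] with ω h1 h2 k
  have hs : 0 ≤ X.s k ω := h2 k ▸ sq_nonneg _
  rw [← abs_of_nonneg hs, ← abs_mul, h1 k, abs_mul, abs_of_nonneg (Real.sqrt_nonneg 2)]

theorem s_mul_unscale_sq (w : Fields d π) : ∀ᵐ ω ∂π, ∀ k,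
    X.s k ω * X.unscale w k ω ^ 2 = 2 * w k ω ^ 2 := by
  filter_upwards [X.r_pos, X.r_sq] with ω h1 h2 k
  rw [← h2, unscale, mul_pow, Real.sq_sqrt zero_le_two]
  have := (h1 k).ne'
  field_simp

theorem integrable_s_mul_unscale_sq (w : Fields d π) (k : Dir d) :
    Integrable (fun ω => X.s k ω * X.unscale w k ω ^ 2) π := by
  refine ((Lp.memLp (w k)).integrable_sq.const_mul 2).congr ?_
  filter_upwards [X.s_mul_unscale_sq w] with ω h
  exact (h k).symm

theorem integral_s_mul_unscale_sq (w : Fields d π) (k : Dir d) :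
    ∫ ω, X.s k ω * X.unscale w k ω ^ 2 ∂π = 2 * ‖w k‖ ^ 2 := by
  rw [← integral_sq_eq_norm_sq, ← integral_const_mul]
  exact integral_congr_ae ((X.s_mul_unscale_sq w).mono fun ω h => h k)

theorem integrable_s_mul_unscale {k : Dir d} (hr : MemLp (X.r k) 2 π) (w : Fields d π) :
    Integrable (fun ω => X.s k ω * |X.unscale w k ω|) π := by
  refine ((hr.integrable_mul (Lp.memLp (w k))).abs.const_mul √2).congr ?_
  filter_upwards [X.s_mul_abs_unscale w] with ω h
  exact (h k).symm

theorem integral_s_mul_unscale_le {k : Dir d} (hr : MemLp (X.r k) 2 π) (w : Fields d π) :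
    ∫ ω, X.s k ω * |X.unscale w k ω| ∂π ≤ √2 * (‖hr.toLp (X.r k)‖ * ‖w k‖) := by
  refine le_trans (le_of_eq ?_) (mul_le_mul_of_nonneg_left (integral_abs_mul_le hr (w k))
    (Real.sqrt_nonneg 2))
  rw [← integral_const_mul]
  exact integral_congr_ae ((X.s_mul_abs_unscale w).mono fun ω h => h k)

theorem integrable_h_mul_unscale {k l : Dir d} (hh : MemLp (fun ω => (X.r l ω)⁻¹ * X.h k l ω) 2 π)
    (w : Fields d π) : Integrable (fun ω => |X.h k l ω| * |X.unscale w l ω|) π := by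
  refine ((hh.integrable_mul (Lp.memLp (w l))).abs.const_mul √2).congr
    (Eventually.of_forall fun ω => ?_)
  simp only [Pi.mul_apply, unscale, abs_mul, abs_of_nonneg (Real.sqrt_nonneg 2)]
  ring

theorem integral_h_mul_unscale_le {k l : Dir d} (hh : MemLp (fun ω => (X.r l ω)⁻¹ * X.h k l ω) 2 π)
    (w : Fields d π) : ∫ ω, |X.h k l ω| * |X.unscale w l ω| ∂π ≤
      √2 * (‖hh.toLp fun ω => (X.r l ω)⁻¹ * X.h k l ω‖ * ‖w l‖) := by
  refine le_trans (le_of_eq ?_) (mul_le_mul_of_nonneg_left (integral_abs_mul_le hh (w l))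
    (Real.sqrt_nonneg 2))
  rw [← integral_const_mul]
  refine integral_congr_ae (Eventually.of_forall fun ω => ?_)
  simp only [unscale, abs_mul, abs_of_nonneg (Real.sqrt_nonneg 2)]
  ring

theorem integrable_unscale {k : Dir d} (hr : MemLp (fun ω => (X.r k ω)⁻¹) 2 π) (w : Fields d π) :
    Integrable (X.unscale w k) π :=
  (hr.integrable_mul (Lp.memLp (w k))).const_mul √2

theorem integral_abs_unscale_le {k : Dir d} (hr : MemLp (fun ω => (X.r k ω)⁻¹) 2 π)
    (w : Fields d π) :
    ∫ ω, |X.unscale w k ω| ∂π ≤ √2 * (‖hr.toLp fun ω => (X.r k ω)⁻¹‖ * ‖w k‖) := by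
  refine le_trans (le_of_eq ?_) (mul_le_mul_of_nonneg_left (integral_abs_mul_le hr (w k))
    (Real.sqrt_nonneg 2))
  rw [← integral_const_mul]
  refine integral_congr_ae (Eventually.of_forall fun ω => ?_)
  simp only [unscale, abs_mul, abs_of_nonneg (Real.sqrt_nonneg 2)]

theorem drift_sub (c : ℝ) (v w : Fields d π) : ∀ᵐ ω ∂π,
    X.drift c (v - w) ω = X.drift c v ω - X.drift c w ω := by
  filter_upwards [X.unscale_sub v w] with ω h
  simp only [drift, h, mul_sub, Finset.sum_sub_distrib]

theorem integrable_s (hr : ∀ k, MemLp (X.r k) 2 π) (k : Dir d) : Integrable (X.s k) π :=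
  (hr k).integrable_sq.congr (X.r_sq.mono fun _ h => h k)

theorem integrable_h {k l : Dir d} (hr : MemLp (X.r l) 2 π)
    (hh : MemLp (fun ω => (X.r l ω)⁻¹ * X.h k l ω) 2 π) : Integrable (X.h k l) π := by
  refine (hr.integrable_mul hh).congr ?_
  filter_upwards [X.r_pos] with ω h
  rw [Pi.mul_apply, mul_inv_cancel_left₀ (h l).ne']

variable [MeasurableConstVAdd (Fin d → ℤ) Ω]

theorem measurable_unscale (w : Fields d π) (k : Dir d) : Measurable (X.unscale w k) :=
  ((X.measurable_r k).inv.mul (Lp.stronglyMeasurable (w k)).measurable).const_mul _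

theorem measurable_drift (c : ℝ) (w : Fields d π) : Measurable (X.drift c w) :=
  Finset.measurable_sum _ fun k _ =>
    ((X.measurable_b k).add ((X.measurable_s k).const_mul c)).mul (X.measurable_unscale w k)

section Invariant

variable [VAddInvariantMeasure (Fin d → ℤ) Ω π]

theorem abs_drift_le {c : ℝ} (hc : |c| = 1) (w : Fields d π) : ∀ᵐ ω ∂π,
    |X.drift c w ω| ≤ ∑ k, 2 * (X.s k ω * |X.unscale w k ω|) := by
  filter_upwards [X.abs_b_le_s] with ω h
  refine (Finset.abs_sum_le_sum_abs _ _).trans (Finset.sum_le_sum fun k _ => ?_)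
  have hs := (abs_nonneg _).trans (h k)
  rw [abs_mul, ← mul_assoc]
  refine mul_le_mul_of_nonneg_right ((abs_add_le _ _).trans ?_) (abs_nonneg _)
  rw [abs_mul, hc, one_mul, abs_of_nonneg hs]
  linarith [h k]

theorem integrable_drift (hr : ∀ k, MemLp (X.r k) 2 π) {c : ℝ} (hc : |c| = 1) (w : Fields d π) :
    Integrable (X.drift c w) π :=
  (integrable_finsetSum Finset.univ fun k _ => (X.integrable_s_mul_unscale (hr k) w).const_mul 2).mono'
    (X.measurable_drift c w).aestronglyMeasurable (X.abs_drift_le hc w)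

theorem integral_abs_drift_le (hr : ∀ k, MemLp (X.r k) 2 π) {c : ℝ} (hc : |c| = 1)
    (w : Fields d π) :
    ∫ ω, |X.drift c w ω| ∂π ≤ ∑ k, 2 * (√2 * (‖(hr k).toLp (X.r k)‖ * ‖w k‖)) := by
  have hi := fun k => (X.integrable_s_mul_unscale (hr k) w).const_mul 2
  refine (integral_mono_ae (X.integrable_drift hr hc w).abs
    (integrable_finsetSum Finset.univ fun k _ => hi k) (X.abs_drift_le hc w)).trans ?_
  rw [integral_finsetSum _ fun k _ => hi k]
  refine Finset.sum_le_sum fun k _ => ?_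
  rw [integral_const_mul]
  exact mul_le_mul_of_nonneg_left (X.integral_s_mul_unscale_le (hr k) w) zero_le_two

/-- The double difference involves the gradient at `τ_k ω`. Since `|h_{k,l}(ω)| = |h_{-k,l}(τ_k
ω)|`, invariance of `π` brings every product of `h` and a gradient to a common point. -/
theorem integral_slopeTerm_eq (hr : ∀ k, MemLp (X.r k) 2 π)
    (hh : ∀ k l, MemLp (fun ω => (X.r l ω)⁻¹ * X.h k l ω) 2 π) {f : Ω → ℝ} {w : Fields d π}
    (hf : ∀ k, ∀ᵐ ω ∂π, f (shift k ω) - f ω = X.unscale w k ω) (L : ℝ) :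
    ∫ ω, slopeTerm X.s X.h f L ω ∂π = ∑ k, (L / 2 * ∫ ω, X.s k ω * |X.unscale w k ω| ∂π +
      L / 4 * (∑ l, (∫ ω, |X.h k.opp l ω| * |X.unscale w l ω| ∂π +
        ∫ ω, |X.h k l ω| * |X.unscale w l ω| ∂π)) +
      1 / 4 * ∫ ω, X.s k ω * X.unscale w k ω ^ 2 ∂π) := by
  have i1 := fun k => (X.integrable_s_mul_unscale (hr k) w).const_mul (L / 2)
  have i2 := fun k l => X.integrable_h_mul_unscale (hh k l) w
  have i3 := fun k => (X.integrable_s_mul_unscale_sq w k).const_mul (1 / 4)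
  have i4 : ∀ k l, Integrable (fun ω => |X.h k.opp l (shift k ω)| * |X.unscale w l (shift k ω)|) π :=
    fun k l => integrable_comp_shift k (i2 k.opp l)
  have i45 : ∀ k l, Integrable (fun ω => |X.h k.opp l (shift k ω)| * |X.unscale w l (shift k ω)| +
      |X.h k l ω| * |X.unscale w l ω|) π := fun k l => (i4 k l).add (i2 k l)
  have i5 : ∀ k, Integrable (fun ω => L / 4 * (∑ l, (|X.h k.opp l (shift k ω)| *
      |X.unscale w l (shift k ω)| + |X.h k l ω| * |X.unscale w l ω|))) π := fun k =>
    (integrable_finsetSum Finset.univ fun l _ => i45 k l).const_mul (L / 4)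
  have i6 : ∀ k, Integrable (fun ω => L / 2 * (X.s k ω * |X.unscale w k ω|) +
      L / 4 * (∑ l, (|X.h k.opp l (shift k ω)| * |X.unscale w l (shift k ω)| +
        |X.h k l ω| * |X.unscale w l ω|))) π := fun k => (i1 k).add (i5 k)
  have e : ∀ᵐ ω ∂π, slopeTerm X.s X.h f L ω = ∑ k, (L / 2 * (X.s k ω * |X.unscale w k ω|) +
      L / 4 * (∑ l, (|X.h k.opp l (shift k ω)| * |X.unscale w l (shift k ω)| +
        |X.h k l ω| * |X.unscale w l ω|)) + 1 / 4 * (X.s k ω * X.unscale w k ω ^ 2)) := by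
    filter_upwards [eventually_all.2 hf, eventually_all.2 fun k : Dir d => shift_ae k (eventually_all.2 hf),
      eventually_all.2 fun k => eventually_all.2 (X.h_opp_left k)] with ω h1 h2 h3
    rw [slopeTerm]
    refine Finset.sum_congr rfl fun k _ => ?_
    simp only [h1, h2]
    congr 3
    refine Finset.sum_congr rfl fun l _ => ?_
    rw [mul_add, ← abs_neg (X.h k.opp l (shift k ω)), ← h3 k l]
  refine (integral_congr_ae e).trans
    ((integral_finsetSum Finset.univ fun k _ => (i6 k).add (i3 k)).trans ?_)
  refine Finset.sum_congr rfl fun k _ => ?_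
  refine (integral_add (i6 k) (i3 k)).trans ?_
  rw [integral_add (i1 k) (i5 k), integral_const_mul, integral_const_mul, integral_const_mul,
    integral_finsetSum Finset.univ fun l _ => i45 k l]
  congr 3
  refine Finset.sum_congr rfl fun l _ => ?_
  rw [integral_add (i4 k l) (i2 k l),
    integral_comp_shift k fun ω => |X.h k.opp l ω| * |X.unscale w l ω|]

/-- Cauchy-Schwarz pairs `r_k` and `h_{k,l} / r_l` in `L²` with the rescaled field. The bound
depends on the field only through its norm, so it is uniform along a convergent sequence. -/
theorem exists_slopeTerm_bound (hr : ∀ k, MemLp (X.r k) 2 π)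
    (hh : ∀ k l, MemLp (fun ω => (X.r l ω)⁻¹ * X.h k l ω) 2 π) (V : ℝ) :
    ∃ K, ∀ (f : Ω → ℝ) (w : Fields d π), ‖w‖ ≤ V →
      (∀ k, ∀ᵐ ω ∂π, f (shift k ω) - f ω = X.unscale w k ω) → ∀ L ≥ 0,
      ∫ ω, slopeTerm X.s X.h f L ω ∂π ≤ (L + 1) * K := by
  have hwk : ∀ (w : Fields d π) k, ‖w‖ ≤ V → ‖w k‖ ≤ V := fun w k hw =>
    (PiLp.norm_apply_le w k).trans hw
  obtain ⟨p, hp⟩ : ∃ p : Dir d → ℝ, ∀ k (w : Fields d π), ‖w‖ ≤ V →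
      ∫ ω, X.s k ω * |X.unscale w k ω| ∂π ≤ p k :=
    ⟨fun k => √2 * (‖(hr k).toLp (X.r k)‖ * V), fun k w hw =>
      (X.integral_s_mul_unscale_le (hr k) w).trans (mul_le_mul_of_nonneg_left
        (mul_le_mul_of_nonneg_left (hwk w k hw) (norm_nonneg _)) (Real.sqrt_nonneg 2))⟩
  obtain ⟨q, hq⟩ : ∃ q : Dir d → Dir d → ℝ, ∀ k l (w : Fields d π), ‖w‖ ≤ V →
      ∫ ω, |X.h k l ω| * |X.unscale w l ω| ∂π ≤ q k l :=
    ⟨fun k l => √2 * (‖(hh k l).toLp fun ω => (X.r l ω)⁻¹ * X.h k l ω‖ * V), fun k l w hw =>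
      (X.integral_h_mul_unscale_le (hh k l) w).trans (mul_le_mul_of_nonneg_left
        (mul_le_mul_of_nonneg_left (hwk w l hw) (norm_nonneg _)) (Real.sqrt_nonneg 2))⟩
  refine ⟨∑ k, (p k + ∑ l, (q k.opp l + q k l) + 2 * V ^ 2), fun f w hw hf L hL => ?_⟩
  rw [X.integral_slopeTerm_eq hr hh hf, Finset.mul_sum]
  refine Finset.sum_le_sum fun k _ => ?_
  have e1 := hp k w hw
  have e3 := Finset.sum_le_sum fun l (_ : l ∈ Finset.univ) =>
    add_le_add (hq k.opp l w hw) (hq k l w hw)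
  have e4 : ∫ ω, X.s k ω * X.unscale w k ω ^ 2 ∂π ≤ 2 * V ^ 2 := by
    rw [X.integral_s_mul_unscale_sq]
    exact mul_le_mul_of_nonneg_left (pow_le_pow_left₀ (norm_nonneg _) (hwk w k hw) 2) zero_le_two
  have p1 : 0 ≤ p k := by
    refine le_trans (integral_nonneg_of_ae ?_) e1
    filter_upwards [X.r_sq] with ω h
    exact mul_nonneg (h k ▸ sq_nonneg _) (abs_nonneg _)
  have p3 : 0 ≤ ∑ l, (q k.opp l + q k l) := le_trans (Finset.sum_nonneg fun l _ =>
    add_nonneg (integral_nonneg fun _ => by positivity)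
      (integral_nonneg fun _ => by positivity)) e3
  have q1 := mul_le_mul_of_nonneg_left e1 (show 0 ≤ L / 2 by positivity)
  have q3 := mul_le_mul_of_nonneg_left e3 (show 0 ≤ L / 4 by positivity)
  have r1 := mul_nonneg hL p1
  have r3 := mul_nonneg hL p3
  have r4 := mul_nonneg hL (show 0 ≤ 2 * V ^ 2 by positivity)
  linarith [sq_nonneg V]

end Invariant

open Topology in
/-- A weak solution of the homogeneous resolvent equation in the closure of the gradients
vanishes. -/
theorem eq_zero_of_weak_solution [IsProbabilityMeasure π] [ErgodicVAdd (Fin d → ℤ) Ω π] (hr : ∀ k, MemLp (X.r k) 2 π)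
    (hr' : ∀ k, MemLp (fun ω => (X.r k ω)⁻¹) 2 π)
    (hh : ∀ k l, MemLp (fun ω => (X.r l ω)⁻¹ * X.h k l ω) 2 π) {v : ℕ → Fields d π}
    {u : Fields d π} (hv : Tendsto v atTop (𝓝 u)) {f : ℕ → Ω → ℝ} (hfm : ∀ n, Measurable (f n))
    (hfb : ∀ n, ∃ C, ∀ ω, |f n ω| ≤ C)
    (hf : ∀ n k, ∀ᵐ ω ∂π, f n (shift k ω) - f n ω = X.unscale (v n) k ω) {c : ℝ} (hc : |c| = 1)
    (h0 : ∀ n, ∫ ω, X.drift c (v n) ω ∂π = 0)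
    (hg : ∀ g ∈ X.core, Tendsto (fun n => ∫ ω, X.drift c (v n) ω *
      ((g : CentredL2 π) : Lp ℝ 2 π) ω ∂π) atTop (𝓝 0)) : u = 0 := by
  have hvu : Tendsto (fun n => ‖v n - u‖) atTop (𝓝 0) := tendsto_iff_norm_sub_tendsto_zero.1 hv
  have hvk : ∀ k, Tendsto (fun n => ‖(v n - u) k‖) atTop (𝓝 0) := fun k =>
    squeeze_zero (fun n => norm_nonneg _) (fun n => PiLp.norm_apply_le (v n - u) k) hvu
  have hi := X.integrable_drift hr hc
  -- As `|b_k + c s_k| ≤ 2 s_k` and `s_k θ_k` is `√2 r_k` times the field, the drift is continuous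
  -- from `L²` fields to `L¹`.
  have hD : Tendsto (fun n => ∫ ω, |X.drift c (v n - u) ω| ∂π) atTop (𝓝 0) := by
    refine squeeze_zero (fun n => integral_nonneg fun _ => abs_nonneg _)
      (fun n => X.integral_abs_drift_le hr hc (v n - u)) ?_
    simpa using tendsto_finsetSum Finset.univ fun k _ =>
      (((hvk k).const_mul ‖(hr k).toLp (X.r k)‖).const_mul √2).const_mul 2
  have hlim : ∀ (g : Ω → ℝ) (C : ℝ), AEStronglyMeasurable g π → (∀ᵐ ω ∂π, |g ω| ≤ C) →
      Tendsto (fun n => ∫ ω, X.drift c (v n) ω * g ω ∂π) atTop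
        (𝓝 (∫ ω, X.drift c u ω * g ω ∂π)) := by
    intro g C hgm hgC
    rw [tendsto_iff_norm_sub_tendsto_zero]
    have hig := fun w => (hi w).mul_bdd hgm hgC
    have hC : Tendsto (fun n => (∫ ω, |X.drift c (v n - u) ω| ∂π) * C) atTop (𝓝 0) := by
      simpa using hD.mul_const C
    refine squeeze_zero (fun n => norm_nonneg _) (fun n => ?_) hC
    rw [← integral_sub (hig _) (hig _), ← integral_mul_const]
    refine (norm_integral_le_integral_norm _).trans (integral_mono_ae
      ((hig _).sub (hig _)).norm ((hi _).abs.mul_const C) ?_)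
    filter_upwards [hgC, X.drift_sub c (v n) u] with ω h1 h2
    rw [h2, ← sub_mul, norm_mul]
    exact mul_le_mul_of_nonneg_left h1 (norm_nonneg _)
  have hmean : ∫ ω, X.drift c u ω ∂π = 0 := by
    have := hlim (fun _ => 1) 1 aestronglyMeasurable_const (by simp)
    simp only [mul_one, h0] at this
    exact (tendsto_nhds_unique this tendsto_const_nhds)
  -- Orthogonality to the core makes the limit drift constant, and its mean is zero: the equation
  -- holds pointwise.
  have hdrift : ∀ᵐ ω ∂π, X.drift c u ω = 0 := by
    have := X.ae_eq_integral_of_orthogonal_core (hi u) fun g hgc => by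
      obtain ⟨C, hC⟩ := hgc.1
      exact tendsto_nhds_unique (hlim _ C (measurable_coe g).aestronglyMeasurable hC) (hg g hgc)
    rwa [hmean] at this
  obtain ⟨V, hV⟩ := hv.norm.bddAbove_range
  obtain ⟨K, hK⟩ := X.exists_slopeTerm_bound hr hh V
  have key := X.energy_limit_nonpos (X.integrable_s hr) (fun k l => X.integrable_h (hr l) (hh k l))
    hfm hfb hc (X.measurable_unscale u) (fun k => X.integrable_unscale (hr' k) u)
    (X.integrable_s_mul_unscale_sq u) (fun k => by
      have : Tendsto (fun n => 2 * ‖(v n - u) k‖ ^ 2) atTop (𝓝 0) := by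
        simpa using ((hvk k).pow 2).const_mul 2
      refine this.congr fun n => ?_
      rw [← X.integral_s_mul_unscale_sq]
      refine integral_congr_ae ?_
      filter_upwards [hf n k, X.unscale_sub (v n) u] with ω h1 h2
      rw [h1, h2])
    (fun k => by
      refine squeeze_zero (fun n => integral_nonneg fun _ => abs_nonneg _) (fun n => ?_)
        (g := fun n => √2 * (‖(hr' k).toLp fun ω => (X.r k ω)⁻¹‖ * ‖(v n - u) k‖)) ?_
      · refine le_trans (le_of_eq (integral_congr_ae ?_)) (X.integral_abs_unscale_le (hr' k) (v n - u))
        filter_upwards [hf n k, X.unscale_sub (v n) u] with ω h1 h2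
        rw [h1, h2]
      · simpa using ((hvk k).const_mul ‖(hr' k).toLp fun ω => (X.r k ω)⁻¹‖).const_mul √2)
    (by
      refine hD.congr fun n => integral_congr_ae ?_
      filter_upwards [eventually_all.2 (hf n), X.drift_sub c (v n) u, hdrift] with ω h1 h2 h3
      -- The energy estimate is stated for `s + c b` and the drift for `b + c s`; they differ by the
      -- factor `c`, as `c² = 1`.
      rw [h2, h3, sub_zero, drift, ← one_mul |∑ k, (X.s k ω + _) * _|, ← hc, ← abs_mul,
        Finset.mul_sum]
      congr 1
      refine Finset.sum_congr rfl fun k _ => ?_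
      have hc2 : c * c = 1 := by rw [← abs_mul_abs_self, hc, one_mul]
      rw [h1 k]
      linear_combination (-(X.b k ω * X.unscale (v n) k ω)) * hc2)
    ⟨K, fun n L hL => hK (f n) (v n) (hV ⟨n, rfl⟩) (hf n) L hL⟩
  simp only [X.integral_s_mul_unscale_sq] at key
  have hz := (Finset.sum_eq_zero_iff_of_nonneg fun k _ => by positivity).1
    (le_antisymm key (Finset.sum_nonneg fun k _ => by positivity))
  refine PiLp.ext fun k => ?_
  have := hz k (Finset.mem_univ k)
  rw [PiLp.zero_apply]
  simpa using this

end Rates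

end RandomEnv

/-! ### The operator `B` and the conclusion -/

namespace RandomEnv

namespace Rates

variable {d : ℕ} {Ω : Type*} [MeasurableSpace Ω] [AddAction (Fin d → ℤ) Ω]
  [MeasurableConstVAdd (Fin d → ℤ) Ω] {π : Measure Ω} [IsProbabilityMeasure π]

theorem unscale_grad [VAddInvariantMeasure (Fin d → ℤ) Ω π] (X : Rates d Ω π) {f : CentredL2 π}
    {v : Fields d π} (hv : (f, v) ∈ X.gradOp.graph) :
    ∀ᵐ ω ∂π, ∀ k, X.unscale v k ω = diff f k ω := by
  filter_upwards [eventually_all.2 (X.mem_graph_gradOp.1 hv).2, X.r_pos] with ω h1 h2 k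
  have := (h2 k).ne'
  rw [unscale, h1 k]
  field_simp

/-- The weak form of the resolvent equation for a function of the core. -/
theorem drift_grad [VAddInvariantMeasure (Fin d → ℤ) Ω π] (X : Rates d Ω π) {f a : CentredL2 π}
    {v : Fields d π} (hv : (f, v) ∈ X.gradOp.graph) (ha : (f, a) ∈ X.antisymOp.graph) (c : ℝ) :
    ∃ z : CentredL2 π, (∀ᵐ ω ∂π, X.drift c v ω = ((a - c • z : CentredL2 π) : Lp ℝ 2 π) ω) ∧
      ∀ g w, (g, w) ∈ X.gradOp.graph → ⟪z, g⟫_ℝ = ⟪v, w⟫_ℝ := by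
  obtain ⟨z, hz, -⟩ := X.exists_graph_symOp (X.mem_graph_gradOp.1 hv).1
  refine ⟨z, ?_, fun g w hw => ?_⟩
  · filter_upwards [X.unscale_grad hv, hz, (X.mem_graph_antisymOp.1 ha).2,
      Lp.coeFn_sub (a : Lp ℝ 2 π) ((c • z : CentredL2 π) : Lp ℝ 2 π),
      Lp.coeFn_smul c (z : Lp ℝ 2 π)] with ω h1 h2 h3 h4 h5
    rw [Submodule.coe_sub, h4, Pi.sub_apply, Submodule.coe_smul, h5, Pi.smul_apply, h2, h3,
      smul_eq_mul, drift]
    simp only [h1, add_mul, Finset.sum_add_distrib, mul_assoc, ← Finset.mul_sum]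
    ring
  · rw [X.inner_grad hv hw, X.integral_dirichlet (X.mem_graph_gradOp.1 hv).1
      (X.mem_graph_gradOp.1 hw).1, CentredL2.inner_eq, ← mul_assoc]
    rw [← integral_const_mul]
    refine integral_congr_ae (hz.mono fun ω h => ?_)
    dsimp only
    rw [h]
    ring

variable [ErgodicVAdd (Fin d → ℤ) Ω π] (X : Rates d Ω π)

theorem exists_graph_sqrtOp {f : CentredL2 π} (hf : f ∈ X.core) : ∃ x, (f, x) ∈ X.sqrtOp.graph :=
  LinearPMap.mem_domain_iff.1 (X.isGradientSqrt.domain_le_sqrt (by rwa [X.domain_gradOp]))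

theorem mem_graph_skewOp_adjoint {Λ : CentredL2 π →ₗᵢ[ℝ] Fields d π}
    (hΛ : ∀ a b u, (a, b) ∈ X.sqrtOp.graph → (a, u) ∈ X.gradOp.graph → Λ b = u)
    {f x : CentredL2 π} (hf : f ∈ X.core) (hx : (f, x) ∈ X.sqrtOp.graph) :
    ∃ w, (Λ x, w) ∈ X.streamOp.graph ∧
      (x, ContinuousLinearMap.adjoint Λ.toContinuousLinearMap w) ∈ X.skewOp.graph := by
  obtain ⟨u, hu⟩ := X.exists_graph_gradOp hf
  obtain ⟨a, ha⟩ := X.exists_graph_antisymOp hf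
  obtain ⟨w, hw⟩ := X.exists_graph_streamOp hu
  rw [hΛ f x u hx hu]
  exact ⟨w, hw, X.mem_graph_skewOp.2 ⟨f, a, hx, ha, X.sqrt_adjoint_stream hΛ hu hw ha⟩⟩

theorem domain_skewOp : X.skewOp.domain = X.sqrtCore := by
  obtain ⟨Λ, hΛ⟩ := X.isGradientSqrt.exists_isometry
  ext x
  rw [LinearPMap.mem_domain_iff, mem_sqrtCore]
  constructor
  · rintro ⟨y, hy⟩
    obtain ⟨f, a, h1, h2, -⟩ := X.mem_graph_skewOp.1 hy
    exact ⟨f, (X.mem_graph_antisymOp.1 h2).1, h1⟩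
  · rintro ⟨f, hf, hx⟩
    obtain ⟨w, -, hw⟩ := X.mem_graph_skewOp_adjoint hΛ hf hx
    exact ⟨_, hw⟩

theorem skewOp_skew {x y x' y' : CentredL2 π} (h : (x, y) ∈ X.skewOp.graph)
    (h' : (x', y') ∈ X.skewOp.graph) : ⟪y, x'⟫_ℝ = -⟪x, y'⟫_ℝ := by
  obtain ⟨f, a, h1, h2, h3⟩ := X.mem_graph_skewOp.1 h
  obtain ⟨f', a', h1', h2', h3'⟩ := X.mem_graph_skewOp.1 h'
  rw [← X.isGradientSqrt.symm h3 h1', X.isGradientSqrt.symm h1 h3', X.antisymOp_skew h2 h2']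

/-- If `ψ` is orthogonal to the range of `B + c`, then `Λψ` is a limit of gradients of core
functions and solves the homogeneous equation weakly. Hence it vanishes by
`eq_zero_of_weak_solution`, and so does `ψ`. -/
theorem isEssentiallySkewSelfAdjoint_skewOp (hr : ∀ k, MemLp (X.r k) 2 π)
    (hr' : ∀ k, MemLp (fun ω => (X.r k ω)⁻¹) 2 π)
    (hh : ∀ k l, MemLp (fun ω => (X.r l ω)⁻¹ * X.h k l ω) 2 π) :
    IsEssentiallySkewSelfAdjoint X.skewOp := by
  obtain ⟨Λ, hΛ⟩ := X.isGradientSqrt.exists_isometry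
  refine isEssentiallySkewSelfAdjoint_of_dense_range ?_
    (fun x y => X.skewOp_skew (X.skewOp.mem_graph x) (X.skewOp.mem_graph y)) fun c hc ψ hψ => ?_
  · rw [X.domain_skewOp]
    exact X.dense_sqrtCore
  obtain ⟨x, hx, hlim⟩ := mem_closure_iff_seq_limit.1 (X.dense_sqrtCore ψ)
  choose f hf hfx using fun n => X.mem_sqrtCore.1 (hx n)
  choose v hv using fun n => X.exists_graph_gradOp (hf n)
  choose a ha using fun n => X.exists_graph_antisymOp (hf n)
  choose z hz hzg using fun n => X.drift_grad (hv n) (ha n) c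
  choose C hC using fun n => (hf n).1
  have hΛx : ∀ n, Λ (x n) = v n := fun n => hΛ _ _ _ (hfx n) (hv n)
  have hvlim : Tendsto v atTop (nhds (Λ ψ)) := by
    simpa only [Function.comp_def, hΛx] using (Λ.continuous.tendsto ψ).comp hlim
  -- Clamping at the essential bound gives a representative of `f n` that is bounded everywhere, as
  -- the energy estimate requires.
  have hclamp : ∀ n, ∀ᵐ ω ∂π, clamp |C n| ((f n : Lp ℝ 2 π) ω) = (f n : Lp ℝ 2 π) ω := fun n =>
    (hC n).mono fun ω h => clamp_of_abs_le (h.trans (le_abs_self _))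
  have hu := X.eq_zero_of_weak_solution hr hr' hh hvlim
    (f := fun n ω => clamp |C n| ((f n : Lp ℝ 2 π) ω))
    (fun n => (continuous_clamp _).measurable.comp (measurable_coe (f n)))
    (fun n => ⟨|C n|, fun ω => abs_clamp_le (abs_nonneg _) _⟩)
    (fun n k => by
      filter_upwards [hclamp n, shift_ae k (hclamp n), X.unscale_grad (hv n)] with ω h1 h2 h3
      rw [h1, h2, h3, diff]) hc
    (fun n => by
      rw [integral_congr_ae (hz n)]
      exact CentredL2.integral_eq_zero _)
    (fun g hg => by
      obtain ⟨y, hy⟩ := X.exists_graph_sqrtOp hg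
      obtain ⟨u, hu⟩ := X.exists_graph_gradOp hg
      obtain ⟨w, -, hw⟩ := X.mem_graph_skewOp_adjoint hΛ hg hy
      set q := ContinuousLinearMap.adjoint Λ.toContinuousLinearMap w
      have h0 : ⟪ψ, q + c • y⟫_ℝ = 0 := by
        obtain ⟨y', h1, h2⟩ := (LinearPMap.mem_graph_iff _).1 hw
        dsimp only at h1 h2
        rw [← h1, ← h2]
        exact hψ y'
      -- With `y = S^{1/2} g` and `q = B y`, the drift tested against `g` is `⟪A f_n - c S f_n, g⟫ =
      -- -⟪x_n, q + c y⟫`, which tends to `-⟪ψ, (B + c) y⟫ = 0`.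
      have ht : Tendsto (fun n => -⟪x n, q + c • y⟫_ℝ) atTop (nhds (-⟪ψ, q + c • y⟫_ℝ)) :=
        (hlim.inner tendsto_const_nhds).neg
      rw [h0, neg_zero] at ht
      refine ht.congr fun n => ?_
      have e1 : ⟪x n, q⟫_ℝ = -⟪a n, g⟫_ℝ := by
        obtain ⟨g', e, h1, h2, h3⟩ := X.mem_graph_skewOp.1 hw
        have : g' = g := by
          have := X.isGradientSqrt.injective (x := g' - g)
            (by simpa using X.sqrtOp.graph.sub_mem h1 hy)
          exact sub_eq_zero.1 this
        subst this
        rw [X.isGradientSqrt.symm (hfx n) h3, X.antisymOp_skew (ha n) h2, neg_neg]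
      have e2 : ⟪x n, y⟫_ℝ = ⟪z n, g⟫_ℝ := by
        rw [hzg n g u hu, ← hΛx, ← hΛ _ _ _ hy hu, Λ.inner_map_map]
      have e3 : ∫ ω, X.drift c (v n) ω * (g : Lp ℝ 2 π) ω ∂π = ⟪a n - c • z n, g⟫_ℝ := by
        rw [CentredL2.inner_eq]
        exact integral_congr_ae ((hz n).mono fun ω h => by dsimp only; rw [h])
      have e4 : ⟪x n, c • y⟫_ℝ = c * ⟪x n, y⟫_ℝ := real_inner_smul_right (x n) y c
      have e5 : ⟪c • z n, g⟫_ℝ = c * ⟪z n, g⟫_ℝ := real_inner_smul_left (z n) g c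
      rw [e3, inner_add_right, e4, e1, e2, inner_sub_left, e5]
      ring)
  exact Λ.injective (hu.trans (map_zero Λ).symm)

end Rates

end RandomEnv

theorem mainTheorem2 {d : ℕ} {Ω : Type*} [MeasurableSpace Ω] [AddAction (Fin d → ℤ) Ω]
    [MeasurableConstVAdd (Fin d → ℤ) Ω] (π : MeasureTheory.Measure Ω)
    [MeasureTheory.IsProbabilityMeasure π] [ErgodicVAdd (Fin d → ℤ) Ω π]
    (X : RandomEnv.Rates d Ω π) (hr : ∀ k, MeasureTheory.MemLp (X.r k) 2 π) :
    -- `R∇` and `A` map `𝒜` into square integrable fields and centred `L²` functions, respectively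
    X.gradOp.domain = X.core ∧
    X.antisymOp.domain = X.core ∧
    -- `S` is self-adjoint and acts by its pointwise formula on `𝒜`
    IsSelfAdjoint X.symOp ∧
    (∀ g ∈ X.core, ∃ hg : g ∈ X.symOp.domain,
      ((X.symOp ⟨g, hg⟩ : RandomEnv.CentredL2 π) : MeasureTheory.Lp ℝ 2 π) =ᵐ[π]
        fun ω => -∑ k, X.s k ω * RandomEnv.Rates.diff g k ω) ∧
    -- `S^{1/2}` exists and is injective, so that `S^{-1/2}` is defined, and `𝒜 ⊆ Dom S^{1/2}`
    RandomEnv.IsPositiveSqrt X.symOp X.sqrtOp ∧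
    X.sqrtOp.toFun.ker = ⊥ ∧
    X.core ≤ X.sqrtOp.domain ∧
    -- `𝒞` is dense and is the domain of `B = S^{-1/2} A S^{-1/2}`
    Dense (X.sqrtCore : Set (RandomEnv.CentredL2 π)) ∧
    X.skewOp.domain = X.sqrtCore ∧
    -- the Riesz isometry `Λ = R∇S^{-1/2}`, and `B = Λ* R⁻¹HR⁻¹ Λ` on `𝒞`
    (∃ Λ : RandomEnv.CentredL2 π →ₗᵢ[ℝ] RandomEnv.Fields d π,
      (∀ (g : X.sqrtOp.domain) (hg : (g : RandomEnv.CentredL2 π) ∈ X.gradOp.domain),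
        Λ (X.sqrtOp g) = X.gradOp ⟨g, hg⟩) ∧
      ∀ f : X.skewOp.domain, ∃ hf : Λ f ∈ X.streamOp.domain,
        X.skewOp f = ContinuousLinearMap.adjoint Λ.toContinuousLinearMap
          (X.streamOp ⟨Λ f, hf⟩)) ∧
    -- `B` is skew-symmetric
    (∀ f g : X.skewOp.domain,
      inner ℝ (X.skewOp f) (g : RandomEnv.CentredL2 π) =
        -inner ℝ (f : RandomEnv.CentredL2 π) (X.skewOp g)) ∧
    -- essential skew-self-adjointness
    ((∀ k, MeasureTheory.MemLp (fun ω => (X.r k ω)⁻¹) 2 π) →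
      (∀ k l, MeasureTheory.MemLp (fun ω => (X.r l ω)⁻¹ * X.h k l ω) 2 π) →
      RandomEnv.IsEssentiallySkewSelfAdjoint X.skewOp) := by
  have hG := X.isGradientSqrt
  obtain ⟨Λ, hΛ⟩ := hG.exists_isometry
  refine ⟨X.domain_gradOp, X.domain_antisymOp, X.isAccretiveSymm_symOp.isSelfAdjoint,
    fun g hg => ?_, hG.sqrt, hG.ker_eq_bot, ?_, X.dense_sqrtCore, X.domain_skewOp,
    ⟨Λ, fun g hg => hΛ _ _ _ (X.sqrtOp.mem_graph g) (X.gradOp.mem_graph ⟨g, hg⟩), fun f => ?_⟩,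
    fun f g => X.skewOp_skew (X.skewOp.mem_graph f) (X.skewOp.mem_graph g),
    X.isEssentiallySkewSelfAdjoint_skewOp hr⟩
  · obtain ⟨z, hz, hgz⟩ := X.exists_graph_symOp hg
    have hgd := LinearPMap.mem_domain_of_mem_graph hgz
    refine ⟨hgd, ?_⟩
    rw [LinearPMap.mem_graph_snd_inj _ (X.symOp.mem_graph ⟨g, hgd⟩) hgz rfl]
    exact hz
  · rw [← X.domain_gradOp]
    exact hG.domain_le_sqrt
  · obtain ⟨g, hg, hgf⟩ := X.mem_sqrtCore.1 (X.domain_skewOp.le f.2)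
    obtain ⟨w, hw, hfw⟩ := X.mem_graph_skewOp_adjoint hΛ hg hgf
    have hd := LinearPMap.mem_domain_of_mem_graph hw
    refine ⟨hd, ?_⟩
    rw [LinearPMap.mem_graph_snd_inj _ (X.streamOp.mem_graph ⟨Λ f, hd⟩) hw rfl]
    exact LinearPMap.mem_graph_snd_inj _ (X.skewOp.mem_graph f) hfw rfl
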